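/- **Setting.** Let $k$ be a trivially valued field, $M$ a finitely generated free abelian group, $N_{\mathbb R}=\mathrm{Hom}(M,\mathbb R)$ and $\Delta$ a (nonempty, finite) rational polyhedral fan of strictly convex cones in $N_{\mathbb R}$. For $\sigma\in\Delta$ put $S_\sigma=\sigma^\vee\cap M$ and $U_\sigma=\mathrm{Spec}\,k[S_\sigma]$; let $X=X(\Delta)$ be the toric variety glued from the $U_\sigma$, with big torus $T=\mathrm{Spec}\,k[M]$. Write $\mathbb R_{\ge0}=[0,\infty)$, $\overline{\mathbb R}_{\ge 0}=[0,\infty]$ (additive monoids), $\overline{\mathbb R}=\mathbb R\cup\{\infty\}$. *Kato fan.* Endow $X$ with the divisorial logarithmic structure $M_\Delta(U)=\{f\in\mathcal O_X(U): f|_{U\cap T}\text{ is invertible}\}$, and put $\overline{\mathcal O}_X=M_\Delta/\mathcal O_X^*$. For a monoid $P$, $\mathrm{Spec}\,P$ is the set of prime ideals of $P$ (including $\emptyset$) with its sheaf of sharp monoids, whose stalk at $\mathfrak p$ is $P_{\mathfrak p}/P_{\mathfrak p}^*$. A fine and saturated Kato fan is a quasi-compact locally monoidal space locally isomorphic to $\mathrm{Spec}\,P$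 with $P$ fine and saturated. A morphism of locally monoidal spaces is strict if it induces isomorphisms on stalks. The characteristic morphism of $X$ is the initial strict morphism $\phi_X:(X,\overline{\mathcal O}_X)\to F_X$ to a fine and saturated Kato fan: every strict morphism from $(X,\overline{\mathcal O}_X)$ to such a Kato fan $G$ factors through $\phi_X$ by a unique strict morphism $F_X\to G$. *Cone complexes.* $\Sigma_X=\mathrm{Hom}(\mathrm{Spec}\,\mathbb R_{\ge0},F_X)\subseteq\overline\Sigma_X=\mathrm{Hom}(\mathrm{Spec}\,\overline{\mathbb R}_{\ge0},F_X)$, with the weak topology: a subset is closed if and only if for every open affine $\mathrm{Spec}\,P\subseteq F_X$ its intersection with $\mathrm{Hom}(P,\mathbb R_{\ge0})$, respectively $\mathrm{Hom}(P,\overline{\mathbb R}_{\ge0})$, is closed for the topology of pointwise convergence. *Tropicalization of the logarithmic scheme.* $X^{an}$ is the set of pairs of a point $\xi\in X$ and an absolute value $|\cdot|$ on its residue field extending the trivial one on $k$. $X^\beth$ is the set of such points together with a center $c=r(x)\in X$: a specialization of $\xi$ such that $|f|\le1$ for all $f\in\mathcal O_{X,c}$, with $|f|<1$ exactly if $f$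 is not a unit. For $x\in X^\beth$, $\mathrm{trop}_X(x)\in\overline\Sigma_X$ is the morphism $\mathrm{Spec}\,\overline{\mathbb R}_{\ge0}\to F_X$ that sends the closed point to $\phi_X(r(x))$ and is given on stalks at the closed point by $\mathcal O_{F_X,\phi_X(r(x))}\to\overline{\mathcal O}_{X,r(x)}\to\overline{\mathbb R}_{\ge0}$, where the second map is $s\mapsto-\log|s|_x$. *Kajiwara–Payne tropicalization.* $N_{\mathbb R}(\Delta)$ is glued from the spaces $N_{\mathbb R}(\sigma)=\mathrm{Hom}(S_\sigma,\overline{\mathbb R})$ (pointwise convergence) along $N_{\mathbb R}(\tau)\subseteq N_{\mathbb R}(\sigma)$ for faces $\tau$ of $\sigma$; it contains $N_{\mathbb R}=N_{\mathbb R}(0)$. The map $\mathrm{trop}_\Delta:X^{an}\to N_{\mathbb R}(\Delta)$ sends $x\in U_\sigma^{an}$ to $(m\mapsto-\log|\chi^m|_x)\in N_{\mathbb R}(\sigma)$. **Proposition.** The characteristic morphism $\phi_X:(X,\overline{\mathcal O}_X)\to F_X$ exists, and the following hold. 1. $\Sigma_X=\Delta$ as cone complexes: there are open immersions $j_\sigma:\mathrm{Spec}\,S_\sigma\to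 F_X$ ($\sigma\in\Delta$) with $\phi_X^{-1}(\mathrm{im}\,j_\sigma)=U_\sigma$ such that every open affine of $F_X$ is the image of $j_\sigma$ for exactly one $\sigma$, and there is a homeomorphism $e:\Sigma_X\to|\Delta|\subseteq N_{\mathbb R}$ that for each $\sigma$ maps the cone $\mathrm{Hom}(S_\sigma,\mathbb R_{\ge0})$ of $\Sigma_X$ onto $\sigma$, with $\langle e(g),m\rangle=g(m)$ for all $g\in \mathrm{Hom}(S_\sigma,\mathbb R_{\ge0})$ and $m\in S_\sigma$. 2. $\overline\Sigma_X$ is the closure of $\Delta$ in $N_{\mathbb R}(\Delta)$: $e$ extends to a topological embedding $\overline e:\overline\Sigma_X\to N_{\mathbb R}(\Delta)$ with image $\overline{|\Delta|}$, given on $\mathrm{Hom}(S_\sigma,\overline{\mathbb R}_{\ge0})$ by the inclusion into $N_{\mathbb R}(\sigma)$. 3. For every $x\in X^\beth$ there is exactly one morphism $\mathrm{trop}_X(x)$ as described, the map $X^\beth\to X^{an}$ is injective, and $\overline e(\mathrm{trop}_X(x))=\mathrm{trop}_\Delta(x)$ for all $x\in X^\beth$; that is, $\mathrm{trop}_X$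 is the restriction of $\mathrm{trop}_\Delta$ to $X^\beth$. -/

import Mathlib

open CategoryTheory AlgebraicGeometry TopologicalSpace Opposite

universe u v w

noncomputable section

namespace LogTrop

/-! ### Rational polyhedral cones and fans -/

section Fans

variable (M : Type u) [AddCommGroup M]

/-- `N_ℝ = Hom(M, ℝ)`, for a lattice `M` with dual lattice `N = Hom(M, ℤ)`. -/
abbrev NR : Type u := M →+ ℝ

variable {M}

/-- `N_ℝ` carries the topology of pointwise convergence on `M`, its topology as a
finite-dimensional real vector space. -/
instance : TopologicalSpace (NR M) := TopologicalSpace.induced (fun u m => u m) inferInstance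

/-- The inclusion `N = Hom(M, ℤ) → N_ℝ`. -/
def latticePoint (v : M →+ ℤ) : NR M := (Int.castAddHom ℝ).comp v

/-- `σ` is a strictly convex rational polyhedral cone: it is generated by finitely many lattice
vectors and contains no line. -/
structure IsRationalCone (σ : PointedCone ℝ (NR M)) : Prop where
  generated : ∃ s : Finset (M →+ ℤ), σ = PointedCone.hull ℝ (latticePoint '' (s : Set (M →+ ℤ)))
  strictlyConvex : ∀ u ∈ σ, -u ∈ σ → u = 0

/-- The monoid `S_σ = σ^∨ ∩ M`. -/
def dualMonoid (σ : PointedCone ℝ (NR M)) : AddSubmonoid M where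
  carrier := {m | ∀ u ∈ σ, 0 ≤ u m}
  zero_mem' := fun u _ => by simp
  add_mem' := fun ha hb u hu => by
    rw [map_add]; exact add_nonneg (ha u hu) (hb u hu)

/-- `τ` is a face of `σ`: it is cut out by a supporting hyperplane `m^⊥`, `m ∈ S_σ`. -/
def IsFace (τ σ : PointedCone ℝ (NR M)) : Prop :=
  ∃ m ∈ dualMonoid σ, ∀ u, u ∈ τ ↔ u ∈ σ ∧ u m = 0

variable (M) in
/-- A rational polyhedral fan in `N_ℝ`. (For a collection of strictly convex cones that is closed
under faces, `zero_mem` says that it is nonempty.) -/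
structure Fan where
  cones : Set (PointedCone ℝ (NR M))
  finite : cones.Finite
  zero_mem : ⊥ ∈ cones
  rational : ∀ σ ∈ cones, IsRationalCone σ
  face_mem : ∀ σ ∈ cones, ∀ τ, IsFace τ σ → τ ∈ cones
  inter_face : ∀ σ ∈ cones, ∀ τ ∈ cones, IsFace (σ ⊓ τ) σ

/-- The cones of the fan `Δ`, ordered by inclusion. -/
abbrev Fan.Cone (Δ : Fan M) : Type u := {σ : PointedCone ℝ (NR M) // σ ∈ Δ.cones}

/-- The support `|Δ|`. -/
def Fan.support (Δ : Fan M) : Set (NR M) := {u | ∃ σ ∈ Δ.cones, u ∈ σ}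

/-- The monoid `S_σ` of a cone of a fan. -/
abbrev Fan.S {Δ : Fan M} (σ : Δ.Cone) : AddSubmonoid M := dualMonoid σ.1

theorem Fan.S_anti {Δ : Fan M} {σ τ : Δ.Cone} (h : σ ≤ τ) : Fan.S τ ≤ Fan.S σ :=
  fun _ hm u hu => hm u (h hu)

theorem Fan.isFace_of_le {Δ : Fan M} {σ τ : Δ.Cone} (h : σ ≤ τ) : IsFace σ.1 τ.1 := by
  have := Δ.inter_face τ.1 τ.2 σ.1 σ.2
  rwa [inf_eq_right.mpr h] at this

/-- The zero cone of a fan. -/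
def Fan.zeroCone (Δ : Fan M) : Δ.Cone := ⟨⊥, Δ.zero_mem⟩

/-- If `τ = σ ∩ m^⊥` is a face of `σ`, then `S_τ = S_σ + ℕ (-m)`. -/
theorem exists_add_nsmul_mem {σ τ : PointedCone ℝ (NR M)} (hσ : IsRationalCone σ) {m : M}
    (hm : m ∈ dualMonoid σ) (hτ : ∀ u, u ∈ τ ↔ u ∈ σ ∧ u m = 0) {w : M}
    (hw : w ∈ dualMonoid τ) : ∃ n : ℕ, w + n • m ∈ dualMonoid σ := by
  classical
  obtain ⟨⟨s, hs⟩, -⟩ := hσ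
  have hgen : ∀ v ∈ s, latticePoint v ∈ σ := fun v hv => by
    rw [hs]; exact Submodule.subset_span ⟨v, hv, rfl⟩
  have key : ∀ v ∈ s, ∃ n : ℕ, ∀ n' ≥ n, 0 ≤ latticePoint v (w + n' • m) := by
    intro v hv
    have h0 : 0 ≤ latticePoint v m := hm _ (hgen v hv)
    rcases h0.eq_or_lt with h0 | h0
    · refine ⟨0, fun n' _ => ?_⟩
      rw [map_add, map_nsmul, ← h0, smul_zero, add_zero]
      exact hw _ ((hτ _).2 ⟨hgen v hv, h0.symm⟩)
    · obtain ⟨n, hn⟩ := exists_nat_ge (-(latticePoint v w) / latticePoint v m)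
      refine ⟨n, fun n' hn' => ?_⟩
      rw [map_add, map_nsmul, nsmul_eq_mul]
      rw [div_le_iff₀ h0] at hn
      have : (n : ℝ) * latticePoint v m ≤ n' * latticePoint v m := by gcongr
      linarith
  choose! f hf using key
  refine ⟨s.sup f, fun u hu => ?_⟩
  rw [hs] at hu
  induction hu using Submodule.span_induction with
  | mem x hx =>
    obtain ⟨v, hv, rfl⟩ := hx
    exact hf v hv _ (Finset.le_sup (f := f) hv)
  | zero => simp
  | add x y _ _ hx hy => exact add_nonneg hx hy
  | smul a x _ hx => exact mul_nonneg a.2 hx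

end Fans


/-! ### Toric varieties -/

section Toric

variable (k : Type u) [Field k] {M : Type u} [AddCommGroup M] (Δ : Fan M)

/-- The homomorphism `k[S_τ] → k[S_σ]` for cones `σ ⊆ τ` of a fan. -/
def chartHom {σ τ : Δ.Cone} (h : σ ≤ τ) :
    AddMonoidAlgebra k (Fan.S τ) →+* AddMonoidAlgebra k (Fan.S σ) :=
  AddMonoidAlgebra.mapDomainRingHom k (AddSubmonoid.inclusion (Fan.S_anti h))

/-- The diagram of the affine toric varieties `U_σ = Spec k[S_σ]`, `σ ∈ Δ`. -/
def toricDiagram : Δ.Cone ⥤ Scheme.{u} where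
  obj σ := Spec (.of (AddMonoidAlgebra k (Fan.S σ)))
  map {σ τ} f := Spec.map (CommRingCat.ofHom (chartHom k Δ f.le))
  map_id σ := by
    rw [← Spec.map_id]
    congr 1
    have : chartHom k Δ (le_refl σ) = RingHom.id _ := AddMonoidAlgebra.mapDomainRingHom_id
    exact congrArg CommRingCat.ofHom this
  map_comp {σ τ ρ} f g := by
    rw [← Spec.map_comp]
    congr 1
    have : chartHom k Δ (f ≫ g).le = (chartHom k Δ f.le).comp (chartHom k Δ g.le) :=
      AddMonoidAlgebra.mapDomainRingHom_comp
        (AddSubmonoid.inclusion (Fan.S_anti f.le)) (AddSubmonoid.inclusion (Fan.S_anti g.le))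
    exact congrArg CommRingCat.ofHom this

theorem chartHom_single {σ τ : Δ.Cone} (h : σ ≤ τ) (m : Fan.S τ) (a : k) :
    chartHom k Δ h (AddMonoidAlgebra.single m a) =
      AddMonoidAlgebra.single (AddSubmonoid.inclusion (Fan.S_anti h) m) a := by
  simp [chartHom]

theorem chartHom_injective {σ τ : Δ.Cone} (h : σ ≤ τ) : Function.Injective (chartHom k Δ h) :=
  AddMonoidAlgebra.mapDomain_injective (AddSubmonoid.inclusion_injective (Fan.S_anti h))

theorem chartHom_pow {σ τ : Δ.Cone} (h : σ ≤ τ) {m : M} (hm : m ∈ Fan.S τ) (n : ℕ) :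
    chartHom k Δ h (AddMonoidAlgebra.single (⟨m, hm⟩ : Fan.S τ) (1 : k) ^ n) =
      AddMonoidAlgebra.single (⟨n • m, nsmul_mem (Fan.S_anti h hm) n⟩ : Fan.S σ) (1 : k) := by
  rw [AddMonoidAlgebra.single_pow, chartHom_single, one_pow]
  rfl

theorem chartHom_surj {σ τ : Δ.Cone} (h : σ ≤ τ) {m : M} (hm : m ∈ Fan.S τ)
    (hτ : ∀ u, u ∈ σ.1 ↔ u ∈ τ.1 ∧ u m = 0) (x : AddMonoidAlgebra k (Fan.S σ)) :
    ∃ (n : ℕ) (a : AddMonoidAlgebra k (Fan.S τ)),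
      x * chartHom k Δ h (AddMonoidAlgebra.single (⟨m, hm⟩ : Fan.S τ) (1 : k)) ^ n =
        chartHom k Δ h a := by
  simp only [← map_pow]
  induction x using AddMonoidAlgebra.induction_linear with
  | zero => exact ⟨0, 0, by simp⟩
  | single w a =>
    obtain ⟨n, hn⟩ := exists_add_nsmul_mem (Δ.rational _ τ.2) hm hτ w.2
    refine ⟨n, AddMonoidAlgebra.single (⟨w + n • m, hn⟩ : Fan.S τ) a, ?_⟩
    rw [chartHom_pow, chartHom_single, AddMonoidAlgebra.single_mul_single, mul_one]
    rfl
  | add x y hx hy =>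
    obtain ⟨n, a, ha⟩ := hx
    obtain ⟨n', a', ha'⟩ := hy
    refine ⟨n + n', a * AddMonoidAlgebra.single (⟨m, hm⟩ : Fan.S τ) (1 : k) ^ n' +
      a' * AddMonoidAlgebra.single (⟨m, hm⟩ : Fan.S τ) (1 : k) ^ n, ?_⟩
    generalize AddMonoidAlgebra.single (⟨m, hm⟩ : Fan.S τ) (1 : k) = c at *
    rw [map_add, map_mul, map_mul, ← ha, ← ha', pow_add, map_mul]
    generalize chartHom k Δ h (c ^ n) = p
    generalize chartHom k Δ h (c ^ n') = q
    rw [add_mul]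
    congr 1
    · rw [mul_assoc]
    · rw [mul_assoc, mul_comm p q]

theorem chartHom_isLocalization {σ τ : Δ.Cone} (h : σ ≤ τ) {m : M} (hm : m ∈ Fan.S τ)
    (hτ : ∀ u, u ∈ σ.1 ↔ u ∈ τ.1 ∧ u m = 0) :
    let _ := (chartHom k Δ h).toAlgebra
    IsLocalization.Away (AddMonoidAlgebra.single (⟨m, hm⟩ : Fan.S τ) (1 : k))
      (AddMonoidAlgebra k (Fan.S σ)) := by
  intro _
  have hneg : -m ∈ Fan.S σ := fun u hu => by rw [map_neg, ((hτ u).1 hu).2, neg_zero]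
  refine IsLocalization.Away.mk _ ?_ (chartHom_surj k Δ h hm hτ)
    fun a b hab => ⟨0, by rw [chartHom_injective k Δ h hab]⟩
  refine IsUnit.of_mul_eq_one (AddMonoidAlgebra.single (⟨-m, hneg⟩ : Fan.S σ) (1 : k)) ?_
  change chartHom k Δ h _ * _ = 1
  rw [chartHom_single, AddMonoidAlgebra.single_mul_single, AddMonoidAlgebra.one_def, one_mul]
  congr 1
  exact Subtype.ext (add_neg_cancel m)

theorem range_toricDiagram_map {σ τ : Δ.Cone} (f : σ ⟶ τ) {m : M} (hm : m ∈ Fan.S τ)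
    (hτ : ∀ u, u ∈ σ.1 ↔ u ∈ τ.1 ∧ u m = 0) :
    Set.range ((toricDiagram k Δ).map f) =
      (PrimeSpectrum.basicOpen (AddMonoidAlgebra.single (⟨m, hm⟩ : Fan.S τ) (1 : k))).carrier := by
  let _ := (chartHom k Δ f.le).toAlgebra
  have := chartHom_isLocalization k Δ f.le hm hτ
  exact PrimeSpectrum.localization_away_comap_range (AddMonoidAlgebra k (Fan.S σ))
    (AddMonoidAlgebra.single (⟨m, hm⟩ : Fan.S τ) (1 : k))

instance {σ τ : Δ.Cone} (f : σ ⟶ τ) : IsOpenImmersion ((toricDiagram k Δ).map f) := by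
  obtain ⟨m, hm, hτ⟩ := Fan.isFace_of_le f.le
  let _ := (chartHom k Δ f.le).toAlgebra
  have := chartHom_isLocalization k Δ f.le hm hτ
  exact IsOpenImmersion.of_isLocalization (AddMonoidAlgebra.single (⟨m, hm⟩ : Fan.S τ) (1 : k))

instance : (toricDiagram k Δ ⋙ Scheme.forget).IsLocallyDirected where
  cond {σ₁ σ₂ τ} f₁ f₂ x₁ x₂ h := by
    have h' : (toricDiagram k Δ).map f₁ x₁ = (toricDiagram k Δ).map f₂ x₂ := h
    obtain ⟨m₁, hm₁, h₁⟩ := Fan.isFace_of_le f₁.le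
    obtain ⟨m₂, hm₂, h₂⟩ := Fan.isFace_of_le f₂.le
    have hiff : ∀ u, u ∈ σ₁.1 ⊓ σ₂.1 ↔ u ∈ τ.1 ∧ u (m₁ + m₂) = 0 := by
      intro u
      rw [Submodule.mem_inf, h₁, h₂, map_add]
      constructor
      · rintro ⟨⟨ha, hb⟩, -, hc⟩
        exact ⟨ha, by rw [hb, hc, add_zero]⟩
      · rintro ⟨ha, hb⟩
        have p₁ := hm₁ u ha
        have p₂ := hm₂ u ha
        exact ⟨⟨ha, by linarith⟩, ha, by linarith⟩
    let ρ : Δ.Cone := ⟨σ₁.1 ⊓ σ₂.1, Δ.face_mem _ τ.2 _ ⟨m₁ + m₂, add_mem hm₁ hm₂, hiff⟩⟩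
    let g₁ : ρ ⟶ σ₁ := homOfLE (inf_le_left : σ₁.1 ⊓ σ₂.1 ≤ σ₁.1)
    let g₂ : ρ ⟶ σ₂ := homOfLE (inf_le_right : σ₁.1 ⊓ σ₂.1 ≤ σ₂.1)
    have hm : m₁ + m₂ ∈ Fan.S τ := add_mem hm₁ hm₂
    have hmem : (toricDiagram k Δ).map f₁ x₁ ∈ Set.range ((toricDiagram k Δ).map (g₁ ≫ f₁)) := by
      have e₁ : (toricDiagram k Δ).map f₁ x₁ ∈ Set.range ((toricDiagram k Δ).map f₁) := ⟨_, rfl⟩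
      have e₂ : (toricDiagram k Δ).map f₁ x₁ ∈ Set.range ((toricDiagram k Δ).map f₂) :=
        ⟨x₂, h'.symm⟩
      rw [range_toricDiagram_map k Δ _ hm₁ h₁] at e₁
      rw [range_toricDiagram_map k Δ _ hm₂ h₂] at e₂
      rw [range_toricDiagram_map k Δ (g₁ ≫ f₁) hm hiff]
      have : AddMonoidAlgebra.single (⟨m₁ + m₂, hm⟩ : Fan.S τ) (1 : k) =
          AddMonoidAlgebra.single (⟨m₁, hm₁⟩ : Fan.S τ) (1 : k) *
            AddMonoidAlgebra.single (⟨m₂, hm₂⟩ : Fan.S τ) (1 : k) := by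
        rw [AddMonoidAlgebra.single_mul_single, one_mul]
        rfl
      rw [this, PrimeSpectrum.basicOpen_mul]
      exact ⟨e₁, e₂⟩
    obtain ⟨x, hx⟩ := hmem
    have c₁ : (toricDiagram k Δ).map f₁ ((toricDiagram k Δ).map g₁ x) =
        (toricDiagram k Δ).map f₁ x₁ := by
      rw [← hx, Functor.map_comp]; rfl
    have c₂ : (toricDiagram k Δ).map f₂ ((toricDiagram k Δ).map g₂ x) =
        (toricDiagram k Δ).map f₂ x₂ := by
      rw [← h', ← hx, Subsingleton.elim (g₁ ≫ f₁) (g₂ ≫ f₂), Functor.map_comp]; rfl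
    exact ⟨ρ, g₁, g₂, x,
      ((toricDiagram k Δ).map f₁).isOpenEmbedding.injective c₁,
      ((toricDiagram k Δ).map f₂).isOpenEmbedding.injective c₂⟩

/-- The toric variety `X(Δ)`, glued from the affine toric varieties `U_σ` along the open immersions
`U_τ ⊆ U_σ`, `τ` a face of `σ`. -/
def toricVariety : Scheme.{u} := Limits.colimit (toricDiagram k Δ)

/-- The open immersion `U_σ → X(Δ)`. -/
def toricChart (σ : Δ.Cone) : Spec (.of (AddMonoidAlgebra k (Fan.S σ))) ⟶ toricVariety k Δ :=
  Limits.colimit.ι (toricDiagram k Δ) σ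

instance (σ : Δ.Cone) : IsOpenImmersion (toricChart k Δ σ) :=
  inferInstanceAs (IsOpenImmersion (Limits.colimit.ι (toricDiagram k Δ) σ))

/-- The structure morphism `X(Δ) → Spec k`. -/
def toricStructure : toricVariety k Δ ⟶ Spec (.of k) :=
  Limits.colimit.desc (toricDiagram k Δ)
    { pt := Spec (.of k)
      ι :=
        { app := fun σ =>
            Spec.map (CommRingCat.ofHom (algebraMap k (AddMonoidAlgebra k (Fan.S σ))))
          naturality := fun σ τ f => by
            refine Eq.trans ?_ (Category.comp_id _).symm
            change Spec.map _ ≫ Spec.map _ = Spec.map _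
            rw [← Spec.map_comp]
            congr 1
            rw [← CommRingCat.ofHom_comp]
            congr 1
            exact RingHom.ext fun a => chartHom_single k Δ f.le 0 a } }

/-- The open subset `U_σ ⊆ X(Δ)`. -/
abbrev toricOpen (σ : Δ.Cone) : (toricVariety k Δ).Opens := (toricChart k Δ σ).opensRange

/-- The big torus `T = U_0 = Spec k[M] ⊆ X(Δ)`. -/
abbrev torus : (toricVariety k Δ).Opens := toricOpen k Δ Δ.zeroCone

/-- The isomorphism `k[S_σ] → Γ(U_σ, 𝒪)`. -/
def toricFunction (σ : Δ.Cone) :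
    AddMonoidAlgebra k (Fan.S σ) →+* Γ(toricVariety k Δ, toricOpen k Δ σ) :=
  ((Scheme.ΓSpecIso (.of (AddMonoidAlgebra k (Fan.S σ)))).inv ≫
    (IsOpenImmersion.ΓIsoTop (toricChart k Δ σ)).hom).hom

/-- The regular function `χ^m` on `U_σ`, for `m ∈ S_σ`. -/
def character (σ : Δ.Cone) (m : Fan.S σ) : Γ(toricVariety k Δ, toricOpen k Δ σ) :=
  toricFunction k Δ σ (AddMonoidAlgebra.single m 1)

theorem exists_mem_toricOpen (x : toricVariety k Δ) : ∃ σ : Δ.Cone, x ∈ toricOpen k Δ σ := by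
  obtain ⟨σ, y, h⟩ := Scheme.IsLocallyDirected.ι_jointly_surjective (toricDiagram k Δ) x
  exact ⟨σ, y, h⟩

end Toric


/-! ### Sheaves of monoids and monoidal spaces

Monoids are commutative and written multiplicatively here. A sheaf of monoids is given by its
étalé space: its stalks, together with the predicate telling which families of germs over an open
set are sections. -/

/-- A sheaf of commutative monoids on `X`. -/
structure MonoidSheaf (X : Type u) [TopologicalSpace X] where
  stalk : X → Type u
  [commMonoid : ∀ x, CommMonoid (stalk x)]
  IsSection : ∀ U : Opens X, (∀ x : U, stalk x) → Prop
  one_section : ∀ U, IsSection U fun _ => 1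
  mul_section : ∀ U s t, IsSection U s → IsSection U t → IsSection U fun x => s x * t x
  res : ∀ (U V : Opens X) (h : V ≤ U) (s : ∀ x : U, stalk x), IsSection U s →
    IsSection V fun x => s ⟨x, h x.2⟩
  glue : ∀ (U : Opens X) (s : ∀ x : U, stalk x),
    (∀ x : U, ∃ (V : Opens X) (h : V ≤ U), x.1 ∈ V ∧ IsSection V fun y => s ⟨y, h y.2⟩) →
    IsSection U s
  exists_section : ∀ (x : X) (a : stalk x), ∃ (U : Opens X) (hx : x ∈ U) (s : ∀ y : U, stalk y),
    IsSection U s ∧ s ⟨x, hx⟩ = a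
  eq_near : ∀ (U : Opens X) (s t : ∀ y : U, stalk y), IsSection U s → IsSection U t →
    ∀ x : U, s x = t x → ∃ (V : Opens X) (h : V ≤ U), x.1 ∈ V ∧ ∀ y : V, s ⟨y, h y.2⟩ = t ⟨y, h y.2⟩

attribute [instance] MonoidSheaf.commMonoid

namespace MonoidSheaf

variable {X : Type u} [TopologicalSpace X]

/-- The sheaf whose sections are the families of germs that locally satisfy `B`. -/
def ofBasic (stalk : X → Type u) [∀ x, CommMonoid (stalk x)]
    (B : ∀ U : Opens X, (∀ x : U, stalk x) → Prop)
    (one : ∀ U, B U fun _ => 1)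
    (mul : ∀ U s t, B U s → B U t → B U fun x => s x * t x)
    (res : ∀ (U V : Opens X) (h : V ≤ U) (s : ∀ x : U, stalk x), B U s → B V fun x => s ⟨x, h x.2⟩)
    (ex : ∀ (x : X) (a : stalk x), ∃ (U : Opens X) (hx : x ∈ U) (s : ∀ y : U, stalk y),
      B U s ∧ s ⟨x, hx⟩ = a)
    (eq : ∀ (U : Opens X) (s t : ∀ y : U, stalk y), B U s → B U t →
      ∀ x : U, s x = t x →
        ∃ (V : Opens X) (h : V ≤ U), x.1 ∈ V ∧ ∀ y : V, s ⟨y, h y.2⟩ = t ⟨y, h y.2⟩) :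
    MonoidSheaf X where
  stalk := stalk
  IsSection U s := ∀ x : U, ∃ (V : Opens X) (h : V ≤ U), x.1 ∈ V ∧ B V fun y => s ⟨y, h y.2⟩
  one_section U x := ⟨U, le_rfl, x.2, one U⟩
  mul_section U s t hs ht x := by
    obtain ⟨V, hV, hxV, h₁⟩ := hs x
    obtain ⟨W, hW, hxW, h₂⟩ := ht x
    exact ⟨V ⊓ W, inf_le_left.trans hV, ⟨hxV, hxW⟩,
      mul _ _ _ (res V _ inf_le_left _ h₁) (res W _ inf_le_right _ h₂)⟩
  res U V h s hs x := by
    obtain ⟨W, hW, hxW, h₁⟩ := hs ⟨x, h x.2⟩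
    exact ⟨W ⊓ V, inf_le_right, ⟨hxW, x.2⟩, res W _ inf_le_left _ h₁⟩
  glue U s hs x := by
    obtain ⟨V, hV, hxV, h₁⟩ := hs x
    obtain ⟨W, hW, hxW, h₂⟩ := h₁ ⟨x, hxV⟩
    exact ⟨W, hW.trans hV, hxW, h₂⟩
  exists_section x a := by
    obtain ⟨U, hx, s, hs, h⟩ := ex x a
    exact ⟨U, hx, s, fun y => ⟨U, le_rfl, y.2, hs⟩, h⟩
  eq_near U s t hs ht x hx := by
    obtain ⟨V, hV, hxV, h₁⟩ := hs x
    obtain ⟨W, hW, hxW, h₂⟩ := ht x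
    obtain ⟨O, hO, hxO, h₃⟩ := eq (V ⊓ W) _ _ (res V _ inf_le_left _ h₁)
      (res W _ inf_le_right _ h₂) ⟨x, hxV, hxW⟩ hx
    exact ⟨O, hO.trans (inf_le_left.trans hV), hxO, h₃⟩

/-- The sheaf of sharp monoids `𝒪 / 𝒪^*`: the sheafification of `U ↦ 𝒪(U) / 𝒪(U)^*`, with stalks
`𝒪_x / 𝒪_x^*`. -/
def sharp (𝒪 : MonoidSheaf X) : MonoidSheaf X :=
  ofBasic (fun x => Associates (𝒪.stalk x))
    (fun U s => ∃ t : ∀ x : U, 𝒪.stalk x, 𝒪.IsSection U t ∧ ∀ x, s x = Associates.mk (t x))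
    (fun U => ⟨fun _ => 1, 𝒪.one_section U, fun _ => rfl⟩)
    (fun U s s' ⟨t, ht, h⟩ ⟨t', ht', h'⟩ => ⟨fun x => t x * t' x, 𝒪.mul_section U _ _ ht ht',
      fun x => by
        change s x * s' x = _
        rw [h, h', Associates.mk_mul_mk]⟩)
    (fun U V h s ⟨t, ht, hst⟩ => ⟨_, 𝒪.res U V h t ht, fun x => hst _⟩)
    (fun x a => by
      obtain ⟨b, rfl⟩ := Associates.mk_surjective a
      obtain ⟨U, hx, s, hs, h⟩ := 𝒪.exists_section x b
      exact ⟨U, hx, fun y => Associates.mk (s y), ⟨s, hs, fun _ => rfl⟩,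
        congrArg Associates.mk h⟩)
    (by
      rintro U s s' ⟨t, ht, h⟩ ⟨t', ht', h'⟩ x hx
      rw [h, h', Associates.mk_eq_mk_iff_associated] at hx
      obtain ⟨w, hw⟩ := hx
      obtain ⟨U₁, hx₁, a, ha, ea⟩ := 𝒪.exists_section x w
      obtain ⟨U₂, hx₂, b, hb, eb⟩ := 𝒪.exists_section x (w⁻¹ : (𝒪.stalk x)ˣ)
      let W : Opens X := U ⊓ (U₁ ⊓ U₂)
      have ht₁ := 𝒪.res U W inf_le_left t ht
      have ht₂ := 𝒪.res U W inf_le_left t' ht'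
      have ha₁ := 𝒪.res U₁ W (inf_le_right.trans inf_le_left) a ha
      have hb₁ := 𝒪.res U₂ W (inf_le_right.trans inf_le_right) b hb
      obtain ⟨V₁, hV₁, hxV₁, e₁⟩ := 𝒪.eq_near W _ _ (𝒪.mul_section W _ _ ht₁ ha₁) ht₂
        ⟨x, x.2, hx₁, hx₂⟩ (by
          change t x * a ⟨x, hx₁⟩ = t' x
          rw [ea, hw])
      obtain ⟨V₂, hV₂, hxV₂, e₂⟩ := 𝒪.eq_near W _ _ (𝒪.mul_section W _ _ ha₁ hb₁)
        (𝒪.one_section W) ⟨x, x.2, hx₁, hx₂⟩ (by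
          change a ⟨x, hx₁⟩ * b ⟨x, hx₂⟩ = 1
          rw [ea, eb, Units.mul_inv])
      refine ⟨V₁ ⊓ V₂, (inf_le_left.trans hV₁).trans inf_le_left, ⟨hxV₁, hxV₂⟩, fun y => ?_⟩
      rw [h, h', Associates.mk_eq_mk_iff_associated]
      have f₁ := e₁ ⟨y, y.2.1⟩
      have f₂ := e₂ ⟨y, y.2.2⟩
      exact ⟨Units.mkOfMulEqOne _ _ f₂, f₁⟩)

end MonoidSheaf

/-- A locally monoidal space. -/
structure MonoidalSpace where
  carrier : Type u
  [top : TopologicalSpace carrier]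
  sheaf : MonoidSheaf carrier

attribute [instance] MonoidalSpace.top

namespace MonoidalSpace

/-- The stalk of the structure sheaf. -/
abbrev stalk (X : MonoidalSpace.{u}) (x : X.carrier) : Type u := X.sheaf.stalk x

/-- A morphism of locally monoidal spaces. -/
@[ext]
structure Hom (X : MonoidalSpace.{u}) (Y : MonoidalSpace.{v}) where
  base : C(X.carrier, Y.carrier)
  stalkMap : ∀ x, Y.stalk (base x) →* X.stalk x
  isLocal : ∀ x (a : Y.stalk (base x)), IsUnit (stalkMap x a) → IsUnit a
  map_section : ∀ (V : Opens Y.carrier) (s : ∀ y : V, Y.stalk y), Y.sheaf.IsSection V s →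
    X.sheaf.IsSection (V.comap base) fun x => stalkMap x (s ⟨base x, x.2⟩)

/-- The composition `X → Y → Z`. -/
def Hom.comp {X : MonoidalSpace.{u}} {Y : MonoidalSpace.{v}} {Z : MonoidalSpace.{w}}
    (f : Hom X Y) (g : Hom Y Z) : Hom X Z where
  base := g.base.comp f.base
  stalkMap x := (f.stalkMap x).comp (g.stalkMap (f.base x))
  isLocal _ _ h := g.isLocal _ _ (f.isLocal _ _ h)
  map_section V s hs := f.map_section _ _ (g.map_section V s hs)

/-- `f : X → Y` is strict: `f⁻¹ 𝒪_Y → 𝒪_X` is an isomorphism. -/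
def Hom.IsStrict {X : MonoidalSpace.{u}} {Y : MonoidalSpace.{v}} (f : Hom X Y) : Prop :=
  ∀ x, Function.Bijective (f.stalkMap x)

/-- `f` is an isomorphism onto an open subspace. -/
structure Hom.IsOpenImmersion {X : MonoidalSpace.{u}} {Y : MonoidalSpace.{v}} (f : Hom X Y) :
    Prop where
  isOpenEmbedding : Topology.IsOpenEmbedding f.base
  isStrict : f.IsStrict

end MonoidalSpace

/-! ### Spectra of monoids -/

/-- A prime ideal of a monoid; the empty ideal is prime. -/
@[ext]
structure PrimeIdeal (P : Type u) [CommMonoid P] where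
  carrier : Set P
  mul_mem : ∀ a b, b ∈ carrier → a * b ∈ carrier
  one_notMem : 1 ∉ carrier
  mem_or_mem : ∀ a b, a * b ∈ carrier → a ∈ carrier ∨ b ∈ carrier

namespace PrimeIdeal

variable {P : Type u} [CommMonoid P] {Q : Type v} [CommMonoid Q]

/-- The face `P - 𝔭`. -/
def compl (p : PrimeIdeal P) : Submonoid P where
  carrier := p.carrierᶜ
  one_mem' := p.one_notMem
  mul_mem' := fun ha hb h => (p.mem_or_mem _ _ h).elim ha hb

theorem mem_compl {p : PrimeIdeal P} {a : P} : a ∈ p.compl ↔ a ∉ p.carrier := Iff.rfl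

/-- The basic open set `D(f)`. -/
def basicOpen (f : P) : Set (PrimeIdeal P) := {p | f ∉ p.carrier}

instance : TopologicalSpace (PrimeIdeal P) :=
  TopologicalSpace.generateFrom (Set.range basicOpen)

theorem isOpen_basicOpen (f : P) : IsOpen (basicOpen f) :=
  TopologicalSpace.isOpen_generateFrom_of_mem ⟨f, rfl⟩

/-- The preimage of a prime ideal. -/
def comap (f : P →* Q) (q : PrimeIdeal Q) : PrimeIdeal P where
  carrier := f ⁻¹' q.carrier
  mul_mem a b hb := by
    change f (a * b) ∈ q.carrier
    rw [map_mul]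
    exact q.mul_mem _ _ hb
  one_notMem h := q.one_notMem (by rwa [Set.mem_preimage, map_one] at h)
  mem_or_mem a b h := q.mem_or_mem _ _ (by rwa [Set.mem_preimage, map_mul] at h)

theorem continuous_comap (f : P →* Q) : Continuous (comap f) :=
  continuous_generateFrom_iff.2 (by
    rintro _ ⟨a, rfl⟩
    exact isOpen_basicOpen (f a))

variable (P) in
/-- The maximal ideal `P - P^*`. -/
def closedPoint : PrimeIdeal P where
  carrier := {a | ¬ IsUnit a}
  mul_mem a b hb h := hb (isUnit_of_mul_isUnit_right h)
  one_notMem h := h isUnit_one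
  mem_or_mem a b h := by
    by_contra! hc
    simp only [Set.mem_ofPred_eq, not_not] at hc h
    exact h (hc.1.mul hc.2)

/-- The localization `P_𝔭`. -/
abbrev Loc (p : PrimeIdeal P) : Type u := Localization p.compl

theorem isUnit_mk_iff (p : PrimeIdeal P) (a : P) (s : p.compl) :
    IsUnit (Localization.mk a s) ↔ a ∉ p.carrier := by
  constructor
  · rintro h
    obtain ⟨b, hb⟩ := h.exists_right_inv
    induction b using Localization.induction_on with
    | H y =>
      obtain ⟨b, t⟩ := y
      rw [Localization.mk_mul, ← Localization.mk_one, Localization.mk_eq_mk_iff,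
        Localization.r_iff_exists] at hb
      obtain ⟨c, hc⟩ := hb
      simp only [OneMemClass.coe_one, one_mul, mul_one] at hc
      intro ha
      have h₁ : (c : P) * (a * b) ∈ p.carrier := by
        rw [mul_comm a b, ← mul_assoc]
        exact p.mul_mem _ _ ha
      rw [hc] at h₁
      exact (c * (s * t)).2 h₁
  · intro ha
    refine IsUnit.of_mul_eq_one (Localization.mk (s : P) ⟨a, ha⟩) ?_
    rw [Localization.mk_mul, ← Localization.mk_one, Localization.mk_eq_mk_iff,
      Localization.r_iff_exists]
    exact ⟨1, by simp [mul_comm]⟩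

/-- The homomorphism `P_{f⁻¹ 𝔮} → Q_𝔮`. -/
def locMap (f : P →* Q) (q : PrimeIdeal Q) : (comap f q).Loc →* q.Loc :=
  (Localization.monoidOf (comap f q).compl).map (T := q.compl) (fun y => y.2)
    (Localization.monoidOf q.compl)

theorem locMap_mk (f : P →* Q) (q : PrimeIdeal Q) (a : P) (s : (comap f q).compl) :
    locMap f q (Localization.mk a s) = Localization.mk (f a) ⟨f s, s.2⟩ := by
  rw [Localization.mk_eq_monoidOf_mk'_apply, Localization.mk_eq_monoidOf_mk'_apply]
  exact Submonoid.LocalizationMap.map_mk' _ _ _ _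

end PrimeIdeal

/-- The homomorphism `P / P^* → Q / Q^*` induced by `P → Q`. -/
def associatesMap {P : Type u} {Q : Type v} [CommMonoid P] [CommMonoid Q] (f : P →* Q) :
    Associates P →* Associates Q where
  toFun := Quotient.map f fun _ _ h => h.map f
  map_one' := congrArg Associates.mk (map_one f)
  map_mul' := by
    rintro ⟨a⟩ ⟨b⟩
    exact congrArg Associates.mk (map_mul f a b)

/-- The homomorphism `P / P^* → Q` induced by `P → Q`, for `Q` sharp. -/
def associatesLift {P : Type u} {Q : Type v} [CommMonoid P] [CommMonoid Q] (f : P →* Q)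
    (hQ : ∀ q : Q, IsUnit q → q = 1) : Associates P →* Q where
  toFun := Quotient.lift f fun a b h => by
    obtain ⟨u, rfl⟩ := h
    rw [map_mul, hQ _ (u.isUnit.map f), mul_one]
  map_one' := map_one f
  map_mul' := by
    rintro ⟨a⟩ ⟨b⟩
    exact map_mul f a b

section Spectrum

variable (P : Type u) [CommMonoid P]

/-- The structure sheaf of `Spec P`: the stalk at `𝔭` is `P_𝔭 / P_𝔭^*`, and sections are locally
given by fractions. -/
def specSheaf : MonoidSheaf (PrimeIdeal P) :=
  MonoidSheaf.ofBasic (fun p => Associates p.Loc)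
    (fun U s => ∃ a b : P, ∀ p : U, ∃ hb : b ∈ p.1.compl,
      s p = Associates.mk (Localization.mk a ⟨b, hb⟩))
    (fun U => ⟨1, 1, fun p => ⟨one_mem _,
      Associates.mk_one.symm.trans (congrArg Associates.mk Localization.mk_one.symm)⟩⟩)
    (by
      rintro U s t ⟨a, b, h⟩ ⟨c, d, h'⟩
      refine ⟨a * c, b * d, fun p => ?_⟩
      obtain ⟨h₁, e₁⟩ := h p
      obtain ⟨h₂, e₂⟩ := h' p
      refine ⟨mul_mem h₁ h₂, ?_⟩
      change s p * t p = _
      rw [e₁, e₂, Associates.mk_mul_mk, Localization.mk_mul]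
      rfl)
    (fun U V h s ⟨a, b, hs⟩ => ⟨a, b, fun p => hs ⟨p, h p.2⟩⟩)
    (by
      intro p x
      obtain ⟨y, rfl⟩ := Associates.mk_surjective x
      induction y using Localization.induction_on with
      | H y =>
        obtain ⟨a, b, hb⟩ := y
        exact ⟨⟨PrimeIdeal.basicOpen b, PrimeIdeal.isOpen_basicOpen b⟩, hb,
          fun q => Associates.mk (Localization.mk a ⟨b, q.2⟩), ⟨a, b, fun q => ⟨q.2, rfl⟩⟩, rfl⟩)
    (by
      rintro U s t ⟨a, b, h⟩ ⟨c, d, h'⟩ p hp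
      obtain ⟨h₁, e₁⟩ := h p
      obtain ⟨h₂, e₂⟩ := h' p
      rw [e₁, e₂, Associates.mk_eq_mk_iff_associated] at hp
      obtain ⟨w, hw⟩ := hp
      have hu : IsUnit (w : p.1.Loc) := w.isUnit
      revert hw hu
      generalize (w : p.1.Loc) = z
      induction z using Localization.induction_on with
      | H y =>
        obtain ⟨e, g⟩ := y
        intro hw hu
        rw [PrimeIdeal.isUnit_mk_iff] at hu
        rw [Localization.mk_mul, Localization.mk_eq_mk_iff, Localization.r_iff_exists] at hw
        obtain ⟨r, hr⟩ := hw
        refine ⟨U ⊓ (⟨PrimeIdeal.basicOpen e, PrimeIdeal.isOpen_basicOpen e⟩ ⊓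
          (⟨PrimeIdeal.basicOpen (g : P), PrimeIdeal.isOpen_basicOpen _⟩ ⊓
          ⟨PrimeIdeal.basicOpen (r : P), PrimeIdeal.isOpen_basicOpen _⟩)), inf_le_left,
          ⟨p.2, hu, g.2, r.2⟩, fun q => ?_⟩
        obtain ⟨k₁, f₁⟩ := h ⟨q, q.2.1⟩
        obtain ⟨k₂, f₂⟩ := h' ⟨q, q.2.1⟩
        rw [f₁, f₂, Associates.mk_eq_mk_iff_associated]
        have hq := (PrimeIdeal.isUnit_mk_iff q.1 e ⟨g, q.2.2.2.1⟩).2 q.2.2.1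
        refine ⟨hq.unit, ?_⟩
        rw [IsUnit.unit_spec, Localization.mk_mul, Localization.mk_eq_mk_iff,
          Localization.r_iff_exists]
        exact ⟨⟨r, q.2.2.2.2⟩, hr⟩)

/-- The sharp monoidal space `Spec P`. -/
abbrev MSpec : MonoidalSpace.{u} := ⟨PrimeIdeal P, specSheaf P⟩

variable {P} {Q : Type v} [CommMonoid Q]

theorem isUnit_of_associatesMap_locMap (f : P →* Q) (q : PrimeIdeal Q)
    (a : Associates (PrimeIdeal.comap f q).Loc)
    (h : IsUnit (associatesMap (PrimeIdeal.locMap f q) a)) : IsUnit a := by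
  obtain ⟨b, rfl⟩ := Associates.mk_surjective a
  change IsUnit (Associates.mk (PrimeIdeal.locMap f q b)) at h
  rw [Associates.isUnit_mk] at h ⊢
  induction b using Localization.induction_on with
  | H y =>
    rw [PrimeIdeal.locMap_mk, PrimeIdeal.isUnit_mk_iff] at h
    exact (PrimeIdeal.isUnit_mk_iff _ _ _).2 h

/-- The morphism `Spec Q → Spec P` induced by `f : P → Q`. -/
def MSpec.map (f : P →* Q) : MonoidalSpace.Hom (MSpec Q) (MSpec P) where
  base := ⟨PrimeIdeal.comap f, PrimeIdeal.continuous_comap f⟩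
  stalkMap := fun q : PrimeIdeal Q => associatesMap (PrimeIdeal.locMap f q)
  isLocal := isUnit_of_associatesMap_locMap f
  map_section V s hs q := by
    obtain ⟨W, hW, hqW, a, b, h⟩ := hs ⟨PrimeIdeal.comap f q.1, q.2⟩
    refine ⟨W.comap ⟨PrimeIdeal.comap f, PrimeIdeal.continuous_comap f⟩, fun x hx => hW hx, hqW,
      f a, f b, fun y => ?_⟩
    obtain ⟨hb, e⟩ := h ⟨PrimeIdeal.comap f y.1, y.2⟩
    refine ⟨hb, ?_⟩
    refine (congrArg (associatesMap (PrimeIdeal.locMap f y.1)) e).trans ?_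
    exact congrArg Associates.mk (PrimeIdeal.locMap_mk f y.1 a ⟨b, hb⟩)

end Spectrum


/-- `P` is a fine and saturated monoid: finitely generated, integral and saturated. -/
structure IsFineSaturated (P : Type u) [CommMonoid P] : Prop where
  fg : Monoid.FG P
  integral : ∀ a b c : P, a * b = a * c → b = c
  saturated : ∀ (a b : P) (n : ℕ), 0 < n → (∃ c, a ^ n = b ^ n * c) → ∃ d, a = b * d

/-- `F` is a fine and saturated Kato fan: it is quasi-compact and covered by open subspaces
isomorphic to spectra of fine and saturated monoids. -/
structure IsFsKatoFan (F : MonoidalSpace.{u}) : Prop where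
  compact : CompactSpace F.carrier
  cover : ∀ y : F.carrier, ∃ (P : Type u) (_ : CommMonoid P) (j : MonoidalSpace.Hom (MSpec P) F),
    IsFineSaturated P ∧ j.IsOpenImmersion ∧ y ∈ Set.range j.base

/-! ### Logarithmic structures -/

section Log

variable (X : Scheme.{u})

/-- The structure sheaf `𝒪_X` as a sheaf of monoids under multiplication. -/
def structureSheaf : MonoidSheaf X :=
  MonoidSheaf.ofBasic (fun x => X.presheaf.stalk x)
    (fun U s => ∃ f : Γ(X, U), ∀ x : U, s x = X.presheaf.germ U x x.2 f)
    (fun U => ⟨1, fun x => (map_one _).symm⟩)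
    (by
      rintro U s t ⟨f, hf⟩ ⟨g, hg⟩
      exact ⟨f * g, fun x => by rw [map_mul, ← hf, ← hg]⟩)
    (by
      rintro U V h s ⟨f, hf⟩
      exact ⟨X.presheaf.map (homOfLE h).op f, fun x => (hf ⟨x, h x.2⟩).trans
        (X.presheaf.germ_res_apply (homOfLE h) x.1 x.2 f).symm⟩)
    (by
      intro x a
      obtain ⟨U, hx, f, rfl⟩ := X.presheaf.exists_germ_eq a
      exact ⟨U, hx, fun y => X.presheaf.germ U y y.2 f, ⟨f, fun _ => rfl⟩, rfl⟩)
    (by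
      rintro U s t ⟨f, hf⟩ ⟨g, hg⟩ x hx
      rw [hf, hg] at hx
      obtain ⟨W, hxW, i₁, i₂, h⟩ := X.presheaf.germ_eq x.1 x.2 x.2 f g hx
      refine ⟨W, i₁.le, hxW, fun y => ?_⟩
      rw [hf, hg, ← X.presheaf.germ_res_apply i₁ y.1 y.2, ← X.presheaf.germ_res_apply i₂ y.1 y.2, h])

/-- A logarithmic structure on `X`: a sheaf of monoids `M` with a homomorphism `α : M → 𝒪_X` that
induces an isomorphism `α⁻¹ 𝒪_X^* → 𝒪_X^*`. -/
structure LogStructure where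
  sheaf : MonoidSheaf X
  toStructure : ∀ x, sheaf.stalk x →* X.presheaf.stalk x
  map_section : ∀ (U : X.Opens) (s : ∀ x : U, sheaf.stalk x), sheaf.IsSection U s →
    (structureSheaf X).IsSection U fun x => toStructure x (s x)
  existsUnique_unit : ∀ x (a : X.presheaf.stalk x), IsUnit a → ∃! m, toStructure x m = a

variable {X}

/-- The germs at `x` of functions that are invertible on `T`. -/
def divisorialStalk (T : X.Opens) (x : X) : Submonoid (X.presheaf.stalk x) where
  carrier := {a | ∃ (U : X.Opens) (hx : x ∈ U) (f : Γ(X, U)),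
    U ⊓ T ≤ X.basicOpen f ∧ X.presheaf.germ U x hx f = a}
  one_mem' := ⟨⊤, trivial, 1, by
    rw [Scheme.basicOpen_of_isUnit _ isUnit_one]; exact le_top, map_one _⟩
  mul_mem' := by
    rintro _ _ ⟨U, hU, f, hf, rfl⟩ ⟨V, hV, g, hg, rfl⟩
    refine ⟨U ⊓ V, ⟨hU, hV⟩, X.presheaf.map (homOfLE inf_le_left).op f *
      X.presheaf.map (homOfLE inf_le_right).op g, ?_, ?_⟩
    · rw [Scheme.basicOpen_mul, Scheme.basicOpen_res, Scheme.basicOpen_res]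
      exact fun y hy => ⟨⟨hy.1, hf ⟨hy.1.1, hy.2⟩⟩, hy.1, hg ⟨hy.1.2, hy.2⟩⟩
    · rw [map_mul]
      congr 1
      · exact X.presheaf.germ_res_apply _ _ _ _
      · exact X.presheaf.germ_res_apply _ _ _ _

/-- The sheaf `U ↦ {f ∈ 𝒪_X(U) : f is invertible on U ∩ T}`. -/
def divisorialSheaf (T : X.Opens) : MonoidSheaf X :=
  MonoidSheaf.ofBasic (fun x => divisorialStalk T x)
    (fun U s => ∃ f : Γ(X, U), U ⊓ T ≤ X.basicOpen f ∧
      ∀ x : U, (s x).1 = X.presheaf.germ U x x.2 f)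
    (fun U => ⟨1, by rw [Scheme.basicOpen_of_isUnit _ isUnit_one]; exact inf_le_left,
      fun x => (map_one _).symm⟩)
    (by
      rintro U s t ⟨f, hf, hf'⟩ ⟨g, hg, hg'⟩
      refine ⟨f * g, ?_, fun x => ?_⟩
      · rw [Scheme.basicOpen_mul]
        exact le_inf hf hg
      · rw [map_mul, ← hf', ← hg']
        rfl)
    (by
      rintro U V h s ⟨f, hf, hf'⟩
      refine ⟨X.presheaf.map (homOfLE h).op f, ?_, fun x => (hf' ⟨x, h x.2⟩).trans
        (X.presheaf.germ_res_apply (homOfLE h) x.1 x.2 f).symm⟩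
      rw [Scheme.basicOpen_res]
      exact fun y hy => ⟨hy.1, hf ⟨h hy.1, hy.2⟩⟩)
    (by
      rintro x ⟨a, U, hx, f, hf, rfl⟩
      exact ⟨U, hx, fun y => ⟨X.presheaf.germ U y y.2 f, U, y.2, f, hf, rfl⟩,
        ⟨f, hf, fun _ => rfl⟩, rfl⟩)
    (by
      rintro U s t ⟨f, hf, hf'⟩ ⟨g, hg, hg'⟩ x hx
      rw [Subtype.ext_iff, hf', hg'] at hx
      obtain ⟨W, hxW, i₁, i₂, h⟩ := X.presheaf.germ_eq x.1 x.2 x.2 f g hx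
      refine ⟨W, i₁.le, hxW, fun y => Subtype.ext ?_⟩
      rw [hf', hg', ← X.presheaf.germ_res_apply i₁ y.1 y.2, ← X.presheaf.germ_res_apply i₂ y.1 y.2,
        h])

/-- The divisorial logarithmic structure of the complement of `T`. -/
def divisorialLog (T : X.Opens) : LogStructure X where
  sheaf := divisorialSheaf T
  toStructure x := (divisorialStalk T x).subtype
  map_section U s hs x := by
    obtain ⟨V, hV, hx, f, -, h⟩ := hs x
    exact ⟨V, hV, hx, f, h⟩
  existsUnique_unit x a ha := by
    refine ⟨⟨a, ?_⟩, rfl, fun b hb => Subtype.ext hb⟩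
    obtain ⟨U, hx, f, rfl⟩ := X.presheaf.exists_germ_eq a
    have hxf : x ∈ X.basicOpen f := (X.mem_basicOpen f x hx).2 ha
    refine ⟨X.basicOpen f, hxf, X.presheaf.map (homOfLE (X.basicOpen_le f)).op f, ?_, ?_⟩
    · rw [Scheme.basicOpen_res]
      exact fun y hy => ⟨hy.1, hy.1⟩
    · exact X.presheaf.germ_res_apply _ _ _ _

/-- The sharp monoidal space `(X, M / 𝒪_X^*)`. -/
abbrev charSpace (L : LogStructure X) : MonoidalSpace.{u} := ⟨X, L.sheaf.sharp⟩

/-- `φ : (X, M / 𝒪_X^*) → F` is the characteristic morphism of the logarithmic scheme `(X, M)`: it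
is the initial strict morphism to a fine and saturated Kato fan. In particular `F` is the Kato fan
`F_X` associated with `X`. -/
structure IsCharacteristic (L : LogStructure X) {F : MonoidalSpace.{u}}
    (φ : MonoidalSpace.Hom (charSpace L) F) : Prop where
  isFsKatoFan : IsFsKatoFan F
  isStrict : φ.IsStrict
  existsUnique : ∀ (G : MonoidalSpace.{u}) (ψ : MonoidalSpace.Hom (charSpace L) G),
    IsFsKatoFan G → ψ.IsStrict →
      ∃! g : MonoidalSpace.Hom F G, g.IsStrict ∧ φ.comp g = ψ

end Log

/-- The divisorial logarithmic structure of `X(Δ) - T`. -/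
def toricLog (k : Type u) [Field k] {M : Type u} [AddCommGroup M] (Δ : Fan M) :
    LogStructure (toricVariety k Δ) :=
  divisorialLog (torus k Δ)

/-! ### Cone complexes -/

/-- The topology of pointwise convergence on `Hom(P, Q)`. -/
abbrev pointwiseTopology (P : Type u) (Q : Type v) [CommMonoid P] [CommMonoid Q]
    [TopologicalSpace Q] : TopologicalSpace (P →* Q) :=
  TopologicalSpace.induced (fun g p => g p) inferInstance

section Complex

variable (F : MonoidalSpace.{u}) (Q : Type v) [CommMonoid Q]

/-- The set `Hom(Spec Q, F)`. -/
def Points : Type (max u v) := MonoidalSpace.Hom (MSpec Q) F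

variable {F Q} in
/-- The map `Hom(P, Q) → Hom(Spec Q, F)` given by a morphism `Spec P → F`. -/
def Points.ofHom {P : Type u} [CommMonoid P] (j : MonoidalSpace.Hom (MSpec P) F) (g : P →* Q) :
    Points F Q :=
  (MSpec.map g).comp j

/-- The weak topology: a set is open if its intersection with `Hom(P, Q)` is open there for every
open affine `U ≅ Spec P` of `F`. -/
instance [TopologicalSpace Q] : TopologicalSpace (Points F Q) where
  IsOpen A := ∀ (P : Type u) (_ : CommMonoid P) (j : MonoidalSpace.Hom (MSpec P) F),
    j.IsOpenImmersion → (pointwiseTopology P Q).IsOpen (Points.ofHom j ⁻¹' A)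
  isOpen_univ P _ j _ := by
    rw [Set.preimage_univ]
    exact @isOpen_univ _ (pointwiseTopology P Q)
  isOpen_inter A B hA hB P _ j hj :=
    @IsOpen.inter _ (pointwiseTopology P Q) _ _ (hA P _ j hj) (hB P _ j hj)
  isOpen_sUnion S hS P _ j hj := by
    rw [Set.preimage_sUnion]
    exact @isOpen_biUnion _ _ (pointwiseTopology P Q) _ _ fun A hA => hS A hA P _ j hj

/-- The additive monoid `ℝ̄_{≥0} = [0, ∞]`, written multiplicatively. -/
abbrev RBar : Type := Multiplicative ENNReal

/-- The additive monoid `ℝ_{≥0}`, written multiplicatively. -/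
abbrev RNonneg : Type := Multiplicative NNReal

/-- The cone complex `Σ_F = Hom(Spec ℝ_{≥0}, F)`. -/
abbrev ConeComplex : Type u := Points F RNonneg

/-- The extended cone complex `Σ̄_F = Hom(Spec ℝ̄_{≥0}, F)`. -/
abbrev ExtConeComplex : Type u := Points F RBar

variable {F} in
/-- The inclusion `Σ_F ⊆ Σ̄_F`, induced by `ℝ_{≥0} ⊆ ℝ̄_{≥0}`. -/
def ConeComplex.toExt (u : ConeComplex F) : ExtConeComplex F :=
  (MSpec.map (AddMonoidHom.toMultiplicative ENNReal.ofNNRealHom.toAddMonoidHom)).comp u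

end Complex

/-! ### Analytic spaces -/

section Analytic

variable {k : Type u} [Field k] {X : Scheme.{u}} (f : X ⟶ Spec (.of k))

/-- The value at `x` of a constant `a ∈ k`. -/
def scalar (x : X) : k →+* X.residueField x :=
  ((Scheme.ΓSpecIso (.of k)).inv ≫ f.appTop ≫ X.evaluation ⊤ x trivial).hom

/-- A point of the Berkovich analytification `X^an` over the trivially valued field `k`: a point
`x ∈ X` with an absolute value on its residue field that extends the trivial one on `k`. -/
structure AnPoint where
  pt : X
  val : Valuation (X.residueField pt) NNReal
  trivial_on : ∀ a : k, a ≠ 0 → val (scalar f pt a) = 1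

variable {f} in
/-- The seminorm `|·|_x` on the local ring at a specialization `c` of the underlying point. -/
def AnPoint.seminorm (x : AnPoint f) {c : X} (h : x.pt ⤳ c) :
    X.presheaf.stalk c →*₀ NNReal :=
  x.val.toMonoidWithZeroHom.comp
    (X.presheaf.stalkSpecializes h ≫ X.residue x.pt).hom.toMonoidWithZeroHom

/-- A point of `X^ℶ`: a point `x` of `X^an` together with a center, i.e. a specialization `c` of
the underlying point of `X` such that the functions in `𝒪_{X,c}` have absolute value at most `1`
and exactly those in the maximal ideal have absolute value less than `1`. On an affine open subset
`Spec A` containing `c`, these are the multiplicative seminorms on `A` that are bounded by `1`, and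
`c` is the prime ideal where the seminorm is less than `1`. -/
structure BethPoint extends AnPoint f where
  /-- The reduction `r(x)`. -/
  center : X
  specializes : pt ⤳ center
  le_one : ∀ a, toAnPoint.seminorm specializes a ≤ 1
  lt_one_iff : ∀ a, toAnPoint.seminorm specializes a < 1 ↔ ¬ IsUnit a

end Analytic

/-- The function `-log`, from `[0, 1]` to `[0, ∞]`. -/
def negLog (r : NNReal) : ENNReal := if r = 0 then ⊤ else ENNReal.ofReal (-Real.log r)

theorem negLog_one : negLog 1 = 0 := by simp [negLog]

theorem negLog_mul {r s : NNReal} (hr : r ≤ 1) (hs : s ≤ 1) :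
    negLog (r * s) = negLog r + negLog s := by
  unfold negLog
  by_cases h : r = 0
  · simp [h]
  by_cases h' : s = 0
  · simp [h']
  rw [if_neg (mul_ne_zero h h'), if_neg h, if_neg h', ← ENNReal.ofReal_add, NNReal.coe_mul,
    Real.log_mul (by exact_mod_cast h) (by exact_mod_cast h'), neg_add]
  · exact neg_nonneg.2 (Real.log_nonpos r.2 (by exact_mod_cast hr))
  · exact neg_nonneg.2 (Real.log_nonpos s.2 (by exact_mod_cast hs))

theorem eq_one_of_isUnit (q : RBar) (h : IsUnit q) : q = 1 := by
  obtain ⟨r, hr⟩ := h.exists_right_inv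
  have : Multiplicative.toAdd q + Multiplicative.toAdd r = 0 := congrArg Multiplicative.toAdd hr
  exact Multiplicative.toAdd.injective (add_eq_zero.1 this).1

section Trop

variable {k : Type u} [Field k] {X : Scheme.{u}} {f : X ⟶ Spec (.of k)} (L : LogStructure X)

/-- The homomorphism `(M / 𝒪_X^*)_{r(x)} → ℝ̄_{≥0}`, `s ↦ -log |α(s)|_x`. -/
def tropStalk (x : BethPoint f) : (charSpace L).stalk x.center →* RBar :=
  associatesLift (P := L.sheaf.stalk x.center)
    { toFun := fun s =>
        .ofAdd (negLog (x.seminorm x.specializes (L.toStructure x.center s)))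
      map_one' := by
        rw [map_one, map_one, negLog_one]
        rfl
      map_mul' := fun s t => by
        rw [map_mul, map_mul, negLog_mul (x.le_one _) (x.le_one _)]
        rfl }
    eq_one_of_isUnit

/-- The homomorphism from `Q` to the stalk `Q / Q^*` of `Spec Q` at its closed point. -/
def toClosedStalk (Q : Type u) [CommMonoid Q] : Q →* (MSpec Q).stalk (PrimeIdeal.closedPoint Q) where
  toFun q := Associates.mk (Localization.mk q 1)
  map_one' := congrArg Associates.mk Localization.mk_one
  map_mul' a b := by
    rw [← one_mul (1 : (PrimeIdeal.closedPoint Q).compl), ← Localization.mk_mul, one_mul]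
    rfl

variable {L} in
/-- `u : Spec ℝ̄_{≥0} → F` is the tropicalization `trop_X(x)` of `x ∈ X^ℶ`: the morphism that sends
the closed point to `φ(r(x))` and is given on the stalks there by
`𝒪_{F, φ(r(x))} → (M / 𝒪_X^*)_{r(x)} → ℝ̄_{≥0}`, `s ↦ -log |s|_x`. A morphism from `Spec ℝ̄_{≥0}` is
determined by its germ at the closed point. -/
def IsTrop {F : MonoidalSpace.{u}} (φ : MonoidalSpace.Hom (charSpace L) F) (x : BethPoint f)
    (u : ExtConeComplex F) : Prop :=
  (⟨u.base (PrimeIdeal.closedPoint RBar), u.stalkMap (PrimeIdeal.closedPoint RBar)⟩ :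
      Σ y : F.carrier, F.stalk y →* (MSpec RBar).stalk (PrimeIdeal.closedPoint RBar)) =
    ⟨φ.base x.center, (toClosedStalk RBar).comp ((tropStalk L x).comp (φ.stalkMap x.center))⟩

end Trop

/-! ### Kajiwara-Payne tropicalization -/

section KajiwaraPayne

variable {M : Type u} [AddCommGroup M] (Δ : Fan M)

/-- The set `N_ℝ(σ) = Hom(S_σ, ℝ ∪ {∞})`. -/
def KPChart {Δ : Fan M} (σ : Δ.Cone) : Type u := Fan.S σ →+ WithTop ℝ

/-- The topology of pointwise convergence. -/
instance {Δ : Fan M} (σ : Δ.Cone) : TopologicalSpace (KPChart σ) :=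
  TopologicalSpace.induced (fun (u : Fan.S σ →+ WithTop ℝ) m => u m) inferInstance

/-- The inclusion `N_ℝ(τ) → N_ℝ(σ)` for `τ ⊆ σ`, given by restriction along `S_σ ⊆ S_τ`. -/
def KPChart.restrict {Δ : Fan M} {τ σ : Δ.Cone} (h : τ ≤ σ) (u : KPChart τ) : KPChart σ :=
  AddMonoidHom.comp (u : Fan.S τ →+ WithTop ℝ) (AddSubmonoid.inclusion (Fan.S_anti h))

/-- The Kajiwara-Payne partial compactification `N_ℝ(Δ)`, glued from the spaces `N_ℝ(σ)` along
`N_ℝ(τ) ⊆ N_ℝ(σ)` for `τ ⊆ σ`. -/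
def KP : Type u :=
  Quot fun a b : Σ σ : Δ.Cone, KPChart σ => ∃ h : a.1 ≤ b.1, b.2 = a.2.restrict h

instance : TopologicalSpace (KP Δ) :=
  inferInstanceAs (TopologicalSpace (Quot _))

variable {Δ}

/-- The map `N_ℝ(σ) → N_ℝ(Δ)`. -/
def KP.mk (σ : Δ.Cone) (u : Fan.S σ →+ WithTop ℝ) : KP Δ := Quot.mk _ ⟨σ, u⟩

theorem KP.mk_restrict {τ σ : Δ.Cone} (h : τ ≤ σ) (u : Fan.S τ →+ WithTop ℝ) :
    KP.mk σ (KPChart.restrict h u) = KP.mk τ u :=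
  (Quot.sound ⟨h, rfl⟩).symm

variable (Δ) in
/-- The inclusion `N_ℝ = N_ℝ(0) ⊆ N_ℝ(Δ)`. -/
def KP.ofNR (u : NR M) : KP Δ :=
  KP.mk Δ.zeroCone (WithTop.addHom.comp (u.comp (Fan.S Δ.zeroCone).subtype))

/-- The inclusion `[0, ∞] ⊆ ℝ ∪ {∞}`. -/
def ennrealToTop : ENNReal →+ WithTop ℝ :=
  AddMonoidHom.withTopMap (NNReal.toRealHom : NNReal →+ ℝ)

/-- A homomorphism `S_σ → ℝ̄_{≥0}` as a point of `N_ℝ(Δ)`. -/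
def KP.ofRBar (σ : Δ.Cone) (g : Multiplicative (Fan.S σ) →* RBar) : KP Δ :=
  KP.mk σ (ennrealToTop.comp (AddMonoidHom.toMultiplicative.symm g))

variable {k : Type u} [Field k]

theorem character_zero (σ : Δ.Cone) : character k Δ σ 0 = 1 :=
  map_one (toricFunction k Δ σ)

theorem character_add (σ : Δ.Cone) (m m' : Fan.S σ) :
    character k Δ σ (m + m') = character k Δ σ m * character k Δ σ m' := by
  rw [character, character, character, ← map_mul, AddMonoidAlgebra.single_mul_single, one_mul]

/-- The function `-log`, from `[0, ∞)` to `ℝ ∪ {∞}`. -/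
def negLogTop (r : NNReal) : WithTop ℝ := if r = 0 then ⊤ else ((-Real.log r : ℝ) : WithTop ℝ)

theorem negLogTop_one : negLogTop 1 = 0 := by simp [negLogTop]

theorem negLogTop_mul (r s : NNReal) : negLogTop (r * s) = negLogTop r + negLogTop s := by
  unfold negLogTop
  by_cases h : r = 0
  · simp [h]
  by_cases h' : s = 0
  · simp [h']
  rw [if_neg (mul_ne_zero h h'), if_neg h, if_neg h', ← WithTop.coe_add, NNReal.coe_mul,
    Real.log_mul (by exact_mod_cast h) (by exact_mod_cast h'), neg_add]

/-- The map `U_σ^an → N_ℝ(σ)`, `x ↦ (m ↦ -log |χ^m|_x)`. -/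
def tropChart (x : AnPoint (toricStructure k Δ)) (σ : Δ.Cone) (h : x.pt ∈ toricOpen k Δ σ) :
    Fan.S σ →+ WithTop ℝ where
  toFun m := negLogTop (x.val ((toricVariety k Δ).evaluation _ x.pt h (character k Δ σ m)))
  map_zero' := by rw [character_zero, map_one, map_one, negLogTop_one]
  map_add' m m' := by rw [character_add, map_mul, map_mul, negLogTop_mul]

/-- The Kajiwara-Payne tropicalization `trop_Δ : X(Δ)^an → N_ℝ(Δ)`, glued from the maps
`U_σ^an → N_ℝ(σ)`. -/
def tropKP (x : AnPoint (toricStructure k Δ)) : KP Δ :=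
  KP.mk (exists_mem_toricOpen k Δ x.pt).choose
    (tropChart x _ (exists_mem_toricOpen k Δ x.pt).choose_spec)

theorem map_toricChart {τ σ : Δ.Cone} (h : τ ≤ σ) :
    Spec.map (CommRingCat.ofHom (chartHom k Δ h)) ≫ toricChart k Δ σ = toricChart k Δ τ :=
  Limits.colimit.w (toricDiagram k Δ) (homOfLE h)

theorem toricOpen_mono {τ σ : Δ.Cone} (h : τ ≤ σ) : toricOpen k Δ τ ≤ toricOpen k Δ σ := by
  rintro x ⟨y, rfl⟩
  rw [← map_toricChart h]
  exact ⟨Spec.map (CommRingCat.ofHom (chartHom k Δ h)) y, rfl⟩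

theorem le_preimage_toricOpen (σ : Δ.Cone) : ⊤ ≤ toricChart k Δ σ ⁻¹ᵁ toricOpen k Δ σ :=
  fun y _ => ⟨y, rfl⟩

theorem ΓIsoTop_hom_appLE {X Y : Scheme.{u}} (f : X ⟶ Y) [IsOpenImmersion f]
    (h : ⊤ ≤ f ⁻¹ᵁ f.opensRange) :
    (IsOpenImmersion.ΓIsoTop f).hom ≫ f.appLE f.opensRange ⊤ h = 𝟙 _ := by
  simp only [IsOpenImmersion.ΓIsoTop, Iso.trans_hom, Iso.symm_hom, Functor.mapIso_hom, Iso.op_hom,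
    eqToIso.hom, Category.assoc, Scheme.Hom.map_appLE]
  rw [Scheme.Hom.appIso_inv_appLE]
  exact X.presheaf.map_id _

theorem appLE_injective {X Y : Scheme.{u}} (f : X ⟶ Y) [IsOpenImmersion f]
    (h : ⊤ ≤ f ⁻¹ᵁ f.opensRange) : Function.Injective (f.appLE f.opensRange ⊤ h) := by
  have : f.appLE f.opensRange ⊤ h = (IsOpenImmersion.ΓIsoTop f).inv := by
    rw [Iso.eq_inv_comp (IsOpenImmersion.ΓIsoTop f) |>.2 (ΓIsoTop_hom_appLE f h), Category.comp_id]
  rw [this]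
  exact (ConcreteCategory.bijective_of_isIso _).1

theorem appLE_appTop {X Y Z : Scheme.{u}} {f : X ⟶ Y} {g : Y ⟶ Z} {e : X ⟶ Z} (h : f ≫ g = e)
    (U : Z.Opens) (h₁ : ⊤ ≤ g ⁻¹ᵁ U) (h₂ : ⊤ ≤ e ⁻¹ᵁ U) :
    g.appLE U ⊤ h₁ ≫ f.appTop = e.appLE U ⊤ h₂ := by
  subst h
  have : f.appTop = f.appLE ⊤ ⊤ le_rfl := f.app_eq_appLE
  exact (congrArg (g.appLE U ⊤ h₁ ≫ ·) this).trans
    (Scheme.Hom.appLE_comp_appLE f g U ⊤ ⊤ h₁ le_rfl)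

theorem appLE_character (σ : Δ.Cone) (m : Fan.S σ) :
    (toricChart k Δ σ).appLE (toricOpen k Δ σ) ⊤ (le_preimage_toricOpen σ) (character k Δ σ m) =
      (Scheme.ΓSpecIso (.of (AddMonoidAlgebra k (Fan.S σ)))).inv (AddMonoidAlgebra.single m 1) := by
  rw [character, toricFunction]
  exact congrArg (fun g => g.hom ((Scheme.ΓSpecIso (.of (AddMonoidAlgebra k (Fan.S σ)))).inv
    (AddMonoidAlgebra.single m 1)))
    (ΓIsoTop_hom_appLE (toricChart k Δ σ) (le_preimage_toricOpen σ))

theorem character_res {τ σ : Δ.Cone} (h : τ ≤ σ) (m : Fan.S σ) :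
    (toricVariety k Δ).presheaf.map (homOfLE (toricOpen_mono h)).op (character k Δ σ m) =
      character k Δ τ (AddSubmonoid.inclusion (Fan.S_anti h) m) := by
  apply appLE_injective (toricChart k Δ τ) (le_preimage_toricOpen τ)
  rw [appLE_character]
  have e₁ : (toricVariety k Δ).presheaf.map (homOfLE (toricOpen_mono h)).op ≫
      (toricChart k Δ τ).appLE (toricOpen k Δ τ) ⊤ (le_preimage_toricOpen τ) =
      (toricChart k Δ σ).appLE (toricOpen k Δ σ) ⊤ (le_preimage_toricOpen σ) ≫
        (Spec.map (CommRingCat.ofHom (chartHom k Δ h))).appTop := by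
    rw [Scheme.Hom.map_appLE]
    exact (appLE_appTop (map_toricChart h) _ _ _).symm
  refine (congrArg (fun g => g.hom (character k Δ σ m)) e₁).trans ?_
  refine (congrArg (Spec.map (CommRingCat.ofHom (chartHom k Δ h))).appTop
    (appLE_character σ m)).trans ?_
  refine (congrArg (fun g => g.hom (AddMonoidAlgebra.single m 1))
    (Scheme.ΓSpecIso_inv_naturality (CommRingCat.ofHom (chartHom k Δ h)))).symm.trans ?_
  exact congrArg (Scheme.ΓSpecIso (.of (AddMonoidAlgebra k (Fan.S τ)))).inv
    (chartHom_single k Δ h m 1)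

theorem tropChart_restrict (x : AnPoint (toricStructure k Δ)) {τ σ : Δ.Cone} (h : τ ≤ σ)
    (hτ : x.pt ∈ toricOpen k Δ τ) :
    tropChart x σ (toricOpen_mono h hτ) = KPChart.restrict h (tropChart x τ hτ) := by
  refine AddMonoidHom.ext fun m => ?_
  change negLogTop (x.val _) = negLogTop (x.val ((toricVariety k Δ).evaluation _ x.pt hτ
    (character k Δ τ (AddSubmonoid.inclusion (Fan.S_anti h) m))))
  rw [← character_res h]
  congr 2
  exact (congrArg ((toricVariety k Δ).residue x.pt) ((toricVariety k Δ).presheaf.germ_res_apply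
    (homOfLE (toricOpen_mono h)) x.pt hτ (character k Δ σ m))).symm

theorem tropKP_eq (x : AnPoint (toricStructure k Δ)) (σ : Δ.Cone) (h : x.pt ∈ toricOpen k Δ σ) :
    tropKP x = KP.mk σ (tropChart x σ h) := by
  suffices H : ∀ (σ τ : Δ.Cone) (h : x.pt ∈ toricOpen k Δ σ) (h' : x.pt ∈ toricOpen k Δ τ),
      KP.mk σ (tropChart x σ h) = KP.mk τ (tropChart x τ h') from H _ _ _ _
  intro σ τ h h'
  obtain ⟨ρ, h₁, h₂, h₃⟩ : ∃ (ρ : Δ.Cone) (_ : ρ ≤ σ) (_ : ρ ≤ τ), x.pt ∈ toricOpen k Δ ρ := by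
    obtain ⟨y, hy⟩ := h
    obtain ⟨z, hz⟩ := h'
    obtain ⟨ρ, f, g, w, hw, -⟩ :=
      (Scheme.IsLocallyDirected.ι_eq_ι_iff (toricDiagram k Δ)).1 (hy.trans hz.symm)
    refine ⟨ρ, f.le, g.le, w, ?_⟩
    rw [← hy, ← hw]
    exact congrArg (fun q : _ ⟶ toricVariety k Δ => q w) (map_toricChart f.le).symm
  have e₁ := tropChart_restrict x h₁ h₃
  have e₂ := tropChart_restrict x h₂ h₃
  rw [e₁, e₂, KP.mk_restrict, KP.mk_restrict]

end KajiwaraPayne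

end LogTrop
end

open LogTrop

/-!
# Tropicalization of toric varieties as logarithmic schemes

The Kato fan of the toric variety `X` of a fan `Δ` is `Δ` itself, as a set of cones whose open
subsets are the sets closed under passage to faces, with stalk `S_σ / S_σ^*` at `σ`
(`Fan.katoFan`). Since the prime ideals of `S_σ` correspond to the faces of `σ` (`Fan.prime`,
`Fan.exists_eq_prime`), its charts are the spectra of the monoids `S_σ` (`Fan.chart`).

The characteristic morphism sends a point of `X` to the cone of its torus orbit. To see that it is
strict, one computes the stalks of the characteristic sheaf: a germ of a function that is invertible
on the torus is a character times a unit (`exists_logCharacter_mul`). Such an `f` divides a product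
`χ^m g` where `g` does not vanish at the point, say `f h = χ^m g`. For a weight `v ∈ σ`, the lowest
weights of terms of `f` and of `h` add up to the linear function `v(m)`; as minima of linear
functions both are concave in `v`, so both are linear on `σ`, and `f` has a single term of lowest
weight for all `v` simultaneously (`exists_eq_single_mul_of_mul_eq`). This argument needs neither
normality of `X` nor the theory of divisors. Characters differ by a unit exactly if they agree on
`σ`, hence the stalk at a point of the orbit of `σ` is `S_σ / S_σ^*`
(`bijective_associatesMap_logCharacter`).

For the universal property, let `ψ` be a strict morphism to a Kato fan. The characteristic sheaf is
constant along an orbit, and a strict morphism to a space covered by spectra identifies a point with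
a generization at which no further germ becomes invertible (`base_eq_of_specializes`). So `ψ` is
determined by the generic points of the orbits (`base_orbitGeneric`), where it gives the required
morphism from the Kato fan of `Δ` (`toricFactor`, `isCharacteristic_toricCharMap`). A characteristic
morphism is unique up to isomorphism, hence the target of any of them inherits the charts
(`IsToricAtlas`, `exists_isToricAtlas`).

Let `Q` be `[0, ∞)` or `[0, ∞]`. Its only unit is the neutral element, so that a morphism from
`Spec Q` to a Kato fan is determined by its germ at the closed point (`hom_ext_of_closedPoint`), and
the set of these morphisms is obtained by gluing the sets `Hom(S_σ, Q)` along faces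
(`IsToricAtlas.exists_desc`). For `Q = [0, ∞)`, biduality identifies `Hom(S_σ, Q)` with `σ`
(`Fan.exists_eq_pairing`). It rests on a form of Farkas' lemma for integral functions on a lattice
(`exists_eq_sum_of_nonneg`), from which Gordan's lemma and the separation of the cones of `Δ` by
lattice hyperplanes follow too. Gluing gives the homeomorphism of `Σ_X` with the support of `Δ`
(`IsToricAtlas.exists_homeomorph`).

For `Q = [0, ∞]`, the inclusions of `Hom(S_σ, Q)` into `N_ℝ(σ)` glue to a continuous injection. The
space `Hom(S_σ, Q)` is compact, and `N_ℝ(Δ)` is Hausdorff since separating characters describe its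
gluing relation by closed conditions (`KP.isClosed_setOf_incl_eq_incl`); therefore the injection is
a closed embedding (`IsToricAtlas.exists_isClosedEmbedding`). Its image contains the support of `Δ`,
and it is contained in the closure because every `g : S_σ → [0, ∞]` is a limit of points `h + n v` of
`σ`, where `v` lies in the relative interior of the face of `σ` that belongs to the prime ideal
`g = ∞` (`KP.ofRBar_mem_closure`).

Finally, the tropicalization of a point of `X^ℶ` with center in `U_σ` is the point given by the
homomorphism `m ↦ -log |χ^m|` on `S_σ` (`IsToricAtlas.exists_isTrop`), and the same formula defines
the Kajiwara-Payne tropicalization in the chart of `σ` (`tropKP_eq_ofRBar`). Centers are unique, by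
the valuative argument for the separatedness of `X` (`toAnPoint_injective`).
-/

namespace LogTrop

/-! ### Convex geometry over the integers -/

/-- Farkas' lemma over `ℤ`, by Bartl's induction: an additive function `b` with values in an ordered
field which is nonnegative wherever finitely many integral functions `A i` are, is a nonnegative
combination of them. The field need not be the one over which the `A i` are linear; this is what
makes rational cones of real functionals accessible without an approximation argument. -/
theorem exists_eq_sum_of_nonneg {ι W V : Type*} [AddCommGroup W] [Field V] [LinearOrder V]
    [IsStrictOrderedRing V] (s : Finset ι) (A : ι → W →+ ℤ) (b : W →+ V)
    (h : ∀ x, (∀ i ∈ s, 0 ≤ A i x) → 0 ≤ b x) :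
    ∃ c : ι → V, (∀ i, 0 ≤ c i) ∧ ∀ x, b x = ∑ i ∈ s, c i * (A i x : V) := by
  classical
  induction s using Finset.induction_on generalizing A b with
  | empty =>
    refine ⟨0, fun _ => le_rfl, fun x => ?_⟩
    have h₁ := h x (by simp)
    have h₂ := h (-x) (by simp)
    rw [map_neg] at h₂
    simpa using le_antisymm (neg_nonneg.1 h₂) h₁
  | insert a s ha ih =>
    by_cases h' : ∀ x, (∀ i ∈ s, 0 ≤ A i x) → 0 ≤ b x
    · obtain ⟨c, hc, hb⟩ := ih A b h'
      refine ⟨Function.update c a 0, fun i => ?_, fun x => ?_⟩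
      · by_cases hi : i = a
        · subst hi; simp
        · simpa [hi] using hc i
      · rw [Finset.sum_insert ha, Function.update_self, zero_mul, zero_add, hb]
        refine Finset.sum_congr rfl fun i hi => ?_
        rw [Function.update_of_ne (ne_of_mem_of_not_mem hi ha)]
    · push Not at h'
      obtain ⟨y, hy, hby⟩ := h'
      have hay : A a y < 0 := by
        by_contra! hay
        refine absurd (h y fun i hi => ?_) (not_le.2 hby)
        rcases Finset.mem_insert.1 hi with rfl | hi
        exacts [hay, hy i hi]
      -- project along `y` onto the hyperplane where `A a` vanishes
      let d : ℤ := -A a y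
      let π : W →+ W :=
        { toFun := fun x => d • x + (A a x) • y
          map_zero' := by simp
          map_add' := fun x x' => by rw [smul_add, map_add, add_smul]; abel }
      have hπ : ∀ x, π x = d • x + (A a x) • y := fun _ => rfl
      obtain ⟨c, hc, hb⟩ := ih (fun i => (A i).comp π) (b.comp π) (fun x hx => by
        refine h _ fun i hi => ?_
        rcases Finset.mem_insert.1 hi with rfl | hi
        · rw [hπ, map_add, map_zsmul, map_zsmul]
          simp only [smul_eq_mul, d]
          exact (by ring : (0 : ℤ) = _).le
        · exact hx i hi)
      have hd : (0 : V) < (d : V) := by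
        have : (0 : ℤ) < d := neg_pos.2 hay
        exact_mod_cast this
      have hs : 0 ≤ ∑ i ∈ s, c i * (A i y : V) :=
        Finset.sum_nonneg fun i hi => mul_nonneg (hc i) (by exact_mod_cast hy i hi)
      refine ⟨Function.update c a ((∑ i ∈ s, c i * (A i y : V) - b y) / d), fun i => ?_,
        fun x => ?_⟩
      · by_cases hi : i = a
        · subst hi
          rw [Function.update_self]
          exact div_nonneg (by linarith) hd.le
        · simpa [hi] using hc i
      · have key := hb x
        simp only [AddMonoidHom.comp_apply, hπ, map_add, map_zsmul, smul_eq_mul, zsmul_eq_mul,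
          Int.cast_add, Int.cast_mul] at key
        have e : ∑ i ∈ s, Function.update c a ((∑ i ∈ s, c i * (A i y : V) - b y) / d) i *
            (A i x : V) = ∑ i ∈ s, c i * (A i x : V) :=
          Finset.sum_congr rfl fun i hi => by
            rw [Function.update_of_ne (ne_of_mem_of_not_mem hi ha)]
        have e' : ∑ i ∈ s, c i * ((d : V) * (A i x : V) + (A a x : V) * (A i y : V)) =
            d * ∑ i ∈ s, c i * (A i x : V) + A a x * ∑ i ∈ s, c i * (A i y : V) := by
          rw [Finset.mul_sum, Finset.mul_sum, ← Finset.sum_add_distrib]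
          exact Finset.sum_congr rfl fun i _ => by ring
        rw [e'] at key
        rw [Finset.sum_insert ha, Function.update_self, e]
        field_simp
        linarith

section

variable {M : Type u} [AddCommGroup M]

/-- A rational cone is spanned by finitely many lattice points, membership in its dual monoid can be
tested on these, and by Farkas' lemma the dual monoid in turn determines the cone. -/
theorem IsRationalCone.exists_generators {σ : PointedCone ℝ (NR M)} (hσ : IsRationalCone σ) :
    ∃ s : Finset (M →+ ℤ), (∀ v ∈ s, latticePoint v ∈ σ) ∧
      (∀ m, m ∈ dualMonoid σ ↔ ∀ v ∈ s, 0 ≤ v m) ∧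
      ∀ u : NR M, (∀ m ∈ dualMonoid σ, 0 ≤ u m) → u ∈ σ := by
  obtain ⟨⟨s, hs⟩, -⟩ := hσ
  have hgen : ∀ v ∈ s, latticePoint v ∈ σ := fun v hv => by
    rw [hs]; exact Submodule.subset_span ⟨v, hv, rfl⟩
  have hdual : ∀ m, m ∈ dualMonoid σ ↔ ∀ v ∈ s, 0 ≤ v m := by
    refine fun m => ⟨fun hm v hv => ?_, fun hm u hu => ?_⟩
    · have : (0 : ℝ) ≤ (v m : ℝ) := hm _ (hgen v hv)
      exact_mod_cast this
    · rw [hs] at hu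
      induction hu using Submodule.span_induction with
      | mem x hx =>
        obtain ⟨v, hv, rfl⟩ := hx
        have : (0 : ℝ) ≤ (v m : ℝ) := by exact_mod_cast hm v hv
        exact this
      | zero => simp
      | add x y _ _ hx hy => exact add_nonneg hx hy
      | smul a x _ hx => exact mul_nonneg a.2 hx
  refine ⟨s, hgen, hdual, fun u hu => ?_⟩
  obtain ⟨c, hc, h⟩ := exists_eq_sum_of_nonneg s (fun v => v) u
    fun x hx => hu x ((hdual x).2 hx)
  have : u = ∑ v ∈ s, (⟨c v, hc v⟩ : {r : ℝ // 0 ≤ r}) • latticePoint v := by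
    refine AddMonoidHom.ext fun m => ?_
    rw [h, AddMonoidHom.finsetSum_apply]
    rfl
  rw [this]
  exact sum_mem fun v hv => Submodule.smul_mem _ _ (hgen v hv)

/-- Biduality for rational cones. -/
theorem IsRationalCone.mem_iff {σ : PointedCone ℝ (NR M)} (hσ : IsRationalCone σ) {u : NR M} :
    u ∈ σ ↔ ∀ m ∈ dualMonoid σ, 0 ≤ u m :=
  ⟨fun hu m hm => hm u hu, by
    obtain ⟨s, -, -, h⟩ := hσ.exists_generators
    exact h u⟩

/-- Gordan's lemma. -/
theorem IsRationalCone.dualMonoid_fg [Module.Finite ℤ M] {σ : PointedCone ℝ (NR M)}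
    (hσ : IsRationalCone σ) : (dualMonoid σ).FG := by
  classical
  obtain ⟨s, -, hdual, -⟩ := hσ.exists_generators
  obtain ⟨t, ht⟩ := Module.Finite.fg_top (R := ℤ) (M := M)
  -- `S_σ` is a quotient of the solutions of `v (∑ (aᵢ - bᵢ) mᵢ) = c_v` in natural numbers
  let β := (t ⊕ t) ⊕ s
  let π : (β → ℕ) →+ M :=
    { toFun := fun z => ∑ i : t, ((z (.inl (.inl i)) : ℤ) - z (.inl (.inr i))) • (i : M)
      map_zero' := by simp
      map_add' := fun z z' => by
        rw [← Finset.sum_add_distrib]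
        refine Finset.sum_congr rfl fun i _ => ?_
        rw [← add_smul, Pi.add_apply, Pi.add_apply]
        push_cast
        congr 1
        ring }
  let P : AddSubmonoid (β → ℕ) :=
    { carrier := {z | ∀ v : s, v.1 (π z) = z (.inr v)}
      zero_mem' := fun v => by simp
      add_mem' := fun {z z'} h h' v => by
        rw [map_add, map_add, h, h', Pi.add_apply]
        push_cast
        rfl }
  have hP : P.FG := AddSubmonoid.fg_of_subtractive fun x hx y hxy v => by
    have h₁ := hxy v
    rw [map_add, map_add, hx v, Pi.add_apply] at h₁
    push_cast at h₁
    linarith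
  have : dualMonoid σ = P.map π := by
    ext m
    rw [hdual]
    constructor
    · intro hm
      obtain ⟨c, hc⟩ : ∃ c : t → ℤ, ∑ i, c i • (i : M) = m := by
        have hm : m ∈ Submodule.span ℤ (t : Set M) := by rw [ht]; trivial
        obtain ⟨c, -, hc⟩ := Submodule.mem_span_finset.1 hm
        exact ⟨fun i => c i, by rw [← hc]; exact (Finset.sum_coe_sort t fun i => c i • i)⟩
      let z : β → ℕ := Sum.elim (Sum.elim (fun i => (c i).toNat) fun i => (-c i).toNat)
        fun v => (v.1 m).toNat
      have hz : π z = m := by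
        rw [← hc]
        refine Finset.sum_congr rfl fun i _ => ?_
        congr 1
        change ((c i).toNat : ℤ) - ((-c i).toNat : ℤ) = c i
        exact Int.toNat_sub_toNat_neg (c i)
      refine ⟨z, fun v => ?_, hz⟩
      rw [hz]
      exact (Int.toNat_of_nonneg (hm v v.2)).symm
    · rintro ⟨z, hz, rfl⟩ v hv
      rw [hz ⟨v, hv⟩]
      exact Int.natCast_nonneg _
  rw [this]
  exact hP.map π

variable {Δ : Fan M}

theorem Fan.mem_iff (σ : Δ.Cone) {u : NR M} : u ∈ σ.1 ↔ ∀ m ∈ Fan.S σ, 0 ≤ u m :=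
  (Δ.rational _ σ.2).mem_iff

theorem Fan.zeroCone_le (σ : Δ.Cone) : Δ.zeroCone ≤ σ := (bot_le : ⊥ ≤ σ.1)

theorem Fan.mem_S_zeroCone (m : M) : m ∈ Fan.S Δ.zeroCone := fun u hu => by
  rw [(Submodule.mem_bot _).1 hu]; exact le_rfl

/-- The face of a cone of `Δ` cut out by a character belongs to `Δ`. -/
theorem Fan.exists_face (σ : Δ.Cone) {m : M} (hm : m ∈ Fan.S σ) :
    ∃ τ : Δ.Cone, τ ≤ σ ∧ ∀ u, u ∈ τ.1 ↔ u ∈ σ.1 ∧ u m = 0 := by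
  let τ : PointedCone ℝ (NR M) :=
    { carrier := {u | u ∈ σ.1 ∧ u m = 0}
      zero_mem' := ⟨Submodule.zero_mem _, rfl⟩
      add_mem' := fun {u u'} h h' => ⟨add_mem h.1 h'.1, by
        change u m + u' m = 0
        rw [h.2, h'.2, add_zero]⟩
      smul_mem' := fun c u h => ⟨Submodule.smul_mem _ _ h.1, by
        change (c : ℝ) * u m = 0
        rw [h.2, mul_zero]⟩ }
  exact ⟨⟨τ, Δ.face_mem _ σ.2 _ ⟨m, hm, fun u => Iff.rfl⟩⟩, fun u h => h.1, fun u => Iff.rfl⟩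

/-- The intersection of two cones of a fan. -/
def Fan.inter (σ τ : Δ.Cone) : Δ.Cone :=
  ⟨σ.1 ⊓ τ.1, Δ.face_mem _ σ.2 _ (Δ.inter_face _ σ.2 _ τ.2)⟩

theorem Fan.inter_le_left (σ τ : Δ.Cone) : Fan.inter σ τ ≤ σ := (inf_le_left : σ.1 ⊓ τ.1 ≤ σ.1)

theorem Fan.inter_le_right (σ τ : Δ.Cone) : Fan.inter σ τ ≤ τ := (inf_le_right : σ.1 ⊓ τ.1 ≤ τ.1)

theorem Fan.le_inter {ρ σ τ : Δ.Cone} (h : ρ ≤ σ) (h' : ρ ≤ τ) : ρ ≤ Fan.inter σ τ :=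
  (le_inf h h' : ρ.1 ≤ σ.1 ⊓ τ.1)

/-- Since `σ` contains no line, `S_σ` generates `M` as a group, even after inverting a single
element. -/
theorem Fan.exists_add_nsmul_mem_S (σ : Δ.Cone) :
    ∃ m ∈ Fan.S σ, ∀ w : M, ∃ n : ℕ, w + n • m ∈ Fan.S σ := by
  obtain ⟨m, hm, h⟩ := Fan.isFace_of_le (Fan.zeroCone_le σ)
  exact ⟨m, hm, fun w => exists_add_nsmul_mem (Δ.rational _ σ.2) hm h (Fan.mem_S_zeroCone w)⟩

/-- Farkas' lemma for a sum `A + B` of monoids, with denominators cleared. -/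
theorem exists_pos_nsmul_eq_add [Module.Free ℤ M] {A B : AddSubmonoid M} (hA : A.FG) (hB : B.FG)
    {w : M} (h : ∀ v : M →+ ℤ, (∀ a ∈ A, 0 ≤ v a) → (∀ b ∈ B, 0 ≤ v b) → 0 ≤ v w) :
    ∃ n : ℕ, 0 < n ∧ ∃ a ∈ A, ∃ b ∈ B, n • w = a + b := by
  classical
  obtain ⟨s, hs⟩ := hA.sup hB
  have hsub : ∀ a ∈ s, a ∈ A ⊔ B := fun a ha => by
    rw [← hs]; exact AddSubmonoid.subset_closure ha
  obtain ⟨c, hc, e⟩ := exists_eq_sum_of_nonneg (V := ℚ) s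
    (fun a => (AddMonoidHom.eval a : (M →+ ℤ) →+ ℤ))
    ((Int.castAddHom ℚ).comp (AddMonoidHom.eval w)) fun v hv => by
      have hv' : ∀ a ∈ A ⊔ B, 0 ≤ v a := by
        intro a ha
        rw [← hs] at ha
        induction ha using AddSubmonoid.closure_induction with
        | mem x hx => exact hv x hx
        | zero => simp
        | add x y _ _ hx hy => rw [map_add]; exact add_nonneg hx hy
      have := h v (fun a ha => hv' a ((le_sup_left : A ≤ A ⊔ B) ha))
        (fun b hb => hv' b ((le_sup_right : B ≤ A ⊔ B) hb))
      change (0 : ℚ) ≤ (v w : ℚ)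
      exact_mod_cast this
  -- clear denominators
  let n : ℕ := ∏ a ∈ s, (c a).den
  have hn : 0 < n := Finset.prod_pos fun a _ => (c a).den_pos
  have hnum : ∀ a ∈ s, ∃ l : ℕ, (l : ℚ) = n * c a := by
    intro a ha
    refine ⟨(∏ b ∈ s.erase a, (c b).den) * (c a).num.toNat, ?_⟩
    have h₁ : ((c a).num.toNat : ℤ) = (c a).num :=
      Int.toNat_of_nonneg (Rat.num_nonneg.2 (hc a))
    have h₂ : (((c a).num.toNat : ℕ) : ℚ) = (c a).num := by exact_mod_cast congrArg (Int.cast : ℤ → ℚ) h₁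
    rw [show n = (c a).den * ∏ b ∈ s.erase a, (c b).den from
      (Finset.mul_prod_erase s (fun b => (c b).den) ha).symm]
    push_cast
    rw [h₂, mul_comm ((c a).den : ℚ), mul_assoc, Rat.den_mul_eq_num]
  choose! l hl using hnum
  have key : n • w = ∑ a ∈ s, l a • a := by
    refine (Module.Free.chooseBasis ℤ M).ext_elem fun i => ?_
    let v : M →+ ℤ := ((Module.Free.chooseBasis ℤ M).coord i).toAddMonoidHom
    change v (n • w) = v (∑ a ∈ s, l a • a)
    have e' : ((v w : ℤ) : ℚ) = ∑ a ∈ s, c a * (v a : ℚ) := e v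
    have : ((v (n • w) : ℤ) : ℚ) = (v (∑ a ∈ s, l a • a) : ℤ) := by
      rw [map_nsmul, map_sum, nsmul_eq_mul]
      push_cast
      rw [e', Finset.mul_sum]
      refine Finset.sum_congr rfl fun a ha => ?_
      rw [map_nsmul, nsmul_eq_mul]
      push_cast
      rw [hl a ha]
      ring
    exact_mod_cast this
  have hmem : n • w ∈ A ⊔ B := by
    rw [key]
    exact sum_mem fun a ha => nsmul_mem (hsub a ha) _
  obtain ⟨a, ha, b, hb, h⟩ := AddSubmonoid.mem_sup.1 hmem
  exact ⟨n, hn, a, ha, b, hb, h.symm⟩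

/-- The separation lemma: two cones of a fan are separated by a lattice hyperplane that cuts out
their intersection. -/
theorem Fan.exists_separating [Module.Free ℤ M] [Module.Finite ℤ M] (σ τ : Δ.Cone) :
    ∃ m ∈ Fan.S τ, -m ∈ Fan.S σ ∧ ∀ u, u ∈ (Fan.inter σ τ).1 ↔ u ∈ τ.1 ∧ u m = 0 := by
  obtain ⟨m, hm, h⟩ := Fan.isFace_of_le (Fan.inter_le_right σ τ)
  obtain ⟨n, hn, s, hs, t, ht, e⟩ : ∃ n : ℕ, 0 < n ∧ ∃ s ∈ Fan.S σ, ∃ t ∈ Fan.S τ,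
      n • (-m) = s + t := by
    refine exists_pos_nsmul_eq_add (Δ.rational _ σ.2).dualMonoid_fg
      (Δ.rational _ τ.2).dualMonoid_fg fun v h₁ h₂ => ?_
    have hv : latticePoint v ∈ (Fan.inter σ τ).1 :=
      ⟨(Fan.mem_iff σ).2 fun a ha => by
        have : (0 : ℝ) ≤ (v a : ℝ) := by exact_mod_cast h₁ a ha
        exact this, (Fan.mem_iff τ).2 fun a ha => by
        have : (0 : ℝ) ≤ (v a : ℝ) := by exact_mod_cast h₂ a ha
        exact this⟩
    have h₀ : ((v m : ℤ) : ℝ) = 0 := ((h _).1 hv).2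
    have h₀' : v m = 0 := by exact_mod_cast h₀
    rw [map_neg, h₀', neg_zero]
  have e' : -(t + n • m) = s := by
    rw [smul_neg] at e
    rw [neg_add, e]
    abel
  refine ⟨t + n • m, add_mem ht (nsmul_mem hm n), e' ▸ hs, fun u => ⟨fun hu => ?_, fun hu => ?_⟩⟩
  · refine ⟨hu.2, le_antisymm ?_ (add_mem ht (nsmul_mem hm n) u hu.2)⟩
    have := hs u hu.1
    rw [← e', map_neg] at this
    linarith
  · refine (h u).2 ⟨hu.1, ?_⟩
    have h₁ := hu.2
    rw [map_add, map_nsmul, nsmul_eq_mul] at h₁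
    have h₂ := ht u hu.1
    have h₃ := hm u hu.1
    have hn' : (0 : ℝ) < n := by exact_mod_cast hn
    nlinarith [mul_nonneg hn'.le h₃]

end

/-! ### Morphisms of monoidal spaces -/

namespace MonoidSheaf

variable {X : Type u} [TopologicalSpace X]

/-- Germs of sections that agree at a point agree at its generizations. -/
theorem eq_of_specializes (𝒪 : MonoidSheaf X) {U V : Opens X} {s : ∀ x : U, 𝒪.stalk x}
    {t : ∀ x : V, 𝒪.stalk x} (hs : 𝒪.IsSection U s) (ht : 𝒪.IsSection V t) {x y : X}
    (hxy : x ⤳ y) (hU : y ∈ U) (hV : y ∈ V) (h : s ⟨y, hU⟩ = t ⟨y, hV⟩) :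
    s ⟨x, hxy.mem_open U.2 hU⟩ = t ⟨x, hxy.mem_open V.2 hV⟩ := by
  obtain ⟨W, hW, hy, e⟩ := 𝒪.eq_near (U ⊓ V) _ _ (𝒪.res U _ inf_le_left s hs)
    (𝒪.res V _ inf_le_right t ht) ⟨y, hU, hV⟩ h
  exact e ⟨x, hxy.mem_open W.2 hy⟩

end MonoidSheaf

namespace MonoidalSpace

/-- Morphisms with the same underlying map agree if they agree on germs of sections of the target;
the statement avoids comparing stalk maps across an equality of points. -/
theorem Hom.ext_of_section {X : MonoidalSpace.{u}} {Y : MonoidalSpace.{v}} {f g : Hom X Y}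
    (hb : ∀ x, f.base x = g.base x)
    (h : ∀ (V : Opens Y.carrier) (s : ∀ y : V, Y.stalk y), Y.sheaf.IsSection V s →
      ∀ x (hf : f.base x ∈ V) (hg : g.base x ∈ V),
        f.stalkMap x (s ⟨f.base x, hf⟩) = g.stalkMap x (s ⟨g.base x, hg⟩)) : f = g := by
  obtain ⟨fb, fs, fl, fm⟩ := f
  obtain ⟨gb, gs, gl, gm⟩ := g
  obtain rfl : fb = gb := ContinuousMap.ext hb
  have : fs = gs := by
    funext x
    refine MonoidHom.ext fun a => ?_
    obtain ⟨U, hx, s, hs, rfl⟩ := Y.sheaf.exists_section _ a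
    exact h U s hs x hx hx
  subst this
  rfl

theorem Hom.stalkMap_congr {X : MonoidalSpace.{u}} {Y : MonoidalSpace.{v}} {f g : Hom X Y}
    (h : f = g) {V : Set Y.carrier} (s : ∀ y : V, Y.stalk y) (x : X.carrier) (hf : f.base x ∈ V)
    (hg : g.base x ∈ V) :
    f.stalkMap x (s ⟨f.base x, hf⟩) = g.stalkMap x (s ⟨g.base x, hg⟩) := by
  subst h
  rfl

/-- The identity morphism. -/
def Hom.id (X : MonoidalSpace.{u}) : Hom X X where
  base := ContinuousMap.id _
  stalkMap _ := MonoidHom.id _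
  isLocal _ _ h := h
  map_section _ _ hs := hs

theorem Hom.id_isStrict (X : MonoidalSpace.{u}) : (Hom.id X).IsStrict :=
  fun _ => Function.bijective_id

theorem Hom.IsStrict.comp {X : MonoidalSpace.{u}} {Y : MonoidalSpace.{v}} {Z : MonoidalSpace.{w}}
    {f : Hom X Y} {g : Hom Y Z} (hf : f.IsStrict) (hg : g.IsStrict) : (f.comp g).IsStrict :=
  fun x => (hf x).comp (hg _)

theorem Hom.IsOpenImmersion.comp {X : MonoidalSpace.{u}} {Y : MonoidalSpace.{v}}
    {Z : MonoidalSpace.{w}} {f : Hom X Y} {g : Hom Y Z} (hf : f.IsOpenImmersion)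
    (hg : g.IsOpenImmersion) : (f.comp g).IsOpenImmersion :=
  ⟨hg.isOpenEmbedding.comp hf.isOpenEmbedding, hf.isStrict.comp hg.isStrict⟩

/-- A surjective morphism that is injective on stalks is an epimorphism. -/
theorem Hom.comp_left_cancel {X : MonoidalSpace.{u}} {Y : MonoidalSpace.{v}}
    {Z : MonoidalSpace.{w}} {f : Hom X Y} (hf : Function.Surjective f.base)
    (hf' : ∀ x, Function.Injective (f.stalkMap x)) {g g' : Hom Y Z} (h : f.comp g = f.comp g') :
    g = g' := by
  refine Hom.ext_of_section (fun y => ?_) fun V s hs y hg hg' => ?_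
  · obtain ⟨x, rfl⟩ := hf y
    exact congrArg (fun p : Hom X Z => p.base x) h
  · obtain ⟨x, rfl⟩ := hf y
    exact hf' x (Hom.stalkMap_congr h s x hg hg')

theorem Hom.isOpenImmersion_of_inverse {X : MonoidalSpace.{u}} {Y : MonoidalSpace.{v}}
    {f : Hom X Y} {g : Hom Y X} (hfg : f.comp g = Hom.id X) (hgf : g.comp f = Hom.id Y)
    (hf : f.IsStrict) : f.IsOpenImmersion := by
  have h₁ : ∀ x, g.base (f.base x) = x := fun x =>
    congrArg (fun p : Hom X X => p.base x) hfg
  have h₂ : ∀ y, f.base (g.base y) = y := fun y =>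
    congrArg (fun p : Hom Y Y => p.base y) hgf
  let e : X.carrier ≃ₜ Y.carrier :=
    { toFun := f.base, invFun := g.base, left_inv := h₁, right_inv := h₂,
      continuous_toFun := f.base.continuous, continuous_invFun := g.base.continuous }
  exact ⟨e.isOpenEmbedding, hf⟩

end MonoidalSpace

/-! ### Spectra of monoids -/

section Spec

variable {P : Type u} [CommMonoid P] {Q : Type v} [CommMonoid Q]

namespace PrimeIdeal

theorem basicOpen_mul (a b : P) : basicOpen (a * b) = basicOpen a ∩ basicOpen b := by
  ext p
  refine ⟨fun h => ⟨fun ha => h ?_, fun hb => h (p.mul_mem _ _ hb)⟩, fun h h' =>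
    (p.mem_or_mem _ _ h').elim h.1 h.2⟩
  rw [mul_comm]
  exact p.mul_mem _ _ ha

theorem isTopologicalBasis_basicOpen :
    IsTopologicalBasis (Set.range (basicOpen (P := P))) where
  exists_subset_inter := by
    rintro _ ⟨a, rfl⟩ _ ⟨b, rfl⟩ p hp
    exact ⟨_, ⟨a * b, rfl⟩, by rwa [basicOpen_mul], (basicOpen_mul a b).subset⟩
  sUnion_eq := Set.eq_univ_of_forall fun p => ⟨_, ⟨1, rfl⟩, p.one_notMem⟩
  eq_generateFrom := rfl

theorem specializes_iff {p q : PrimeIdeal P} : p ⤳ q ↔ p.carrier ⊆ q.carrier := by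
  constructor
  · intro h a ha
    by_contra hq
    exact h.mem_open (isOpen_basicOpen a) (show q ∈ basicOpen a from hq) ha
  · intro h
    rw [specializes_iff_forall_open]
    intro U hU hq
    obtain ⟨_, ⟨a, rfl⟩, ha, hs⟩ := isTopologicalBasis_basicOpen.exists_subset_of_mem_open hq hU
    exact hs fun hp => ha (h hp)

theorem specializes_closedPoint (p : PrimeIdeal P) : p ⤳ closedPoint P :=
  specializes_iff.2 fun a ha hu => p.one_notMem <| by
    obtain ⟨b, hb⟩ := hu.exists_left_inv
    rw [← hb]
    exact p.mul_mem _ _ ha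

end PrimeIdeal

/-- The homomorphism from `P` to the stalk `P_𝔭 / P_𝔭^*` of `Spec P`. -/
def toStalk (p : PrimeIdeal P) : P →* (MSpec P).stalk p where
  toFun a := Associates.mk (Localization.mk a 1)
  map_one' := congrArg Associates.mk Localization.mk_one
  map_mul' a b := by
    rw [← one_mul (1 : p.compl), ← Localization.mk_mul, one_mul]
    rfl

theorem mk_eq_toStalk (p : PrimeIdeal P) (a : P) (b : p.compl) :
    Associates.mk (Localization.mk a b) = toStalk p a := by
  refine Associates.mk_eq_mk_iff_associated.2 ?_
  have hu : IsUnit (Localization.mk (b : P) (1 : p.compl)) :=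
    (PrimeIdeal.isUnit_mk_iff p _ _).2 b.2
  refine ⟨hu.unit, ?_⟩
  rw [IsUnit.unit_spec, Localization.mk_mul, mul_one, Localization.mk_eq_mk_iff,
    Localization.r_iff_exists]
  exact ⟨1, by simp [mul_comm]⟩

theorem toStalk_surjective (p : PrimeIdeal P) : Function.Surjective (toStalk p) := by
  intro x
  obtain ⟨y, rfl⟩ := Associates.mk_surjective x
  induction y using Localization.induction_on with
  | H y => exact ⟨y.1, (mk_eq_toStalk p y.1 y.2).symm⟩

theorem isUnit_toStalk (p : PrimeIdeal P) (a : P) : IsUnit (toStalk p a) ↔ a ∉ p.carrier :=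
  Associates.isUnit_mk.trans (PrimeIdeal.isUnit_mk_iff p a 1)

/-- Two elements of `P` have the same germ at `p` if and only if they agree up to factors outside of
`p`. -/
theorem toStalk_eq_iff {p : PrimeIdeal P} {a b : P} : toStalk p a = toStalk p b ↔
    ∃ c ∈ p.compl, ∃ d ∈ p.compl, c * a = d * b := by
  constructor
  · intro h
    obtain ⟨w, hw⟩ := Associates.mk_eq_mk_iff_associated.1 h
    have hu : IsUnit (w : p.Loc) := w.isUnit
    revert hw hu
    generalize (w : p.Loc) = z
    induction z using Localization.induction_on with
    | H y =>
      obtain ⟨e, g⟩ := y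
      intro hw hu
      rw [PrimeIdeal.isUnit_mk_iff] at hu
      rw [Localization.mk_mul, Localization.mk_eq_mk_iff, Localization.r_iff_exists] at hw
      obtain ⟨r, hr⟩ := hw
      refine ⟨r * e, mul_mem r.2 hu, r * g, mul_mem r.2 g.2, ?_⟩
      simp only [OneMemClass.coe_one, one_mul] at hr
      rw [mul_assoc, mul_comm e a, hr, mul_assoc]
  · rintro ⟨c, hc, d, hd, h⟩
    have h₁ := (isUnit_toStalk p c).2 hc
    have h₂ := (isUnit_toStalk p d).2 hd
    have h₃ := congrArg (toStalk p) h
    rw [map_mul, map_mul] at h₃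
    have e : ∀ x : (MSpec P).stalk p, IsUnit x → x = 1 := fun x hx =>
      Associates.isUnit_iff_eq_one x |>.1 hx
    rwa [e _ h₁, e _ h₂, one_mul, one_mul] at h₃

theorem map_toStalk (f : P →* Q) (q : PrimeIdeal Q) (a : P) :
    (MSpec.map f).stalkMap q (toStalk (PrimeIdeal.comap f q) a) = toStalk q (f a) :=
  (congrArg Associates.mk (PrimeIdeal.locMap_mk f q a 1)).trans (mk_eq_toStalk q (f a) _)

theorem isSection_toStalk (U : Opens (PrimeIdeal P)) (a : P) :
    (MSpec P).sheaf.IsSection U fun p => toStalk p.1 a :=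
  fun p => ⟨U, le_rfl, p.2, a, 1, fun _ => ⟨one_mem _, rfl⟩⟩

theorem section_eq_toStalk {U : Opens (PrimeIdeal P)} {s : ∀ p : U, (MSpec P).stalk p}
    (hs : (MSpec P).sheaf.IsSection U s) {p q : PrimeIdeal P} (hpq : p ⤳ q) (hq : q ∈ U) {a : P}
    (h : s ⟨q, hq⟩ = toStalk q a) : s ⟨p, hpq.mem_open U.2 hq⟩ = toStalk p a :=
  (MSpec P).sheaf.eq_of_specializes hs (isSection_toStalk U a) hpq hq hq h

theorem toStalk_closedPoint_injective (hQ : ∀ q : Q, IsUnit q → q = 1) :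
    Function.Injective (toStalk (PrimeIdeal.closedPoint Q)) := by
  intro a b h
  obtain ⟨c, hc, d, hd, h⟩ := toStalk_eq_iff.1 h
  have e : ∀ x ∈ (PrimeIdeal.closedPoint Q).compl, x = 1 := fun x hx => hQ x (not_not.1 hx)
  rwa [e c hc, e d hd, one_mul, one_mul] at h

/-! ### Morphisms from the spectrum of a sharp monoid -/

section Sharp

variable {F : MonoidalSpace.{u}} {j : MonoidalSpace.Hom (MSpec P) F}

open MonoidalSpace

/-- Sections of `F` near a point of an open affine realize every element of the monoid. -/
theorem exists_section_toStalk (hj : j.IsStrict) (p : PrimeIdeal P) (a : P) :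
    ∃ (V : Opens F.carrier) (hp : j.base p ∈ V) (s : ∀ y : V, F.stalk y), F.sheaf.IsSection V s ∧
      j.stalkMap p (s ⟨j.base p, hp⟩) = toStalk p a := by
  obtain ⟨b, hb⟩ := (hj p).2 (toStalk p a)
  obtain ⟨V, hp, s, hs, e⟩ := F.sheaf.exists_section _ b
  exact ⟨V, hp, s, hs, by rw [e, hb]⟩

theorem mem_range_of_specializes (hj : j.IsOpenImmersion) {x : F.carrier} {p : PrimeIdeal P}
    (h : x ⤳ j.base p) : ∃ q, q ⤳ p ∧ j.base q = x := by
  obtain ⟨q, rfl⟩ := h.mem_open hj.isOpenEmbedding.isOpen_range ⟨p, rfl⟩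
  exact ⟨q, hj.isOpenEmbedding.isInducing.specializes_iff.1 h, rfl⟩

/-- In a chart `j : Spec P → F`, whether an element lies in a prime can be read off from the
invertibility of the corresponding germ on `F`. -/
theorem mem_iff_isUnit {V : Opens F.carrier} {s : ∀ y : V, F.stalk y} {p : PrimeIdeal P}
    (hp : j.base p ∈ V) {a : P} (h : j.stalkMap p (s ⟨j.base p, hp⟩) = toStalk p a) :
    a ∉ p.carrier ↔ IsUnit (s ⟨j.base p, hp⟩) := by
  rw [← isUnit_toStalk, ← h]
  exact ⟨j.isLocal p _, fun h => h.map _⟩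

/-- A morphism from the spectrum of a monoid to a space covered by spectra is determined by its
germ at the closed point, because every germ at a generization of a point of `Spec P` extends to
that point. -/
theorem hom_ext_of_closedPoint
    (hF : ∀ y : F.carrier, ∃ (P : Type u) (_ : CommMonoid P) (j : Hom (MSpec P) F),
      j.IsOpenImmersion ∧ y ∈ Set.range j.base)
    {f g : Hom (MSpec Q) F}
    (hb : f.base (PrimeIdeal.closedPoint Q) = g.base (PrimeIdeal.closedPoint Q))
    (h : ∀ (V : Opens F.carrier) (s : ∀ y : V, F.stalk y), F.sheaf.IsSection V s →
      ∀ (hf : f.base (PrimeIdeal.closedPoint Q) ∈ V) (hg : g.base (PrimeIdeal.closedPoint Q) ∈ V),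
        f.stalkMap _ (s ⟨_, hf⟩) = g.stalkMap _ (s ⟨_, hg⟩)) : f = g := by
  obtain ⟨P, _, j, hj, p, hp⟩ := hF (f.base (PrimeIdeal.closedPoint Q))
  have hglob : ∀ (V : Opens F.carrier) (s : ∀ y : V, F.stalk y), F.sheaf.IsSection V s →
      j.base p ∈ V → ∀ q : PrimeIdeal Q, ∃ (h₁ : f.base q ∈ V) (h₂ : g.base q ∈ V),
        f.stalkMap q (s ⟨_, h₁⟩) = g.stalkMap q (s ⟨_, h₂⟩) := by
    intro V s hs hV q
    have hf : f.base (PrimeIdeal.closedPoint Q) ∈ V := hp ▸ hV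
    have hg : g.base (PrimeIdeal.closedPoint Q) ∈ V := hb ▸ hf
    exact ⟨_, _, (MSpec Q).sheaf.eq_of_specializes (f.map_section V s hs) (g.map_section V s hs)
      (PrimeIdeal.specializes_closedPoint q) hf hg (h V s hs hf hg)⟩
  have hgen : ∀ (k : Hom (MSpec Q) F), k.base (PrimeIdeal.closedPoint Q) = j.base p →
      ∀ q, ∃ p', p' ⤳ p ∧ j.base p' = k.base q := fun k hk q => by
    refine mem_range_of_specializes hj ?_
    rw [← hk]
    exact (PrimeIdeal.specializes_closedPoint q).map k.base.continuous
  have hbase : ∀ q, f.base q = g.base q := by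
    intro q
    obtain ⟨p₁, h₁, e₁⟩ := hgen f hp.symm q
    obtain ⟨p₂, h₂, e₂⟩ := hgen g (hb.symm.trans hp.symm) q
    rw [← e₁, ← e₂]
    congr 1
    ext a
    obtain ⟨V, hV, s, hs, e⟩ := exists_section_toStalk hj.isStrict p a
    obtain ⟨hf, hg, e'⟩ := hglob V s hs hV q
    have k₁ := section_eq_toStalk (j.map_section V s hs) h₁ hV e
    have k₂ := section_eq_toStalk (j.map_section V s hs) h₂ hV e
    rw [← not_iff_not, mem_iff_isUnit (j := j) (p := p₁) (e₁ ▸ hf) k₁,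
      mem_iff_isUnit (j := j) (p := p₂) (e₂ ▸ hg) k₂]
    have t : ∀ x y (h : x = y) (hx : x ∈ V) (hy : y ∈ V),
        IsUnit (s ⟨x, hx⟩) ↔ IsUnit (s ⟨y, hy⟩) := by
      rintro x y rfl hx hy
      rfl
    rw [t _ _ e₁ _ hf, t _ _ e₂ _ hg]
    exact ⟨fun h => g.isLocal q _ (e' ▸ h.map _), fun h => f.isLocal q _ (e'.symm ▸ h.map _)⟩
  refine Hom.ext_of_section hbase fun V t ht q hf hg => ?_
  obtain ⟨p₁, h₁, e₁⟩ := hgen f hp.symm q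
  have hV₁ : j.base p₁ ∈ V := e₁ ▸ hf
  obtain ⟨a, ha⟩ := toStalk_surjective p₁ (j.stalkMap p₁ (t ⟨j.base p₁, hV₁⟩))
  obtain ⟨W, hW, s, hs, e⟩ := exists_section_toStalk hj.isStrict p a
  obtain ⟨hf', hg', e'⟩ := hglob W s hs hW q
  have k := section_eq_toStalk (j.map_section W s hs) h₁ hW e
  have hts : ∀ x (hx : x = j.base p₁) (hV : x ∈ V) (hW : x ∈ W), t ⟨x, hV⟩ = s ⟨x, hW⟩ := by
    rintro x rfl hV hW
    exact (hj.isStrict p₁).1 (ha.symm.trans k.symm)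
  rw [hts _ e₁.symm hf hf', hts _ ((hbase q).symm.trans e₁.symm) hg hg', e']

/-- For `g : P → Q`, the pullback of a section along `Spec Q → Spec P → F`. -/
theorem ofHom_stalkMap {V : Opens F.carrier} {s : ∀ y : V, F.stalk y} (g : P →* Q)
    (q : PrimeIdeal Q) (hV : j.base (PrimeIdeal.comap g q) ∈ V) {a : P}
    (h : j.stalkMap _ (s ⟨j.base (PrimeIdeal.comap g q), hV⟩) = toStalk _ a) :
    (Points.ofHom j g).stalkMap q (s ⟨_, hV⟩) = toStalk q (g a) := by
  refine Eq.trans ?_ (map_toStalk g q a)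
  exact congrArg ((MSpec.map g).stalkMap q) h

/-- A local homomorphism from a stalk of `F` to a sharp monoid `Q` is the germ at the closed point
of a morphism `Spec Q → Spec P → F`. -/
theorem exists_ofHom_germ (hj : j.IsOpenImmersion)
    (p : PrimeIdeal P) (l : F.stalk (j.base p) →* Q) (hl : ∀ a, IsUnit (l a) → IsUnit a) :
    ∃ g : P →* Q, PrimeIdeal.comap g (PrimeIdeal.closedPoint Q) = p ∧
      (∀ a b, j.stalkMap p a = toStalk p b → g b = l a) ∧
      ∀ (V : Opens F.carrier) (s : ∀ y : V, F.stalk y), F.sheaf.IsSection V s →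
        ∀ (hp : j.base p ∈ V) (hg : (Points.ofHom j g).base (PrimeIdeal.closedPoint Q) ∈ V),
          (Points.ofHom j g).stalkMap _ (s ⟨_, hg⟩) = toStalk _ (l (s ⟨_, hp⟩)) := by
  let ε : F.stalk (j.base p) ≃* (MSpec P).stalk p :=
    MulEquiv.ofBijective (j.stalkMap p) (hj.isStrict p)
  let g : P →* Q := l.comp (ε.symm.toMonoidHom.comp (toStalk p))
  have hgl : ∀ a b, j.stalkMap p a = toStalk p b → g b = l a := by
    intro a b h
    refine congrArg l ?_
    exact ε.symm_apply_eq.2 (show toStalk p b = ε a from h.symm)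
  have hc : PrimeIdeal.comap g (PrimeIdeal.closedPoint Q) = p := by
    ext b
    rw [← not_iff_not]
    refine Iff.trans ?_ (isUnit_toStalk p b)
    change ¬ ¬ IsUnit (g b) ↔ _
    rw [not_not]
    refine ⟨fun h => ?_, fun h => (h.map ε.symm.toMonoidHom).map l⟩
    have := (hl _ h).map ε
    rwa [MonoidHom.comp_apply, MulEquiv.toMonoidHom_eq_coe, MonoidHom.coe_coe,
      MulEquiv.apply_symm_apply] at this
  refine ⟨g, hc, hgl, fun V s hs hp hg => ?_⟩
  obtain ⟨a, ha⟩ := toStalk_surjective p (j.stalkMap p (s ⟨j.base p, hp⟩))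
  rw [← hgl _ a ha.symm]
  refine ofHom_stalkMap g _ hg ?_
  have : ∀ q (hq : q = p) (h : j.base q ∈ V), j.stalkMap q (s ⟨j.base q, h⟩) = toStalk q a := by
    rintro q rfl h
    exact ha.symm
  exact this _ hc hg

/-- A morphism from `Spec Q` that sends the closed point into an open affine factors through it. -/
theorem exists_eq_ofHom
    (hF : ∀ y : F.carrier, ∃ (P : Type u) (_ : CommMonoid P) (j : Hom (MSpec P) F),
      j.IsOpenImmersion ∧ y ∈ Set.range j.base)
    (hQ : ∀ q : Q, IsUnit q → q = 1) (hj : j.IsOpenImmersion) (f : Points F Q)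
    (p : PrimeIdeal P) (hp : f.base (PrimeIdeal.closedPoint Q) = j.base p) :
    ∃ g : P →* Q, f = Points.ofHom j g ∧ PrimeIdeal.comap g (PrimeIdeal.closedPoint Q) = p := by
  let ε : Q ≃* (MSpec Q).stalk (PrimeIdeal.closedPoint Q) :=
    MulEquiv.ofBijective (toStalk _) ⟨toStalk_closedPoint_injective hQ, toStalk_surjective _⟩
  obtain ⟨l, hl, hl'⟩ : ∃ l : F.stalk (j.base p) →* Q, (∀ a, IsUnit (l a) → IsUnit a) ∧
      ∀ (V : Opens F.carrier) (s : ∀ y : V, F.stalk y) (h₁ : j.base p ∈ V)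
        (h₂ : f.base (PrimeIdeal.closedPoint Q) ∈ V),
        toStalk _ (l (s ⟨_, h₁⟩)) = f.stalkMap _ (s ⟨_, h₂⟩) := by
    rw [← hp]
    refine ⟨ε.symm.toMonoidHom.comp (f.stalkMap _), fun a ha => f.isLocal _ a ?_, ?_⟩
    · have := ha.map ε
      rwa [MonoidHom.comp_apply, MulEquiv.toMonoidHom_eq_coe, MonoidHom.coe_coe,
        MulEquiv.apply_symm_apply] at this
    · intro V s h₁ h₂
      exact ε.apply_symm_apply _
  obtain ⟨g, hg, -, h⟩ := exists_ofHom_germ hj p l hl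
  have e : (Points.ofHom j g).base (PrimeIdeal.closedPoint Q) = j.base p := congrArg j.base hg
  refine ⟨g, hom_ext_of_closedPoint hF (hp.trans e.symm) fun V s hs hf hg' => ?_, hg⟩
  rw [h V s hs (hp ▸ hf) hg', hl' V s _ hf]

theorem ofHom_injective (hQ : ∀ q : Q, IsUnit q → q = 1) (hj : j.IsOpenImmersion) :
    Function.Injective (Points.ofHom j : (P →* Q) → Points F Q) := by
  intro g g' h
  refine MonoidHom.ext fun a => toStalk_closedPoint_injective hQ ?_
  have hb : (Points.ofHom j g).base (PrimeIdeal.closedPoint Q) =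
      (Points.ofHom j g').base (PrimeIdeal.closedPoint Q) := by rw [h]
  obtain ⟨V, hV, s, hs, e⟩ := exists_section_toStalk hj.isStrict
    (PrimeIdeal.comap g (PrimeIdeal.closedPoint Q)) a
  have hc : PrimeIdeal.comap g (PrimeIdeal.closedPoint Q) =
      PrimeIdeal.comap g' (PrimeIdeal.closedPoint Q) := hj.isOpenEmbedding.injective hb
  have e' : ∀ q (hq : PrimeIdeal.comap g (PrimeIdeal.closedPoint Q) = q) (h : j.base q ∈ V),
      j.stalkMap q (s ⟨j.base q, h⟩) = toStalk q a := by
    rintro q rfl h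
    exact e
  rw [← ofHom_stalkMap g _ hV e, ← ofHom_stalkMap g' _ (hc ▸ hV) (e' _ hc _)]
  exact Hom.stalkMap_congr h s _ _ _

/-- Morphisms `Spec Q → F` that factor through `i : Spec P' → F` factor through any open affine that
contains the image of the closed point of `Spec P'`, and the factorization depends on the given one
only through evaluation at elements of `P'`. -/
theorem exists_reparametrization
    (hF : ∀ y : F.carrier, ∃ (P : Type u) (_ : CommMonoid P) (j : Hom (MSpec P) F),
      j.IsOpenImmersion ∧ y ∈ Set.range j.base)
    (hQ : ∀ q : Q, IsUnit q → q = 1) (hj : j.IsOpenImmersion) {P' : Type u} [CommMonoid P']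
    (i : Hom (MSpec P') F) (p : PrimeIdeal P)
    (hp : i.base (PrimeIdeal.closedPoint P') = j.base p) :
    ∃ θ : P → P', ∀ g : P' →* Q, ∃ g' : P →* Q, Points.ofHom i g = Points.ofHom j g' ∧
      ∀ a, g' a = g (θ a) := by
  have hθ : ∀ a : P, ∃ (b : P') (V : Opens F.carrier) (hV : j.base p ∈ V)
      (s : ∀ y : V, F.stalk y), F.sheaf.IsSection V s ∧
      j.stalkMap p (s ⟨j.base p, hV⟩) = toStalk p a ∧
      ∃ hV' : i.base (PrimeIdeal.closedPoint P') ∈ V,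
        i.stalkMap _ (s ⟨_, hV'⟩) = toStalk _ b := by
    intro a
    obtain ⟨V, hV, s, hs, e⟩ := exists_section_toStalk hj.isStrict p a
    have hV' : i.base (PrimeIdeal.closedPoint P') ∈ V := hp ▸ hV
    obtain ⟨b, hb⟩ := toStalk_surjective _ (i.stalkMap _ (s ⟨_, hV'⟩))
    exact ⟨b, V, hV, s, hs, e, hV', hb.symm⟩
  choose θ hθ using hθ
  refine ⟨θ, fun g => ?_⟩
  obtain ⟨p₁, h₁, e₁⟩ : ∃ p₁, p₁ ⤳ p ∧
      j.base p₁ = (Points.ofHom i g).base (PrimeIdeal.closedPoint Q) := by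
    refine mem_range_of_specializes hj ?_
    rw [← hp]
    exact (PrimeIdeal.specializes_closedPoint _).map i.base.continuous
  obtain ⟨g', h, hg'⟩ := exists_eq_ofHom hF hQ hj (Points.ofHom i g) p₁ e₁.symm
  refine ⟨g', h, fun a => toStalk_closedPoint_injective hQ ?_⟩
  obtain ⟨V, hV, s, hs, e, hV', e'⟩ := hθ a
  have k := section_eq_toStalk (j.map_section V s hs) h₁ hV e
  have k' := section_eq_toStalk (i.map_section V s hs)
    (PrimeIdeal.specializes_closedPoint (PrimeIdeal.comap g (PrimeIdeal.closedPoint Q))) hV' e'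
  have r : ∀ q (hq : q = p₁) (h : j.base q ∈ V),
      j.stalkMap q (s ⟨j.base q, h⟩) = toStalk q a := by
    rintro q rfl h
    exact k
  have m : (Points.ofHom j g').base (PrimeIdeal.closedPoint Q) ∈ V := by
    rw [← h, ← e₁]
    exact h₁.mem_open (V.2.preimage j.base.continuous) hV
  rw [← ofHom_stalkMap g' _ m (r _ hg' m), ← ofHom_stalkMap g _ _ k']
  exact Hom.stalkMap_congr h.symm s _ _ _

end Sharp

end Spec

/-! ### The Kato fan of a fan -/

section KatoFan

variable {M : Type u} [AddCommGroup M] {Δ : Fan M}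

/-- The topology on `Δ` whose open sets are the sets of cones closed under passing to faces. -/
instance Fan.topologicalSpace : TopologicalSpace Δ.Cone where
  IsOpen U := IsLowerSet U
  isOpen_univ := isLowerSet_univ
  isOpen_inter _ _ := IsLowerSet.inter
  isOpen_sUnion _ := isLowerSet_sUnion

/-- The monoid `S_σ / S_σ^*`. -/
abbrev Fan.SharpS (σ : Δ.Cone) : Type u := Associates (Multiplicative (Fan.S σ))

/-- The inclusion `S_σ ⊆ S_τ` for `τ ≤ σ`, written multiplicatively. -/
abbrev Fan.inclS {τ σ : Δ.Cone} (h : τ ≤ σ) :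
    Multiplicative (Fan.S σ) →* Multiplicative (Fan.S τ) :=
  AddMonoidHom.toMultiplicative (AddSubmonoid.inclusion (Fan.S_anti h))

/-- The homomorphism `S_σ / S_σ^* → S_τ / S_τ^*` for `τ ≤ σ`. -/
def Fan.resS {τ σ : Δ.Cone} (h : τ ≤ σ) : Fan.SharpS σ →* Fan.SharpS τ :=
  associatesMap (Fan.inclS h)

theorem Fan.resS_mk {τ σ : Δ.Cone} (h : τ ≤ σ) (m : Multiplicative (Fan.S σ)) :
    Fan.resS h (Associates.mk m) = Associates.mk (Fan.inclS h m) := rfl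

theorem Fan.resS_resS {ρ τ σ : Δ.Cone} (h : ρ ≤ τ) (h' : τ ≤ σ) (a : Fan.SharpS σ) :
    Fan.resS h (Fan.resS h' a) = Fan.resS (h.trans h') a := by
  obtain ⟨m, rfl⟩ := Associates.mk_surjective a
  rfl

theorem Fan.resS_refl {σ : Δ.Cone} (h : σ ≤ σ) (a : Fan.SharpS σ) : Fan.resS h a = a := by
  obtain ⟨m, rfl⟩ := Associates.mk_surjective a
  rfl

/-- The cones contained in `σ`. -/
def Fan.below (σ : Δ.Cone) : Opens Δ.Cone := ⟨Set.Iic σ, isLowerSet_Iic σ⟩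

variable (Δ) in
/-- The sheaf on `Δ` with stalks `S_σ / S_σ^*`. A section on an open set is a family that is
compatible with the homomorphisms `S_σ / S_σ^* → S_τ / S_τ^*`. -/
def Fan.sheaf : MonoidSheaf Δ.Cone where
  stalk σ := Fan.SharpS σ
  IsSection U s := ∀ (τ σ : Δ.Cone) (h : τ ≤ σ) (hσ : σ ∈ U) (hτ : τ ∈ U),
    Fan.resS h (s ⟨σ, hσ⟩) = s ⟨τ, hτ⟩
  one_section U τ σ h _ _ := map_one _
  mul_section U s t hs ht τ σ h hσ hτ := by rw [map_mul, hs τ σ h hσ hτ, ht τ σ h hσ hτ]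
  res U V hVU s hs τ σ h hσ hτ := hs τ σ h _ _
  glue U s hs τ σ h hσ hτ := by
    obtain ⟨V, hV, hσV, e⟩ := hs ⟨σ, hσ⟩
    exact e τ σ h hσV (V.2 h hσV)
  exists_section σ a := ⟨Fan.below σ, (le_refl σ), fun τ => Fan.resS τ.2 a,
    fun _ _ _ _ _ => Fan.resS_resS _ _ _, Fan.resS_refl _ _⟩
  eq_near U s t hs ht σ h := ⟨Fan.below σ.1, fun τ hτ => U.2 hτ σ.2, le_refl σ.1, fun τ => by
    rw [← hs τ.1 σ.1 τ.2 σ.2, ← ht τ.1 σ.1 τ.2 σ.2]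
    exact congrArg _ h⟩

variable (Δ) in
/-- The Kato fan of `Δ`: its points are the cones of `Δ`. -/
abbrev Fan.katoFan : MonoidalSpace.{u} := ⟨Δ.Cone, Fan.sheaf Δ⟩

/-! ### Faces of a cone and prime ideals of its dual monoid -/

/-- The prime ideal `S_σ - τ^⊥` of `S_σ`. -/
def Fan.prime {τ σ : Δ.Cone} (h : τ ≤ σ) : PrimeIdeal (Multiplicative (Fan.S σ)) where
  carrier := {m | ∃ u ∈ τ.1, u (m.toAdd : M) ≠ 0}
  mul_mem a b := by
    rintro ⟨u, hu, hb⟩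
    refine ⟨u, hu, fun h0 => hb ?_⟩
    have e : u (a.toAdd : M) + u (b.toAdd : M) = 0 := by rw [← map_add]; exact h0
    have h₁ := a.toAdd.2 u (h hu)
    have h₂ := b.toAdd.2 u (h hu)
    linarith
  one_notMem := by
    rintro ⟨u, hu, h⟩
    exact h (map_zero u)
  mem_or_mem a b := by
    rintro ⟨u, hu, hab⟩
    by_contra! hc
    refine hab ?_
    have h₁ : u (a.toAdd : M) = 0 := by by_contra h; exact hc.1 ⟨u, hu, h⟩
    have h₂ : u (b.toAdd : M) = 0 := by by_contra h; exact hc.2 ⟨u, hu, h⟩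
    change u ((a.toAdd : M) + (b.toAdd : M)) = 0
    rw [map_add, h₁, h₂, add_zero]

theorem Fan.notMem_prime {τ σ : Δ.Cone} (h : τ ≤ σ) {m : Multiplicative (Fan.S σ)} :
    m ∉ (Fan.prime h).carrier ↔ ∀ u ∈ τ.1, u (m.toAdd : M) = 0 := by
  change ¬ (∃ u ∈ τ.1, _) ↔ _
  push Not
  rfl

theorem Fan.exists_notMem_prime {τ σ : Δ.Cone} (h : τ ≤ σ) :
    ∃ m : Multiplicative (Fan.S σ), m ∉ (Fan.prime h).carrier ∧
      ∀ u, u ∈ τ.1 ↔ u ∈ σ.1 ∧ u (m.toAdd : M) = 0 := by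
  obtain ⟨m, hm, e⟩ := Fan.isFace_of_le h
  exact ⟨.ofAdd ⟨m, hm⟩, (Fan.notMem_prime h).2 fun u hu => ((e u).1 hu).2, e⟩

theorem Fan.le_of_prime_le {τ τ' σ : Δ.Cone} (h : τ ≤ σ) (h' : τ' ≤ σ)
    (hp : (Fan.prime h).carrier ⊆ (Fan.prime h').carrier) : τ ≤ τ' := by
  obtain ⟨m, hm, e⟩ := Fan.exists_notMem_prime h'
  exact fun u hu => (e u).2 ⟨h hu, (Fan.notMem_prime h).1 (fun hm' => hm (hp hm')) u hu⟩

/-- Every prime ideal of `S_σ` is the complement of `τ^⊥` for a face `τ`: a face of the finitely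
generated monoid `S_σ` is the face spanned by the sum of the generators that it contains. -/
theorem Fan.exists_eq_prime [Module.Finite ℤ M] {σ : Δ.Cone}
    (p : PrimeIdeal (Multiplicative (Fan.S σ))) :
    ∃ (τ : Δ.Cone) (h : τ ≤ σ), p = Fan.prime h := by
  classical
  obtain ⟨t, ht⟩ := (Δ.rational _ σ.2).dualMonoid_fg
  let s : Finset M := t.filter fun m => ∃ h : m ∈ Fan.S σ, Multiplicative.ofAdd ⟨m, h⟩ ∈ p.compl
  have hts : ∀ m ∈ t, m ∈ Fan.S σ := fun m hm => by
    change m ∈ dualMonoid σ.1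
    rw [← ht]
    exact AddSubmonoid.subset_closure hm
  have hface : ∀ a b : Multiplicative (Fan.S σ), a * b ∈ p.compl → a ∈ p.compl ∧ b ∈ p.compl :=
    fun a b hab => ⟨fun ha => hab (mul_comm b a ▸ p.mul_mem b a ha), fun hb => hab (p.mul_mem a b hb)⟩
  have hsum : ∃ h : ∑ m ∈ s, m ∈ Fan.S σ, Multiplicative.ofAdd ⟨∑ m ∈ s, m, h⟩ ∈ p.compl := by
    refine Finset.sum_induction (fun m => m)
      (fun m => ∃ h : m ∈ Fan.S σ, Multiplicative.ofAdd ⟨m, h⟩ ∈ p.compl) ?_ ?_ ?_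
    · rintro a b ⟨ha, ha'⟩ ⟨hb, hb'⟩
      exact ⟨add_mem ha hb, mul_mem ha' hb'⟩
    · exact ⟨AddSubmonoid.zero_mem _, one_mem p.compl⟩
    · intro m hm
      exact (Finset.mem_filter.1 hm).2
  obtain ⟨hm₀, hm₀'⟩ := hsum
  set m₀ := ∑ m ∈ s, m
  obtain ⟨τ, hτ, e⟩ := Fan.exists_face σ hm₀
  refine ⟨τ, hτ, ?_⟩
  ext a
  rw [← not_iff_not, Fan.notMem_prime]
  constructor
  · intro ha u hu
    have hu' := (e u).1 hu
    have hs0 : ∀ m ∈ s, u m = 0 := by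
      have h0 : ∑ m ∈ s, u m = 0 := by rw [← map_sum]; exact hu'.2
      exact (Finset.sum_eq_zero_iff_of_nonneg fun m hm =>
        hts m (Finset.mem_filter.1 hm).1 u hu'.1).1 h0
    have key : ∀ b ∈ AddSubmonoid.closure (t : Set M), ∀ hb : b ∈ Fan.S σ,
        Multiplicative.ofAdd ⟨b, hb⟩ ∈ p.compl → u b = 0 := by
      intro b hb
      induction hb using AddSubmonoid.closure_induction with
      | mem x hx => exact fun hb hp => hs0 x (Finset.mem_filter.2 ⟨hx, hb, hp⟩)
      | zero => exact fun _ _ => map_zero u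
      | add x y hx hy ihx ihy =>
        intro hb hp
        rw [ht] at hx hy
        obtain ⟨h₁, h₂⟩ := hface (.ofAdd ⟨x, hx⟩) (.ofAdd ⟨y, hy⟩) hp
        rw [map_add, ihx hx h₁, ihy hy h₂, add_zero]
    exact key _ (by rw [ht]; exact a.toAdd.2) a.toAdd.2 ha
  · intro ha
    have hneg : -(a.toAdd : M) ∈ dualMonoid τ.1 := fun u hu => by
      rw [map_neg, ha u hu, neg_zero]
    obtain ⟨n, hn⟩ := exists_add_nsmul_mem (Δ.rational _ σ.2) hm₀ e hneg
    have hmem : a * Multiplicative.ofAdd ⟨_, hn⟩ ∈ p.compl := by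
      have : a * Multiplicative.ofAdd ⟨_, hn⟩ =
          (Multiplicative.ofAdd (⟨m₀, hm₀⟩ : Fan.S σ)) ^ n := by
        refine Multiplicative.toAdd.injective (Subtype.ext ?_)
        change (a.toAdd : M) + (-(a.toAdd : M) + n • m₀) = n • m₀
        abel
      rw [this]
      exact pow_mem hm₀' n
    exact (hface _ _ hmem).1

/-- The face of `σ` that corresponds to a prime ideal of `S_σ`. -/
noncomputable def Fan.primeFace [Module.Finite ℤ M] {σ : Δ.Cone}
    (p : PrimeIdeal (Multiplicative (Fan.S σ))) : Δ.Cone :=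
  (Fan.exists_eq_prime p).choose

theorem Fan.primeFace_le [Module.Finite ℤ M] {σ : Δ.Cone}
    (p : PrimeIdeal (Multiplicative (Fan.S σ))) : Fan.primeFace p ≤ σ :=
  (Fan.exists_eq_prime p).choose_spec.choose

theorem Fan.prime_primeFace [Module.Finite ℤ M] {σ : Δ.Cone}
    (p : PrimeIdeal (Multiplicative (Fan.S σ))) : Fan.prime (Fan.primeFace_le p) = p :=
  (Fan.exists_eq_prime p).choose_spec.choose_spec.symm

theorem Fan.primeFace_prime [Module.Finite ℤ M] {τ σ : Δ.Cone} (h : τ ≤ σ) :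
    Fan.primeFace (Fan.prime h) = τ := by
  have e := Fan.prime_primeFace (Fan.prime h)
  exact le_antisymm (Fan.le_of_prime_le (Fan.primeFace_le _) h (by rw [e]))
    (Fan.le_of_prime_le h (Fan.primeFace_le (Fan.prime h)) (by rw [e]))

theorem Fan.notMem_iff [Module.Finite ℤ M] {σ : Δ.Cone}
    (p : PrimeIdeal (Multiplicative (Fan.S σ))) {m : Multiplicative (Fan.S σ)} :
    m ∉ p.carrier ↔ ∀ u ∈ (Fan.primeFace p).1, u (m.toAdd : M) = 0 := by
  rw [← Fan.notMem_prime (Fan.primeFace_le p), Fan.prime_primeFace]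

/-- If `τ` is a face of `σ`, then `S_τ` is the localization of `S_σ` at `τ^⊥`. -/
theorem Fan.exists_mul_inclS {τ σ : Δ.Cone} (h : τ ≤ σ) (w : Multiplicative (Fan.S τ)) :
    ∃ (m : Multiplicative (Fan.S σ)) (b : Multiplicative (Fan.S σ)),
      b ∉ (Fan.prime h).carrier ∧ w * Fan.inclS h b = Fan.inclS h m := by
  obtain ⟨b, hb, e⟩ := Fan.exists_notMem_prime h
  obtain ⟨n, hn⟩ := exists_add_nsmul_mem (Δ.rational _ σ.2) b.toAdd.2 e w.toAdd.2
  exact ⟨.ofAdd ⟨_, hn⟩, b ^ n, pow_mem (S := (Fan.prime h).compl) hb n, rfl⟩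

theorem Fan.isUnit_inclS {τ σ : Δ.Cone} (h : τ ≤ σ) {b : Multiplicative (Fan.S σ)} :
    IsUnit (Fan.inclS h b) ↔ b ∉ (Fan.prime h).carrier := by
  rw [Fan.notMem_prime]
  constructor
  · intro hb u hu
    obtain ⟨c, hc⟩ := hb.exists_right_inv
    have e : u (b.toAdd : M) + u (c.toAdd : M) = 0 := by
      rw [← map_add]
      have : ((b.toAdd : M) + (c.toAdd : M)) = 0 :=
        congrArg (fun x : Multiplicative (Fan.S τ) => (x.toAdd : M)) hc
      rw [this, map_zero]
    have h₁ := b.toAdd.2 u (h hu)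
    have h₂ := c.toAdd.2 u hu
    linarith
  · intro hb
    have hneg : -(b.toAdd : M) ∈ Fan.S τ := fun u hu => by rw [map_neg, hb u hu, neg_zero]
    refine IsUnit.of_mul_eq_one (.ofAdd ⟨_, hneg⟩) ?_
    exact Multiplicative.toAdd.injective (Subtype.ext (add_neg_cancel (b.toAdd : M)))

theorem Fan.resS_surjective {τ σ : Δ.Cone} (h : τ ≤ σ) (a : Fan.SharpS τ) :
    ∃ m, Associates.mk (Fan.inclS h m) = a := by
  obtain ⟨w, rfl⟩ := Associates.mk_surjective a
  obtain ⟨m, b, hb, e⟩ := Fan.exists_mul_inclS h w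
  refine ⟨m, ?_⟩
  rw [← e, Associates.mk_eq_mk_iff_associated]
  exact associated_mul_unit_left _ _ ((Fan.isUnit_inclS h).2 hb)

theorem Fan.mk_inclS_eq_iff {τ σ : Δ.Cone} (h : τ ≤ σ) {a b : Multiplicative (Fan.S σ)} :
    Associates.mk (Fan.inclS h a) = Associates.mk (Fan.inclS h b) ↔
      toStalk (Fan.prime h) a = toStalk (Fan.prime h) b := by
  rw [toStalk_eq_iff, Associates.mk_eq_mk_iff_associated]
  constructor
  · rintro ⟨w, hw⟩
    obtain ⟨m, c, hc, e⟩ := Fan.exists_mul_inclS h (w : Multiplicative (Fan.S τ))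
    refine ⟨m, (Fan.isUnit_inclS h).1 ?_, c, hc, ?_⟩
    · rw [← e]
      exact w.isUnit.mul ((Fan.isUnit_inclS h).2 hc)
    · have hinj : Function.Injective (Fan.inclS h) := fun x y hxy =>
        Multiplicative.toAdd.injective (Subtype.ext
          (congrArg (fun z : Multiplicative (Fan.S τ) => (z.toAdd : M)) hxy))
      refine hinj ?_
      rw [map_mul, map_mul, ← e, ← hw, mul_comm, mul_comm _ (Fan.inclS h a * _), mul_assoc]
  · rintro ⟨c, hc, d, hd, e⟩
    have e' := congrArg (Fan.inclS h) e
    rw [map_mul, map_mul] at e'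
    refine (associated_unit_mul_left (Fan.inclS h a) _ ((Fan.isUnit_inclS h).2 hc)).symm.trans ?_
    rw [e']
    exact associated_unit_mul_left _ _ ((Fan.isUnit_inclS h).2 hd)

theorem exists_mulEquiv_of_surjective {A B C : Type*} [CommMonoid A] [CommMonoid B] [CommMonoid C]
    {f : A →* B} {g : A →* C} (hf : Function.Surjective f) (hg : Function.Surjective g)
    (h : ∀ a b, f a = f b ↔ g a = g b) : ∃ e : B ≃* C, ∀ a, e (f a) = g a := by
  choose r hr using hf
  have hr' : ∀ a, g (r (f a)) = g a := fun a => (h _ _).1 (hr _)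
  let l : B →* C :=
    { toFun := fun b => g (r b)
      map_one' := by rw [← map_one f, hr', map_one]
      map_mul' := fun b b' => by
        rw [← map_mul]
        exact (h _ _).1 (by rw [hr, map_mul, hr, hr]) }
  refine ⟨MulEquiv.ofBijective l ⟨fun b b' e => ?_, fun c => ?_⟩, hr'⟩
  · rw [← hr b, ← hr b']
    exact (h _ _).2 e
  · obtain ⟨a, rfl⟩ := hg c
    exact ⟨f a, hr' a⟩

theorem Fan.exists_stalkEquiv [Module.Finite ℤ M] {σ : Δ.Cone}
    (p : PrimeIdeal (Multiplicative (Fan.S σ))) :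
    ∃ e : Fan.SharpS (Fan.primeFace p) ≃* (MSpec (Multiplicative (Fan.S σ))).stalk p,
      ∀ m, e (Associates.mk (Fan.inclS (Fan.primeFace_le p) m)) = toStalk p m :=
  exists_mulEquiv_of_surjective
    (f := Associates.mkMonoidHom.comp (Fan.inclS (Fan.primeFace_le p)))
    (fun a => Fan.resS_surjective _ a) (toStalk_surjective p) fun a b =>
      (Fan.mk_inclS_eq_iff (Fan.primeFace_le p)).trans (by rw [Fan.prime_primeFace])

/-- The isomorphism between `S_τ / S_τ^*` and the stalk of `Spec S_σ` at the prime ideal of a face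
`τ` of `σ`. -/
noncomputable def Fan.stalkEquiv [Module.Finite ℤ M] {σ : Δ.Cone}
    (p : PrimeIdeal (Multiplicative (Fan.S σ))) :
    Fan.SharpS (Fan.primeFace p) ≃* (MSpec (Multiplicative (Fan.S σ))).stalk p :=
  (Fan.exists_stalkEquiv p).choose

theorem Fan.stalkEquiv_mk [Module.Finite ℤ M] {σ : Δ.Cone}
    (p : PrimeIdeal (Multiplicative (Fan.S σ))) (m : Multiplicative (Fan.S σ)) :
    Fan.stalkEquiv p (Associates.mk (Fan.inclS (Fan.primeFace_le p) m)) = toStalk p m :=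
  (Fan.exists_stalkEquiv p).choose_spec m

theorem Fan.primeFace_mono [Module.Finite ℤ M] {σ : Δ.Cone}
    {p q : PrimeIdeal (Multiplicative (Fan.S σ))} :
    Fan.primeFace p ≤ Fan.primeFace q ↔ p.carrier ⊆ q.carrier := by
  constructor
  · intro h a ha
    by_contra hq
    exact (Fan.notMem_iff p).2 (fun u hu => (Fan.notMem_iff q).1 hq u (h hu)) ha
  · intro h
    refine Fan.le_of_prime_le (Fan.primeFace_le p) (Fan.primeFace_le q) ?_
    rwa [Fan.prime_primeFace, Fan.prime_primeFace]

theorem Fan.primeFace_injective [Module.Finite ℤ M] {σ : Δ.Cone} :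
    Function.Injective (Fan.primeFace (Δ := Δ) (σ := σ)) := fun p q h => by
  ext a
  exact ⟨fun ha => Fan.primeFace_mono.1 h.le ha, fun ha => Fan.primeFace_mono.1 h.ge ha⟩

theorem Fan.continuous_primeFace [Module.Finite ℤ M] {σ : Δ.Cone} :
    Continuous (Fan.primeFace (Δ := Δ) (σ := σ)) := by
  refine continuous_def.2 fun U hU => isOpen_iff_forall_mem_open.2 fun p hp => ?_
  obtain ⟨m, hm, e⟩ := Fan.exists_notMem_prime (Fan.primeFace_le p)
  refine ⟨PrimeIdeal.basicOpen m, fun q hq => hU (fun u hu => ?_) hp,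
    PrimeIdeal.isOpen_basicOpen m, ?_⟩
  · exact (e u).2 ⟨Fan.primeFace_le q hu, (Fan.notMem_iff q).1 hq u hu⟩
  · rw [Fan.prime_primeFace] at hm
    exact hm

theorem Fan.isOpenEmbedding_primeFace [Module.Finite ℤ M] {σ : Δ.Cone} :
    Topology.IsOpenEmbedding (Fan.primeFace (Δ := Δ) (σ := σ)) := by
  refine .of_continuous_injective_isOpenMap Fan.continuous_primeFace Fan.primeFace_injective
    fun U hU τ' τ hτ => ?_
  rintro ⟨p, hp, rfl⟩
  refine ⟨Fan.prime (hτ.trans (Fan.primeFace_le p)), ?_, Fan.primeFace_prime _⟩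
  refine (PrimeIdeal.specializes_iff.2 ?_ : _ ⤳ p).mem_open hU hp
  rw [← Fan.primeFace_mono, Fan.primeFace_prime]
  exact hτ

/-- The open immersion of `Spec S_σ` into the Kato fan of `Δ`, with image the set of faces
of `σ`. -/
noncomputable def Fan.chart [Module.Finite ℤ M] (σ : Δ.Cone) :
    MonoidalSpace.Hom (MSpec (Multiplicative (Fan.S σ))) (Fan.katoFan Δ) where
  base := ⟨Fan.primeFace, Fan.continuous_primeFace⟩
  stalkMap p := (Fan.stalkEquiv p).toMonoidHom
  isLocal p a h := (MulEquiv.isUnit_map (Fan.stalkEquiv p)).1 h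
  map_section V s hs := by
    refine MonoidSheaf.glue _ _ _ fun p => ?_
    obtain ⟨m, hm⟩ := Fan.resS_surjective (Fan.primeFace_le p.1) (s ⟨Fan.primeFace p.1, p.2⟩)
    refine ⟨⟨Fan.primeFace ⁻¹' Set.Iic (Fan.primeFace p.1),
      (Fan.below (Fan.primeFace p.1)).2.preimage Fan.continuous_primeFace⟩,
      fun q hq => V.2 hq p.2, le_refl (Fan.primeFace p.1), ?_⟩
    convert isSection_toStalk _ m with q
    refine Eq.trans ?_ (Fan.stalkEquiv_mk q.1 m)
    refine congrArg (Fan.stalkEquiv q.1) ?_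
    refine (hs _ _ q.2 p.2 (V.2 q.2 p.2)).symm.trans ?_
    rw [← hm]
    rfl

theorem Fan.chart_stalkMap [Module.Finite ℤ M] (σ : Δ.Cone)
    (p : PrimeIdeal (Multiplicative (Fan.S σ))) (m : Multiplicative (Fan.S σ)) :
    (Fan.chart σ).stalkMap p (Associates.mk (Fan.inclS (Fan.primeFace_le p) m)) = toStalk p m :=
  Fan.stalkEquiv_mk p m

theorem Fan.isOpenImmersion_chart [Module.Finite ℤ M] (σ : Δ.Cone) :
    (Fan.chart σ).IsOpenImmersion :=
  ⟨Fan.isOpenEmbedding_primeFace, fun p => (Fan.stalkEquiv p).bijective⟩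

theorem Fan.range_chart [Module.Finite ℤ M] (σ : Δ.Cone) :
    Set.range (Fan.chart σ).base = Set.Iic σ :=
  Set.Subset.antisymm (by rintro _ ⟨p, rfl⟩; exact Fan.primeFace_le p) fun _ h =>
    ⟨Fan.prime h, Fan.primeFace_prime h⟩

/-- The charts of the Kato fan are compatible with the inclusions of faces. -/
theorem Fan.map_chart [Module.Finite ℤ M] {τ σ : Δ.Cone} (h : τ ≤ σ) :
    (MSpec.map (Fan.inclS h)).comp (Fan.chart σ) = Fan.chart τ := by
  have hb : ∀ p : PrimeIdeal (Multiplicative (Fan.S τ)),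
      Fan.primeFace (PrimeIdeal.comap (Fan.inclS h) p) = Fan.primeFace p := by
    intro p
    have : PrimeIdeal.comap (Fan.inclS h) p = Fan.prime ((Fan.primeFace_le p).trans h) := by
      ext m
      rw [← not_iff_not, Fan.notMem_prime]
      exact Fan.notMem_iff p
    rw [this, Fan.primeFace_prime]
  refine MonoidalSpace.Hom.ext_of_section hb fun V s hs p h₁ h₂ => ?_
  obtain ⟨m, hm⟩ := Fan.resS_surjective ((Fan.primeFace_le p).trans h) (s ⟨Fan.primeFace p, h₂⟩)
  have e₂ : (Fan.chart τ).stalkMap p (s ⟨Fan.primeFace p, h₂⟩) = toStalk p (Fan.inclS h m) := by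
    rw [← hm]
    exact Fan.chart_stalkMap τ p (Fan.inclS h m)
  refine Eq.trans ?_ e₂.symm
  refine Eq.trans ?_ (map_toStalk (Fan.inclS h) p m)
  refine congrArg ((MSpec.map (Fan.inclS h)).stalkMap p) ?_
  have e₁ : ∀ ρ (hρ : ρ = Fan.primeFace p) (hρσ : ρ ≤ σ) (hV : ρ ∈ V),
      s ⟨ρ, hV⟩ = Associates.mk (Fan.inclS hρσ m) := by
    rintro _ rfl _ _
    exact hm.symm
  refine Eq.trans (congrArg _ (e₁ _ (hb p) (Fan.primeFace_le _) h₁)) ?_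
  exact Fan.chart_stalkMap σ _ m

theorem Fan.isFineSaturated_S [Module.Finite ℤ M] (σ : Δ.Cone) :
    IsFineSaturated (Multiplicative (Fan.S σ)) where
  fg := by
    have : AddMonoid.FG (Fan.S σ) :=
      (AddMonoid.fg_iff_addSubmonoid_fg _).2 (Δ.rational _ σ.2).dualMonoid_fg
    infer_instance
  integral a b c h := mul_left_cancel (G := Multiplicative (Fan.S σ)) h
  saturated a b n hn := by
    rintro ⟨c, hc⟩
    have hc' : n • (a.toAdd : M) = n • (b.toAdd : M) + (c.toAdd : M) :=
      congrArg (fun x : Multiplicative (Fan.S σ) => (x.toAdd : M)) hc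
    refine ⟨.ofAdd ⟨(a.toAdd : M) - b.toAdd, fun u hu => ?_⟩, ?_⟩
    · have e := congrArg u hc'
      rw [map_nsmul, map_add, map_nsmul, nsmul_eq_mul, nsmul_eq_mul] at e
      have h₁ := c.toAdd.2 u hu
      have hn' : (0 : ℝ) < n := by exact_mod_cast hn
      rw [map_sub]
      by_contra! hlt
      have := mul_neg_of_pos_of_neg hn' hlt
      linarith
    · exact Multiplicative.toAdd.injective (Subtype.ext (add_sub_cancel _ _).symm)

theorem Fan.exists_chart [Module.Finite ℤ M] (σ : Δ.Cone) : σ ∈ Set.range (Fan.chart σ).base := by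
  rw [Fan.range_chart]
  exact le_refl σ

variable (Δ) in
theorem Fan.isFsKatoFan_katoFan [Module.Finite ℤ M] : IsFsKatoFan (Fan.katoFan Δ) where
  compact := by
    have : Finite Δ.Cone := Δ.finite
    exact Finite.compactSpace
  cover σ := ⟨_, inferInstance, Fan.chart σ, Fan.isFineSaturated_S σ, Fan.isOpenImmersion_chart σ,
    Fan.exists_chart σ⟩

/-- Every open affine of the Kato fan is the set of faces of the image of its closed point. -/
theorem Fan.range_eq_Iic {P : Type v} [CommMonoid P]
    {i : MonoidalSpace.Hom (MSpec P) (Fan.katoFan Δ)} (hi : i.IsOpenImmersion) :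
    Set.range i.base = Set.Iic (i.base (PrimeIdeal.closedPoint P)) := by
  refine Set.Subset.antisymm ?_ fun τ hτ => hi.isOpenEmbedding.isOpen_range hτ ⟨_, rfl⟩
  rintro _ ⟨p, rfl⟩
  exact ((PrimeIdeal.specializes_closedPoint p).map i.base.continuous).mem_open
    (Fan.below (i.base (PrimeIdeal.closedPoint P))).2 (le_refl (i.base (PrimeIdeal.closedPoint P)))

end KatoFan

/-! ### Factorization of regular functions with divisor on the toric boundary -/

section Algebra

theorem uniqueSums_of_free (M : Type u) [AddCommGroup M] [Module.Free ℤ M] : UniqueSums M :=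
  UniqueSums.of_injective_addHom (Module.Free.chooseBasis ℤ M).repr.toAddMonoidHom.toAddHom
    (Module.Free.chooseBasis ℤ M).repr.injective inferInstance

theorem uniqueSums_submonoid {M : Type u} [AddCommGroup M] [Module.Free ℤ M]
    (S : AddSubmonoid M) : UniqueSums S :=
  UniqueSums.of_injective_addHom S.subtype.toAddHom Subtype.val_injective (uniqueSums_of_free M)

open AddMonoidAlgebra in
/-- For every weight `v`, some product of monomials of lowest weight of `f` and of `h` survives
in `f * h`. -/
theorem exists_minimal_mem_support_mul {k S : Type*} [Field k] [AddCommMonoid S] [UniqueSums S]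
    (v : S →+ ℤ) {f h : AddMonoidAlgebra k S} (hf : f ≠ 0) (hh : h ≠ 0) :
    ∃ a ∈ f.coeff.support, ∃ b ∈ h.coeff.support, (∀ c ∈ f.coeff.support, v a ≤ v c) ∧
      (∀ c ∈ h.coeff.support, v b ≤ v c) ∧ a + b ∈ (f * h).coeff.support := by
  classical
  have hf' : f.coeff.support.Nonempty := Finsupp.support_nonempty_iff.2 (coeff_eq_zero.not.2 hf)
  have hh' : h.coeff.support.Nonempty := Finsupp.support_nonempty_iff.2 (coeff_eq_zero.not.2 hh)
  obtain ⟨a₁, ha₁, hmin₁⟩ := f.coeff.support.exists_min_image v hf'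
  obtain ⟨b₁, hb₁, hmin₂⟩ := h.coeff.support.exists_min_image v hh'
  obtain ⟨a, ha, b, hb, hu⟩ := UniqueSums.uniqueAdd_of_nonempty
    (A := f.coeff.support.filter fun c => v c = v a₁)
    (B := h.coeff.support.filter fun c => v c = v b₁)
    ⟨a₁, Finset.mem_filter.2 ⟨ha₁, rfl⟩⟩ ⟨b₁, Finset.mem_filter.2 ⟨hb₁, rfl⟩⟩
  obtain ⟨ha, ea⟩ := Finset.mem_filter.1 ha
  obtain ⟨hb, eb⟩ := Finset.mem_filter.1 hb
  refine ⟨a, ha, b, hb, fun c hc => ea ▸ hmin₁ c hc, fun c hc => eb ▸ hmin₂ c hc, ?_⟩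
  have hU : UniqueAdd f.coeff.support h.coeff.support a b := by
    intro c d hc hd e
    have e' : v c + v d = v a + v b := by rw [← map_add, ← map_add, e]
    have h₁ := hmin₁ c hc
    have h₂ := hmin₂ d hd
    exact hu (Finset.mem_filter.2 ⟨hc, by omega⟩) (Finset.mem_filter.2 ⟨hd, by omega⟩) e
  rw [Finsupp.mem_support_iff, coeff_mul_add_of_uniqueAdd hU]
  exact mul_ne_zero (Finsupp.mem_support_iff.1 ha) (Finsupp.mem_support_iff.1 hb)

open AddMonoidAlgebra in
/-- Let `𝔭` be a prime of `k[S_σ]` that contains all characters that are not invertible. If `f`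
divides the product of a character and a function outside of `𝔭`, then it is itself such a product.
For each `v ∈ σ`, the weights of the terms of lowest weight of `f` and of its cofactor add up to a
linear function of `v`; since each of the two is concave in `v`, both are linear on `σ`, so a single
term of `f` has lowest weight for all `v`. -/
theorem exists_eq_single_mul_of_mul_eq {k : Type*} {M : Type u} [Field k] [AddCommGroup M]
    [Module.Free ℤ M] {σ : PointedCone ℝ (NR M)} (hσ : IsRationalCone σ)
    (p : Ideal (AddMonoidAlgebra k (dualMonoid σ))) [p.IsPrime]
    (hp : ∀ m : dualMonoid σ, single m 1 ∉ p → ∀ u ∈ σ, u (m : M) = 0)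
    {f h g : AddMonoidAlgebra k (dualMonoid σ)} {m : dualMonoid σ}
    (e : f * h = single m 1 * g) (hg : g ∉ p) :
    ∃ (m' : dualMonoid σ) (f' : AddMonoidAlgebra k (dualMonoid σ)),
      f = single m' 1 * f' ∧ f' ∉ p := by
  classical
  have := uniqueSums_submonoid (dualMonoid σ)
  obtain ⟨s, hs, hdual, -⟩ := hσ.exists_generators
  have hsingle : ∀ (a b : dualMonoid σ) (x : k),
      (single (a + b) x : AddMonoidAlgebra k (dualMonoid σ)) = single a 1 * single b x := by
    intro a b x
    rw [single_mul_single, one_mul]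
  have hne : ∀ a : dualMonoid σ, (single a 1 : AddMonoidAlgebra k (dualMonoid σ)) ≠ 0 :=
    fun a => by simp
  have hdvd : ∀ (x : AddMonoidAlgebra k (dualMonoid σ)) (y : AddMonoidAlgebra k (dualMonoid σ)),
      (∀ a ∈ x.coeff.support, y ∣ single a (x.coeff a)) → y ∣ x := by
    intro x y hxy
    rw [← sum_coeff_single x]
    exact Finset.dvd_sum hxy
  have hg0 : g ≠ 0 := fun h => hg (h ▸ zero_mem _)
  obtain ⟨m₀, hm₀, hm₀'⟩ : ∃ m₀ ∈ g.coeff.support, ∀ u ∈ σ, u (m₀ : M) = 0 := by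
    by_contra! hc
    refine hg ?_
    rw [← sum_coeff_single g]
    refine sum_mem fun a ha => ?_
    obtain ⟨u, hu, hne⟩ := hc a ha
    have ha' : single a 1 ∈ p := by
      by_contra h
      exact hne (hp a h u hu)
    have := p.mul_mem_left (single 0 (g.coeff a)) ha'
    rwa [single_mul_single, zero_add, mul_one] at this
  have hfh : f * h ≠ 0 := by rw [e]; exact mul_ne_zero (hne m) hg0
  have hf0 : f ≠ 0 := fun h => hfh (by rw [h, zero_mul])
  have hh0 : h ≠ 0 := fun h => hfh (by rw [h, mul_zero])
  -- the term `χ^(m + m₀)` of `f * h` has lowest weight for every weight in `σ`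
  have hsupp : (f * h).coeff.support = g.coeff.support.image (m + ·) := by
    rw [e]
    exact support_coeff_single_mul_eq_image g (fun y => by rw [one_mul]) (add_right_injective m)
  have key : ∀ v : M →+ ℤ, (∀ a ∈ dualMonoid σ, 0 ≤ v a) → v m₀ = 0 →
      ∃ a ∈ f.coeff.support, ∃ b ∈ h.coeff.support, (∀ c ∈ f.coeff.support, v a ≤ v c) ∧
        (∀ c ∈ h.coeff.support, v b ≤ v c) ∧ v a + v b = v m := by
    intro v hv hv0
    obtain ⟨a, ha, b, hb, ha', hb', hab⟩ :=
      exists_minimal_mem_support_mul (v.comp (dualMonoid σ).subtype) hf0 hh0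
    refine ⟨a, ha, b, hb, ha', hb', le_antisymm ?_ ?_⟩
    · have hm : m + m₀ ∈ (f * h).coeff.support := by
        rw [hsupp]
        exact Finset.mem_image_of_mem _ hm₀
      obtain ⟨c, hc, d, hd, hcd⟩ := Finset.mem_add.1 (support_coeff_mul_subset f h hm)
      have h₁ : v a ≤ v c := ha' c hc
      have h₂ : v b ≤ v d := hb' d hd
      have h₃ : v c + v d = v m + v m₀ := by
        rw [← map_add, ← map_add]
        exact congrArg (fun z : dualMonoid σ => v z) hcd
      omega
    · rw [hsupp] at hab
      obtain ⟨c, hc, hcd⟩ := Finset.mem_image.1 hab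
      have h₁ : v m + v c = v a + v b := by
        rw [← map_add, ← map_add]
        exact congrArg (fun z : dualMonoid σ => v z) hcd
      have h₂ := hv c c.2
      omega
  have hs0 : ∀ v ∈ s, v (m₀ : M) = 0 := fun v hv => by
    have : ((v m₀ : ℤ) : ℝ) = 0 := hm₀' _ (hs v hv)
    exact_mod_cast this
  have hs1 : ∀ v ∈ s, ∀ a ∈ dualMonoid σ, 0 ≤ v a := fun v hv a ha => (hdual a).1 ha v hv
  obtain ⟨a, ha, b, hb, -, -, hab⟩ := key (∑ v ∈ s, v)
    (fun a ha => by
      rw [AddMonoidHom.finsetSum_apply]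
      exact Finset.sum_nonneg fun v hv => hs1 v hv a ha)
    (by
      rw [AddMonoidHom.finsetSum_apply]
      exact Finset.sum_eq_zero hs0)
  rw [AddMonoidHom.finsetSum_apply, AddMonoidHom.finsetSum_apply, AddMonoidHom.finsetSum_apply,
    ← Finset.sum_add_distrib] at hab
  have hle : ∀ v ∈ s, v (m : M) ≤ v a + v b := fun v hv => by
    obtain ⟨c, -, d, -, hc, hd, hcd⟩ := key v (hs1 v hv) (hs0 v hv)
    have := hc a ha
    have := hd b hb
    omega
  have heq := (Finset.sum_eq_sum_iff_of_le hle).1 hab.symm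
  have hmin : ∀ v ∈ s, (∀ c ∈ f.coeff.support, v a ≤ v c) ∧ ∀ c ∈ h.coeff.support, v b ≤ v c := by
    intro v hv
    obtain ⟨c, -, d, -, hc, hd, hcd⟩ := key v (hs1 v hv) (hs0 v hv)
    have h₁ := hc a ha
    have h₂ := hd b hb
    have h₃ := heq v hv
    refine ⟨fun x hx => ?_, fun x hx => ?_⟩
    · have := hc x hx
      omega
    · have := hd x hx
      omega
  have hdiv : ∀ (x : AddMonoidAlgebra k (dualMonoid σ)) (a : dualMonoid σ),
      (∀ v ∈ s, ∀ c ∈ x.coeff.support, v a ≤ v c) → single a 1 ∣ x := by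
    intro x a hx
    refine hdvd x _ fun c hc => ?_
    have hmem : (c : M) - a ∈ dualMonoid σ := (hdual _).2 fun v hv => by
      rw [map_sub]
      exact sub_nonneg.2 (hx v hv c hc)
    refine ⟨single ⟨_, hmem⟩ (x.coeff c), ?_⟩
    rw [← hsingle]
    congr 1
    exact Subtype.ext (add_sub_cancel _ _).symm
  obtain ⟨f', hf'⟩ := hdiv f a fun v hv => (hmin v hv).1
  obtain ⟨h', hh'⟩ := hdiv h b fun v hv => (hmin v hv).2
  refine ⟨a, f', hf', fun hmem => hg ?_⟩
  -- `g` differs from the product of the cofactors by an invertible character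
  have hd : (a : M) + b - m ∈ dualMonoid σ := (hdual _).2 fun v hv => by
    rw [map_sub, map_add, heq v hv, sub_self]
  have : single m 1 * g = single m 1 * (single ⟨_, hd⟩ 1 * (f' * h')) := by
    rw [← e, hf', hh', ← mul_assoc (single m 1), ← hsingle]
    have : m + ⟨_, hd⟩ = a + b := Subtype.ext (add_sub_cancel _ _)
    rw [this, hsingle]
    ring
  rw [mul_left_cancel₀ (hne m) this]
  exact p.mul_mem_left _ (p.mul_mem_right _ hmem)

end Algebra

/-! ### Local rings of a toric variety -/

section Local

variable {k : Type u} [Field k] {M : Type u} [AddCommGroup M] {Δ : Fan M}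

theorem toricOpen_inter {σ τ : Δ.Cone} {x : toricVariety k Δ} (h : x ∈ toricOpen k Δ σ)
    (h' : x ∈ toricOpen k Δ τ) : x ∈ toricOpen k Δ (Fan.inter σ τ) := by
  obtain ⟨y, hy⟩ := h
  obtain ⟨z, hz⟩ := h'
  obtain ⟨ρ, f, g, w, hw, -⟩ :=
    (Scheme.IsLocallyDirected.ι_eq_ι_iff (toricDiagram k Δ)).1 (hy.trans hz.symm)
  refine toricOpen_mono (Fan.le_inter f.le g.le) ⟨w, ?_⟩
  rw [← hy, ← hw]
  exact congrArg (fun q : _ ⟶ toricVariety k Δ => q w) (map_toricChart f.le).symm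

theorem exists_least_cone (x : toricVariety k Δ) :
    ∃ σ : Δ.Cone, x ∈ toricOpen k Δ σ ∧ ∀ τ, x ∈ toricOpen k Δ τ → σ ≤ τ := by
  have : Finite Δ.Cone := Δ.finite
  obtain ⟨σ, hσ⟩ := exists_minimal_of_wellFoundedLT (fun σ : Δ.Cone => x ∈ toricOpen k Δ σ)
    (exists_mem_toricOpen k Δ x)
  exact ⟨σ, hσ.1, fun τ hτ => (hσ.2 (toricOpen_inter hσ.1 hτ) (Fan.inter_le_left σ τ)).trans
    (Fan.inter_le_right σ τ)⟩

/-- The cone whose torus orbit contains `x`: the smallest `σ` with `x ∈ U_σ`. -/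
noncomputable def orbitCone (x : toricVariety k Δ) : Δ.Cone := (exists_least_cone x).choose

theorem mem_orbitCone (x : toricVariety k Δ) : x ∈ toricOpen k Δ (orbitCone x) :=
  (exists_least_cone x).choose_spec.1

theorem orbitCone_le_iff {x : toricVariety k Δ} {σ : Δ.Cone} :
    orbitCone x ≤ σ ↔ x ∈ toricOpen k Δ σ :=
  ⟨fun h => toricOpen_mono h (mem_orbitCone x), (exists_least_cone x).choose_spec.2 σ⟩

/-- The germ at `x ∈ U_σ` of an element of `k[S_σ]`. -/
noncomputable def toricGerm {σ : Δ.Cone} {x : toricVariety k Δ} (hx : x ∈ toricOpen k Δ σ) :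
    AddMonoidAlgebra k (Fan.S σ) →+* (toricVariety k Δ).presheaf.stalk x :=
  ((toricVariety k Δ).presheaf.germ (toricOpen k Δ σ) x hx).hom.comp (toricFunction k Δ σ)

theorem toricGerm_single {σ : Δ.Cone} {x : toricVariety k Δ} (hx : x ∈ toricOpen k Δ σ)
    (m : Fan.S σ) : toricGerm hx (AddMonoidAlgebra.single m 1) =
      (toricVariety k Δ).presheaf.germ (toricOpen k Δ σ) x hx (character k Δ σ m) := rfl

theorem stalkSpecializes_toricGerm {σ : Δ.Cone} {x y : toricVariety k Δ} (h : x ⤳ y)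
    (hy : y ∈ toricOpen k Δ σ) (hx : x ∈ toricOpen k Δ σ) (a : AddMonoidAlgebra k (Fan.S σ)) :
    (toricVariety k Δ).presheaf.stalkSpecializes h (toricGerm hy a) = toricGerm hx a :=
  congrArg (fun q => q.hom (toricFunction k Δ σ a))
    ((toricVariety k Δ).presheaf.germ_stalkSpecializes hy h)

theorem appLE_toricFunction (σ : Δ.Cone) (a : AddMonoidAlgebra k (Fan.S σ)) :
    (toricChart k Δ σ).appLE (toricOpen k Δ σ) ⊤ (le_preimage_toricOpen σ)
      (toricFunction k Δ σ a) =
      (Scheme.ΓSpecIso (.of (AddMonoidAlgebra k (Fan.S σ)))).inv a := by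
  rw [toricFunction]
  exact congrArg (fun g => g.hom ((Scheme.ΓSpecIso (.of (AddMonoidAlgebra k (Fan.S σ)))).inv a))
    (ΓIsoTop_hom_appLE (toricChart k Δ σ) (le_preimage_toricOpen σ))

/-- The prime ideal of `k[S_σ]` that corresponds to a point of `U_σ`. -/
noncomputable def toricPrime {σ : Δ.Cone} {x : toricVariety k Δ} (hx : x ∈ toricOpen k Δ σ) :
    PrimeSpectrum (AddMonoidAlgebra k (Fan.S σ)) := hx.choose

theorem toricChart_toricPrime {σ : Δ.Cone} {x : toricVariety k Δ} (hx : x ∈ toricOpen k Δ σ) :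
    toricChart k Δ σ (toricPrime hx) = x := hx.choose_spec

theorem isUnit_toricGerm {σ : Δ.Cone} {x : toricVariety k Δ} (hx : x ∈ toricOpen k Δ σ)
    (a : AddMonoidAlgebra k (Fan.S σ)) :
    IsUnit (toricGerm hx a) ↔ a ∉ (toricPrime hx).asIdeal := by
  refine ((toricVariety k Δ).mem_basicOpen (toricFunction k Δ σ a) _ hx).symm.trans ?_
  have e : (toricChart k Δ σ) ⁻¹ᵁ ((toricVariety k Δ).basicOpen (toricFunction k Δ σ a)) =
      (Spec (.of (AddMonoidAlgebra k (Fan.S σ)))).basicOpen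
        ((Scheme.ΓSpecIso (.of (AddMonoidAlgebra k (Fan.S σ)))).inv a) := by
    rw [← appLE_toricFunction, Scheme.Hom.appLE, Scheme.preimage_basicOpen]
    refine Eq.symm ?_
    refine ((Spec (.of (AddMonoidAlgebra k (Fan.S σ)))).basicOpen_res _ _).trans ?_
    exact inf_eq_right.2 le_top
  have e' := e.trans (basicOpen_eq_of_affine (R := .of (AddMonoidAlgebra k (Fan.S σ))) a)
  have h : toricPrime hx ∈ (toricChart k Δ σ) ⁻¹ᵁ
      ((toricVariety k Δ).basicOpen (toricFunction k Δ σ a)) ↔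
      toricPrime hx ∈ PrimeSpectrum.basicOpen a := by
    rw [e']
    exact Iff.rfl
  exact Iff.trans (Eq.to_iff (congrArg (· ∈ (toricVariety k Δ).basicOpen (toricFunction k Δ σ a))
    (toricChart_toricPrime hx).symm)) h

theorem toricFunction_bijective (σ : Δ.Cone) : Function.Bijective (toricFunction k Δ σ) :=
  ConcreteCategory.bijective_of_isIso ((Scheme.ΓSpecIso (.of (AddMonoidAlgebra k (Fan.S σ)))).inv ≫
    (IsOpenImmersion.ΓIsoTop (toricChart k Δ σ)).hom)

theorem exists_mul_toricGerm {σ : Δ.Cone} {x : toricVariety k Δ} (hx : x ∈ toricOpen k Δ σ)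
    (z : (toricVariety k Δ).presheaf.stalk x) :
    ∃ a s : AddMonoidAlgebra k (Fan.S σ), s ∉ (toricPrime hx).asIdeal ∧
      z * toricGerm hx s = toricGerm hx a := by
  have hU : IsAffineOpen (toricOpen k Δ σ) := isAffineOpen_opensRange _
  let := (toricVariety k Δ).presheaf.algebra_section_stalk ⟨x, hx⟩
  have := hU.isLocalization_stalk ⟨x, hx⟩
  obtain ⟨⟨a, s⟩, h⟩ := IsLocalization.surj (hU.primeIdealOf ⟨x, hx⟩).asIdeal.primeCompl
    (S := (toricVariety k Δ).presheaf.stalk x) z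
  have hs := IsLocalization.map_units ((toricVariety k Δ).presheaf.stalk x) s
  obtain ⟨a, rfl⟩ := (toricFunction_bijective σ).2 a
  obtain ⟨s', hs'⟩ := (toricFunction_bijective σ).2 s.1
  rw [← hs'] at hs
  simp only [← hs'] at h
  exact ⟨a, s', (isUnit_toricGerm hx s').1 hs, h⟩

theorem toricGerm_injective [Module.Free ℤ M] {σ : Δ.Cone} {x : toricVariety k Δ}
    (hx : x ∈ toricOpen k Δ σ) : Function.Injective (toricGerm hx) := by
  intro a b h
  have := uniqueSums_submonoid (Fan.S σ)
  have hU : IsAffineOpen (toricOpen k Δ σ) := isAffineOpen_opensRange _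
  let := (toricVariety k Δ).presheaf.algebra_section_stalk ⟨x, hx⟩
  have := hU.isLocalization_stalk ⟨x, hx⟩
  obtain ⟨s, hs⟩ := (IsLocalization.eq_iff_exists (hU.primeIdealOf ⟨x, hx⟩).asIdeal.primeCompl
    ((toricVariety k Δ).presheaf.stalk x)).1
    (show algebraMap _ _ (toricFunction k Δ σ a) = algebraMap _ _ (toricFunction k Δ σ b) from h)
  obtain ⟨s', hs'⟩ := (toricFunction_bijective σ).2 s.1
  rw [← hs', ← map_mul, ← map_mul] at hs
  have hs0 : s' ≠ 0 := by
    rintro rfl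
    rw [map_zero] at hs'
    exact s.2 (hs' ▸ zero_mem _)
  exact mul_left_cancel₀ hs0 ((toricFunction_bijective σ).1 hs)

theorem toricGerm_inclusion {τ σ : Δ.Cone} (h : τ ≤ σ) {x : toricVariety k Δ}
    (hx : x ∈ toricOpen k Δ τ) (m : Fan.S σ) :
    toricGerm hx (AddMonoidAlgebra.single (AddSubmonoid.inclusion (Fan.S_anti h) m) 1) =
      toricGerm (toricOpen_mono h hx) (AddMonoidAlgebra.single m 1) := by
  rw [toricGerm_single, toricGerm_single, ← character_res h]
  exact (toricVariety k Δ).presheaf.germ_res_apply (homOfLE (toricOpen_mono h)) x hx _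

theorem isUnit_single {S : Type*} [AddCommMonoid S] {m : S} (h : IsAddUnit m) :
    IsUnit (AddMonoidAlgebra.single m (1 : k)) := by
  obtain ⟨n, hn⟩ := h.exists_neg
  refine IsUnit.of_mul_eq_one (AddMonoidAlgebra.single n 1) ?_
  rw [AddMonoidAlgebra.single_mul_single, hn, one_mul]
  rfl

/-- The open subset `U_τ` of `U_σ`, for the face `τ = σ ∩ m^⊥`, is the locus where `χ^m` is
invertible. -/
theorem isUnit_toricGerm_single {τ σ : Δ.Cone} (h : τ ≤ σ) {m : Fan.S σ}
    (e : ∀ u, u ∈ τ.1 ↔ u ∈ σ.1 ∧ u (m : M) = 0) {x : toricVariety k Δ}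
    (hx : x ∈ toricOpen k Δ σ) :
    IsUnit (toricGerm hx (AddMonoidAlgebra.single m 1)) ↔ x ∈ toricOpen k Δ τ := by
  constructor
  · intro hu
    have hy := (isUnit_toricGerm hx _).1 hu
    have hr := range_toricDiagram_map k Δ (homOfLE h) m.2 e
    obtain ⟨z, hz⟩ : toricPrime hx ∈ Set.range ((toricDiagram k Δ).map (homOfLE h)) := by
      rw [hr]
      exact hy
    refine ⟨z, ?_⟩
    rw [← toricChart_toricPrime hx, ← hz]
    exact congrArg (fun q : _ ⟶ toricVariety k Δ => q z) (map_toricChart h).symm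
  · intro hx'
    rw [← toricGerm_inclusion h hx']
    refine (isUnit_single ?_).map _
    have hneg : -(m : M) ∈ Fan.S τ := fun u hu => by
      rw [map_neg, ((e u).1 hu).2, neg_zero]
    exact IsAddUnit.of_add_eq_zero ⟨_, hneg⟩ (Subtype.ext (add_neg_cancel (m : M)))

theorem eq_zero_of_isUnit_toricGerm_single {x : toricVariety k Δ} {m : Fan.S (orbitCone x)}
    (h : IsUnit (toricGerm (mem_orbitCone x) (AddMonoidAlgebra.single m 1))) :
    ∀ u ∈ (orbitCone x).1, u (m : M) = 0 := by
  obtain ⟨τ, hτ, e⟩ := Fan.exists_face (orbitCone x) m.2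
  have hle := orbitCone_le_iff.2 ((isUnit_toricGerm_single hτ e _).1 h)
  exact fun u hu => ((e u).1 (hle hu)).2

/-! ### The characteristic sheaf -/

theorem isUnit_iff_toStructure {X : Scheme.{u}} (L : LogStructure X) (x : X)
    (s : L.sheaf.stalk x) : IsUnit s ↔ IsUnit (L.toStructure x s) := by
  refine ⟨fun h => h.map _, fun h => ?_⟩
  obtain ⟨b, hb⟩ := h.exists_right_inv
  obtain ⟨t, ht, -⟩ := L.existsUnique_unit x b (IsUnit.of_mul_eq_one_right _ hb)
  refine IsUnit.of_mul_eq_one t ?_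
  refine (L.existsUnique_unit x 1 isUnit_one).unique ?_ (map_one _)
  rw [map_mul, ht, hb]

theorem inf_torus_le_basicOpen (σ : Δ.Cone) (m : Fan.S σ) :
    toricOpen k Δ σ ⊓ torus k Δ ≤ (toricVariety k Δ).basicOpen (character k Δ σ m) := by
  rintro x ⟨hx, hx'⟩
  refine ((toricVariety k Δ).mem_basicOpen _ x hx).2 ?_
  change IsUnit (toricGerm hx (AddMonoidAlgebra.single m 1))
  rw [← toricGerm_inclusion (Fan.zeroCone_le σ) hx']
  refine (isUnit_single ?_).map _
  exact IsAddUnit.of_add_eq_zero (⟨-(m : M), Fan.mem_S_zeroCone _⟩ : Fan.S Δ.zeroCone)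
    (Subtype.ext (add_neg_cancel (m : M)))

/-- The character `χ^m`, `m ∈ S_σ`, as a germ of the logarithmic structure at `x ∈ U_σ`. -/
noncomputable def logCharacter {σ : Δ.Cone} {x : toricVariety k Δ} (hx : x ∈ toricOpen k Δ σ) :
    Multiplicative (Fan.S σ) →* (toricLog k Δ).sheaf.stalk x where
  toFun m := (⟨toricGerm hx (AddMonoidAlgebra.single m.toAdd 1), toricOpen k Δ σ, hx,
    character k Δ σ m.toAdd, inf_torus_le_basicOpen σ _, rfl⟩ : divisorialStalk (torus k Δ) x)
  map_one' := Subtype.ext (map_one (toricGerm hx))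
  map_mul' m m' := Subtype.ext <| by
    change toricGerm hx (AddMonoidAlgebra.single (m.toAdd + m'.toAdd) 1) = toricGerm hx _ * toricGerm hx _
    rw [← map_mul, AddMonoidAlgebra.single_mul_single, one_mul]

theorem toStructure_logCharacter {σ : Δ.Cone} {x : toricVariety k Δ}
    (hx : x ∈ toricOpen k Δ σ) (m : Multiplicative (Fan.S σ)) :
    (toricLog k Δ).toStructure x (logCharacter hx m) =
      toricGerm hx (AddMonoidAlgebra.single m.toAdd 1) := rfl

theorem toStructure_injective (x : toricVariety k Δ) :
    Function.Injective ((toricLog k Δ).toStructure x) := Subtype.val_injective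

theorem logCharacter_inclS {τ σ : Δ.Cone} (h : τ ≤ σ) {x : toricVariety k Δ}
    (hx : x ∈ toricOpen k Δ τ) (m : Multiplicative (Fan.S σ)) :
    logCharacter hx (Fan.inclS h m) = logCharacter (toricOpen_mono h hx) m :=
  toStructure_injective x (toricGerm_inclusion h hx m.toAdd)

/-- Germs of the logarithmic structure are invertible at generizations in the big torus. -/
theorem isUnit_stalkSpecializes (x : toricVariety k Δ) (s : (toricLog k Δ).sheaf.stalk x)
    {t : toricVariety k Δ} (h : t ⤳ x) (ht : t ∈ torus k Δ) :
    IsUnit ((toricVariety k Δ).presheaf.stalkSpecializes h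
      ((toricLog k Δ).toStructure x s)) := by
  obtain ⟨U, hx, f, hf, e⟩ := s.2
  have htU : t ∈ U := h.mem_open U.2 hx
  have := ((toricVariety k Δ).mem_basicOpen f t htU).1 (hf ⟨htU, ht⟩)
  have e' : (toricVariety k Δ).presheaf.stalkSpecializes h
      ((toricVariety k Δ).presheaf.germ U x hx f) =
      (toricVariety k Δ).presheaf.germ U t htU f :=
    congrArg (fun q => q.hom f) ((toricVariety k Δ).presheaf.germ_stalkSpecializes hx h)
  rw [e] at e'
  exact e'.symm ▸ this

/-- Every germ of the logarithmic structure at `x` is a character times a unit. If `a` is a regular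
function near `x` that is invertible on the torus, then no prime below that of `x` contains `a` but
not the character `χ^m₀` defining the torus, so `a` divides a product `χ^(n m₀) g` with
`g(x) ≠ 0`. -/
theorem exists_logCharacter_mul [Module.Free ℤ M] (x : toricVariety k Δ)
    (s : (toricLog k Δ).sheaf.stalk x) :
    ∃ m, Associated (logCharacter (mem_orbitCone x) m) s := by
  have hx := mem_orbitCone x
  obtain ⟨a, d, hd, e⟩ := exists_mul_toricGerm hx ((toricLog k Δ).toStructure x s)
  obtain ⟨m₀, hm₀, em₀⟩ := Fan.isFace_of_le (Fan.zeroCone_le (orbitCone x))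
  let χ : AddMonoidAlgebra k (Fan.S (orbitCone x)) := AddMonoidAlgebra.single ⟨m₀, hm₀⟩ 1
  have hprime : ∀ q : Ideal (AddMonoidAlgebra k (Fan.S (orbitCone x))), q.IsPrime →
      q ≤ (toricPrime hx).asIdeal → χ ∉ q → a ∉ q := by
    intro q hq hqy hχ
    let z : PrimeSpectrum (AddMonoidAlgebra k (Fan.S (orbitCone x))) := ⟨q, hq⟩
    obtain ⟨t, ht⟩ : ∃ t, t = toricChart k Δ (orbitCone x) z := ⟨_, rfl⟩
    have htσ : t ∈ toricOpen k Δ (orbitCone x) := ⟨z, ht.symm⟩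
    have htz : toricPrime htσ = z :=
      (toricChart k Δ (orbitCone x)).isOpenEmbedding.injective
        ((toricChart_toricPrime htσ).trans ht)
    have hz : t ⤳ x := by
      have := ((PrimeSpectrum.le_iff_specializes z (toricPrime hx)).1 hqy).map
        (toricChart k Δ (orbitCone x)).continuous
      rwa [toricChart_toricPrime hx, ← ht] at this
    have hzt : t ∈ torus k Δ := by
      refine (isUnit_toricGerm_single (m := ⟨m₀, hm₀⟩) (Fan.zeroCone_le _) em₀ htσ).1
        ((isUnit_toricGerm htσ _).2 ?_)
      rw [htz]
      exact hχ
    have h₁ := isUnit_stalkSpecializes x s hz hzt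
    have h₂ : IsUnit (toricGerm htσ d) := (isUnit_toricGerm htσ d).2 <| by
      rw [htz]
      exact fun h => hd (hqy h)
    rw [← stalkSpecializes_toricGerm hz hx] at h₂
    have h₃ := h₁.mul h₂
    rw [← map_mul, e, stalkSpecializes_toricGerm hz hx htσ, isUnit_toricGerm, htz] at h₃
    exact h₃
  obtain ⟨b, n, g, hg, hab⟩ : ∃ (b : AddMonoidAlgebra k (Fan.S (orbitCone x))) (n : ℕ)
      (g : AddMonoidAlgebra k (Fan.S (orbitCone x))), g ∉ (toricPrime hx).asIdeal ∧ a * b = χ ^ n * g := by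
    by_contra! hc
    obtain ⟨q, hq, hle, hdisj⟩ := Ideal.exists_le_prime_disjoint (Ideal.span {a})
      (Submonoid.powers χ ⊔ (toricPrime hx).asIdeal.primeCompl) (by
        refine Set.disjoint_left.2 fun c hc₁ hc₂ => ?_
        obtain ⟨b, rfl⟩ := Ideal.mem_span_singleton.1 hc₁
        obtain ⟨_, ⟨n, rfl⟩, g, hg, h⟩ := Submonoid.mem_sup.1 hc₂
        exact hc b n g hg h.symm)
    refine hprime q hq (fun c hc => ?_) (fun h => ?_) (hle (Ideal.mem_span_singleton_self a))
    · by_contra hcy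
      exact Set.disjoint_left.1 hdisj hc ((le_sup_right : _ ≤ Submonoid.powers χ ⊔ _) hcy)
    · exact Set.disjoint_left.1 hdisj h
        ((le_sup_left : Submonoid.powers χ ≤ _) (Submonoid.mem_powers χ))
  rw [AddMonoidAlgebra.single_pow, one_pow] at hab
  obtain ⟨m, f, hf, hfy⟩ := exists_eq_single_mul_of_mul_eq (Δ.rational _ (orbitCone x).2) (toricPrime hx).asIdeal
    (fun m hm => eq_zero_of_isUnit_toricGerm_single ((isUnit_toricGerm hx _).2 hm)) hab hg
  -- at the level of germs, `s * d = χ^m * f` with `d` and `f` invertible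
  obtain ⟨d', hd', -⟩ := (toricLog k Δ).existsUnique_unit x _ ((isUnit_toricGerm hx d).2 hd)
  obtain ⟨f', hf', -⟩ := (toricLog k Δ).existsUnique_unit x _ ((isUnit_toricGerm hx f).2 hfy)
  have hdu : IsUnit d' := (isUnit_iff_toStructure _ x d').2 (hd' ▸ (isUnit_toricGerm hx d).2 hd)
  have hfu : IsUnit f' := (isUnit_iff_toStructure _ x f').2 (hf' ▸ (isUnit_toricGerm hx f).2 hfy)
  refine ⟨.ofAdd m, (associated_mul_unit_right _ f' hfu).trans ?_⟩
  refine Associated.trans ?_ (associated_mul_unit_left s d' hdu)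
  refine Associated.of_eq (toStructure_injective x ?_)
  rw [map_mul, map_mul, hd', hf', e, hf, map_mul]
  rfl

/-- If `χ^m` and `χ^m'` differ by a unit at `x`, then `u(m') ≤ u(m)` on the cone of the orbit of `x`,
since a function that does not vanish at `x` has a term of weight zero for all of that cone and no
term of negative weight. By symmetry, equality holds. -/
theorem le_of_associated_logCharacter [Module.Free ℤ M] {x : toricVariety k Δ}
    {m m' : Multiplicative (Fan.S (orbitCone x))}
    (h : Associated (logCharacter (mem_orbitCone x) m) (logCharacter (mem_orbitCone x) m')) :
    ∀ u ∈ (orbitCone x).1, u (m'.toAdd : M) ≤ u (m.toAdd : M) := by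
  classical
  have hx := mem_orbitCone x
  obtain ⟨w, hw⟩ := h
  obtain ⟨c, d, hd, hcd⟩ := exists_mul_toricGerm hx ((toricLog k Δ).toStructure x w)
  have hc : c ∉ (toricPrime hx).asIdeal := by
    rw [← isUnit_toricGerm, ← hcd]
    exact (w.isUnit.map _).mul ((isUnit_toricGerm hx d).2 hd)
  have e : AddMonoidAlgebra.single m.toAdd 1 * c = AddMonoidAlgebra.single m'.toAdd 1 * d := by
    refine toricGerm_injective hx ?_
    rw [map_mul, map_mul, ← hcd, ← mul_assoc, ← toStructure_logCharacter,
      ← toStructure_logCharacter, ← map_mul, hw]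
  obtain ⟨m₀, hm₀, hm₀'⟩ : ∃ m₀ ∈ c.coeff.support, ∀ u ∈ (orbitCone x).1, u (m₀ : M) = 0 := by
    by_contra! h
    refine hc ?_
    rw [← AddMonoidAlgebra.sum_coeff_single c]
    refine sum_mem fun b hb => ?_
    obtain ⟨u, hu, hne⟩ := h b hb
    have hb' : AddMonoidAlgebra.single b 1 ∈ (toricPrime hx).asIdeal := by
      by_contra h
      exact hne (eq_zero_of_isUnit_toricGerm_single ((isUnit_toricGerm hx _).2 h) u hu)
    have := (toricPrime hx).asIdeal.mul_mem_left (AddMonoidAlgebra.single 0 (c.coeff b)) hb'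
    rwa [AddMonoidAlgebra.single_mul_single, zero_add, mul_one] at this
  have hmem : m.toAdd + m₀ ∈ (AddMonoidAlgebra.single m'.toAdd 1 * d).coeff.support := by
    rw [← e, AddMonoidAlgebra.support_coeff_single_mul_eq_image c (fun y => by rw [one_mul])
      (add_right_injective _)]
    exact Finset.mem_image_of_mem _ hm₀
  obtain ⟨b, -, hb⟩ := Finset.mem_image.1
    (AddMonoidAlgebra.support_coeff_single_mul_subset d 1 m'.toAdd hmem)
  intro u hu
  have h₁ : u (m'.toAdd : M) + u (b : M) = u (m.toAdd : M) + u (m₀ : M) := by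
    rw [← map_add, ← map_add]
    exact congrArg (fun z : Fan.S (orbitCone x) => u (z : M)) hb
  have h₂ := b.2 u hu
  have h₃ := hm₀' u hu
  linarith

/-- Characters that agree on `σ` differ by an invertible element of `S_σ`. -/
theorem associated_of_eq_on {σ : Δ.Cone} {m m' : Multiplicative (Fan.S σ)}
    (h : ∀ u ∈ σ.1, u (m'.toAdd : M) = u (m.toAdd : M)) : Associated m m' := by
  have h₁ : (m'.toAdd : M) - m.toAdd ∈ Fan.S σ := fun u hu => by
    rw [map_sub, h u hu, sub_self]
  have h₂ : (m.toAdd : M) - m'.toAdd ∈ Fan.S σ := fun u hu => by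
    rw [map_sub, h u hu, sub_self]
  refine ⟨Units.mkOfMulEqOne (.ofAdd ⟨_, h₁⟩) (.ofAdd ⟨_, h₂⟩) ?_, ?_⟩
  · refine Multiplicative.toAdd.injective (Subtype.ext ?_)
    change ((m'.toAdd : M) - m.toAdd) + (m.toAdd - m'.toAdd) = 0
    abel
  · refine Multiplicative.toAdd.injective (Subtype.ext ?_)
    change (m.toAdd : M) + (m'.toAdd - m.toAdd) = m'.toAdd
    abel

/-- The stalk of the characteristic sheaf at a point of the orbit of `σ` is `S_σ / S_σ^*`. -/
theorem bijective_associatesMap_logCharacter [Module.Free ℤ M] (x : toricVariety k Δ) :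
    Function.Bijective (associatesMap (logCharacter (k := k) (mem_orbitCone x))) := by
  constructor
  · intro a b hab
    obtain ⟨m, rfl⟩ := Associates.mk_surjective a
    obtain ⟨m', rfl⟩ := Associates.mk_surjective b
    have h : Associated (logCharacter (mem_orbitCone x) m) (logCharacter (mem_orbitCone x) m') :=
      Associates.mk_eq_mk_iff_associated.1 hab
    exact Associates.mk_eq_mk_iff_associated.2 (associated_of_eq_on fun u hu =>
      le_antisymm (le_of_associated_logCharacter h u hu)
        (le_of_associated_logCharacter h.symm u hu))
  · intro s
    obtain ⟨s, rfl⟩ := Associates.mk_surjective s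
    obtain ⟨m, hm⟩ := exists_logCharacter_mul x s
    exact ⟨Associates.mk m, Associates.mk_eq_mk_iff_associated.2 hm⟩

/-- The characters form sections of the characteristic sheaf. -/
theorem isSection_logCharacter (σ : Δ.Cone) (m : Multiplicative (Fan.S σ)) :
    (charSpace (toricLog k Δ)).sheaf.IsSection (toricOpen k Δ σ) fun x =>
      Associates.mk (logCharacter x.2 m) :=
  fun x => ⟨toricOpen k Δ σ, le_rfl, x.2, fun x => logCharacter x.2 m,
    fun x => ⟨toricOpen k Δ σ, le_rfl, x.2, character k Δ σ m.toAdd, inf_torus_le_basicOpen σ _,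
      fun _ => rfl⟩, fun _ => rfl⟩

variable (k Δ) in
theorem continuous_orbitCone : Continuous (orbitCone : toricVariety k Δ → Δ.Cone) := by
  refine continuous_def.2 fun U hU => isOpen_iff_forall_mem_open.2 fun x hx => ?_
  exact ⟨toricOpen k Δ (orbitCone x), fun z hz => hU (orbitCone_le_iff.2 hz) hx,
    (toricOpen k Δ (orbitCone x)).2, mem_orbitCone x⟩

variable (k Δ) in
/-- The characteristic morphism of a toric variety: it sends the points of the orbit of `σ`
to `σ`. -/
noncomputable def toricCharMap [Module.Free ℤ M] :
    MonoidalSpace.Hom (charSpace (toricLog k Δ)) (Fan.katoFan Δ) where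
  base := ⟨orbitCone, continuous_orbitCone k Δ⟩
  stalkMap x := associatesMap (logCharacter (mem_orbitCone x))
  isLocal x a h := by
    let e := MulEquiv.ofBijective _ (bijective_associatesMap_logCharacter (k := k) x)
    exact (MulEquiv.isUnit_map e).1 h
  map_section V s hs := by
    refine MonoidSheaf.glue _ _ _ fun x => ?_
    obtain ⟨m, hm⟩ := Associates.mk_surjective (s ⟨orbitCone x.1, x.2⟩)
    refine ⟨toricOpen k Δ (orbitCone x.1), fun z hz => V.2 (orbitCone_le_iff.2 hz) x.2,
      mem_orbitCone x.1, ?_⟩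
    refine (congrArg ((charSpace (toricLog k Δ)).sheaf.IsSection (toricOpen k Δ (orbitCone x.1)))
      (funext fun z => ?_)).mpr (isSection_logCharacter (orbitCone x.1) m)
    have hle := orbitCone_le_iff.2 z.2
    have e := hs _ _ hle x.2 (V.2 hle x.2)
    refine (congrArg (associatesMap (logCharacter (mem_orbitCone z.1))) e).symm.trans ?_
    rw [← hm]
    exact congrArg Associates.mk (logCharacter_inclS hle (mem_orbitCone z.1) m)

theorem toricCharMap_isStrict [Module.Free ℤ M] : (toricCharMap k Δ).IsStrict :=
  fun x : toricVariety k Δ => bijective_associatesMap_logCharacter x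

end Local

/-! ### Generic points of torus orbits -/

section Orbits

variable {k : Type u} [Field k] {M : Type u} [AddCommGroup M] {Δ : Fan M}

open Classical in
/-- The endomorphism of `k[S_σ]` that is the identity on the characters in `τ^⊥` and vanishes on
the other ones. -/
noncomputable def faceProjection (k : Type u) [Field k] {τ σ : Δ.Cone} (h : τ ≤ σ) :
    AddMonoidAlgebra k (Fan.S σ) →ₐ[k] AddMonoidAlgebra k (Fan.S σ) :=
  AddMonoidAlgebra.lift k (AddMonoidAlgebra k (Fan.S σ)) (Fan.S σ)
    { toFun := fun m => if m ∈ (Fan.prime h).carrier then 0 else AddMonoidAlgebra.single m.toAdd 1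
      map_one' := if_neg (Fan.prime h).one_notMem
      map_mul' := fun a b => by
        by_cases ha : a ∈ (Fan.prime h).carrier
        · rw [if_pos ha, if_pos (mul_comm b a ▸ (Fan.prime h).mul_mem b a ha), zero_mul]
        by_cases hb : b ∈ (Fan.prime h).carrier
        · rw [if_pos hb, if_pos ((Fan.prime h).mul_mem a b hb), mul_zero]
        rw [if_neg ha, if_neg hb, if_neg fun hab => ((Fan.prime h).mem_or_mem a b hab).elim ha hb,
          AddMonoidAlgebra.single_mul_single, one_mul]
        rfl }

open Classical in
theorem faceProjection_single {τ σ : Δ.Cone} (h : τ ≤ σ) (m : Fan.S σ) (a : k) :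
    faceProjection k h (AddMonoidAlgebra.single m a) =
      a • if .ofAdd m ∈ (Fan.prime h).carrier then 0 else AddMonoidAlgebra.single m 1 :=
  AddMonoidAlgebra.lift_single _ _ _

theorem single_mem_ker_faceProjection {τ σ : Δ.Cone} (h : τ ≤ σ) (m : Fan.S σ) :
    AddMonoidAlgebra.single m 1 ∈ RingHom.ker (faceProjection k h) ↔
      .ofAdd m ∈ (Fan.prime h).carrier := by
  rw [RingHom.mem_ker, faceProjection_single, one_smul]
  by_cases hm : Multiplicative.ofAdd m ∈ (Fan.prime h).carrier
  · simp [hm]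
  · simp [hm]

/-- The kernel of the projection to a face is generated by the characters that vanish on the orbit. -/
theorem ker_faceProjection_le {τ σ : Δ.Cone} (h : τ ≤ σ)
    {p : Ideal (AddMonoidAlgebra k (Fan.S σ))}
    (hp : ∀ m : Fan.S σ, .ofAdd m ∈ (Fan.prime h).carrier → AddMonoidAlgebra.single m 1 ∈ p) :
    RingHom.ker (faceProjection k h) ≤ p := by
  have key : ∀ f, f - faceProjection k h f ∈ p := by
    intro f
    induction f using AddMonoidAlgebra.induction_linear with
    | zero => simp
    | add f g hf hg =>
      rw [map_add, add_sub_add_comm]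
      exact p.add_mem hf hg
    | single m a =>
      rw [faceProjection_single]
      by_cases hm : Multiplicative.ofAdd m ∈ (Fan.prime h).carrier
      · rw [if_pos hm, smul_zero, sub_zero]
        have := p.mul_mem_left (AddMonoidAlgebra.single 0 a) (hp m hm)
        rwa [AddMonoidAlgebra.single_mul_single, zero_add, mul_one] at this
      · rw [if_neg hm, AddMonoidAlgebra.smul_single, smul_eq_mul, mul_one, sub_self]
        exact p.zero_mem
  intro f hf
  have := key f
  rwa [(RingHom.mem_ker).1 hf, sub_zero] at this

theorem specializes_of_toricPrime_le {σ : Δ.Cone} {x y : toricVariety k Δ}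
    (hx : x ∈ toricOpen k Δ σ) (hy : y ∈ toricOpen k Δ σ)
    (h : (toricPrime hx).asIdeal ≤ (toricPrime hy).asIdeal) : x ⤳ y := by
  have := ((PrimeSpectrum.le_iff_specializes (toricPrime hx) (toricPrime hy)).1 h).map
    (toricChart k Δ σ).continuous
  rwa [toricChart_toricPrime, toricChart_toricPrime] at this

theorem section_eq_logCharacter {σ : Δ.Cone} {U : Opens (toricVariety k Δ)}
    {s : ∀ z : U, (charSpace (toricLog k Δ)).stalk z}
    (hs : (charSpace (toricLog k Δ)).sheaf.IsSection U s) {x y : toricVariety k Δ} (h : x ⤳ y)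
    (hyU : y ∈ U) (hyσ : y ∈ toricOpen k Δ σ) {m : Multiplicative (Fan.S σ)}
    (e : s ⟨y, hyU⟩ = Associates.mk (logCharacter hyσ m)) :
    s ⟨x, h.mem_open U.2 hyU⟩ =
      Associates.mk (logCharacter (h.mem_open (toricOpen k Δ σ).2 hyσ) m) :=
  (charSpace (toricLog k Δ)).sheaf.eq_of_specializes hs (isSection_logCharacter σ m) h hyU hyσ e

theorem isUnit_logCharacter_iff {τ σ : Δ.Cone} (h : τ ≤ σ) {m : Multiplicative (Fan.S σ)}
    (e : ∀ u, u ∈ τ.1 ↔ u ∈ σ.1 ∧ u (m.toAdd : M) = 0) {x : toricVariety k Δ}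
    (hx : x ∈ toricOpen k Δ σ) :
    IsUnit (Associates.mk (logCharacter hx m)) ↔ orbitCone x ≤ τ := by
  rw [Associates.isUnit_mk, isUnit_iff_toStructure, toStructure_logCharacter,
    isUnit_toricGerm_single h e, orbitCone_le_iff]

variable [Module.Free ℤ M]

/-- The point of `U_σ` whose prime ideal is spanned by the characters outside of `τ^⊥`, for a face
`τ` of `σ`. -/
noncomputable def orbitPoint (k : Type u) [Field k] {τ σ : Δ.Cone} (h : τ ≤ σ) :
    toricVariety k Δ :=
  have := uniqueSums_submonoid (Fan.S σ)
  toricChart k Δ σ (⟨RingHom.ker (faceProjection k h), RingHom.ker_isPrime _⟩ :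
    PrimeSpectrum (AddMonoidAlgebra k (Fan.S σ)))

theorem orbitPoint_mem {τ σ : Δ.Cone} (h : τ ≤ σ) : orbitPoint k h ∈ toricOpen k Δ σ := ⟨_, rfl⟩

theorem toricPrime_orbitPoint {τ σ : Δ.Cone} (h : τ ≤ σ) (hx : orbitPoint k h ∈ toricOpen k Δ σ) :
    (toricPrime hx).asIdeal = RingHom.ker (faceProjection k h) :=
  congrArg PrimeSpectrum.asIdeal
    ((toricChart k Δ σ).isOpenEmbedding.injective (toricChart_toricPrime hx))

theorem orbitCone_orbitPoint {τ σ : Δ.Cone} (h : τ ≤ σ) : orbitCone (orbitPoint k h) = τ := by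
  have key : ∀ (ρ : Δ.Cone) (hρ : ρ ≤ σ), orbitCone (orbitPoint k h) ≤ ρ ↔ τ ≤ ρ := by
    intro ρ hρ
    obtain ⟨m, hm, e⟩ := Fan.exists_notMem_prime hρ
    rw [orbitCone_le_iff, ← isUnit_toricGerm_single hρ e (orbitPoint_mem h), isUnit_toricGerm,
      toricPrime_orbitPoint, single_mem_ker_faceProjection]
    refine (Fan.notMem_prime h).trans ⟨fun hτ u hu => (e u).2 ⟨h hu, hτ u hu⟩, fun hτ u hu =>
      ((e u).1 (hτ hu)).2⟩
  have hle : orbitCone (orbitPoint k h) ≤ σ := orbitCone_le_iff.2 (orbitPoint_mem h)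
  exact le_antisymm ((key τ h).2 le_rfl) ((key _ hle).1 le_rfl)

variable (k) in
/-- The generic point of the torus orbit of `σ`. -/
noncomputable def orbitGeneric (σ : Δ.Cone) : toricVariety k Δ := orbitPoint k (le_refl σ)

theorem orbitGeneric_mem (σ : Δ.Cone) : orbitGeneric k σ ∈ toricOpen k Δ σ := orbitPoint_mem _

theorem toricPrime_orbitGeneric {σ : Δ.Cone} (hx : orbitGeneric k σ ∈ toricOpen k Δ σ) :
    (toricPrime hx).asIdeal = RingHom.ker (faceProjection k (le_refl σ)) :=
  toricPrime_orbitPoint _ hx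

theorem orbitCone_orbitGeneric (σ : Δ.Cone) : orbitCone (orbitGeneric k σ) = σ :=
  orbitCone_orbitPoint _

theorem orbitGeneric_specializes (x : toricVariety k Δ) : orbitGeneric k (orbitCone x) ⤳ x := by
  refine specializes_of_toricPrime_le (orbitGeneric_mem _) (mem_orbitCone x) ?_
  rw [toricPrime_orbitGeneric]
  refine ker_faceProjection_le _ fun m hm => ?_
  by_contra h
  exact (Fan.notMem_prime _).2
    (eq_zero_of_isUnit_toricGerm_single ((isUnit_toricGerm (mem_orbitCone x) _).2 h)) hm

theorem orbitGeneric_specializes_of_le {τ σ : Δ.Cone} (h : τ ≤ σ) :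
    orbitGeneric k τ ⤳ orbitGeneric k σ := by
  have h₁ := orbitGeneric_specializes (orbitPoint k h)
  rw [orbitCone_orbitPoint] at h₁
  refine h₁.trans (specializes_of_toricPrime_le (orbitPoint_mem h) (orbitGeneric_mem σ) ?_)
  rw [toricPrime_orbitPoint]
  refine ker_faceProjection_le _ fun m hm => ?_
  rw [toricPrime_orbitGeneric, single_mem_ker_faceProjection]
  obtain ⟨u, hu, hne⟩ := hm
  exact ⟨u, h hu, hne⟩

/-! ### The universal property of the characteristic morphism -/

open MonoidalSpace in
/-- A strict morphism to a Kato fan identifies a point with a generization as soon as no germ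
becomes invertible there. -/
theorem base_eq_of_specializes {X : MonoidalSpace.{v}} {G : MonoidalSpace.{u}}
    (hG : ∀ y : G.carrier, ∃ (P : Type u) (_ : CommMonoid P) (j : Hom (MSpec P) G),
      j.IsOpenImmersion ∧ y ∈ Set.range j.base) (f : Hom X G) {x y : X.carrier} (h : x ⤳ y)
    (hu : ∀ (U : Opens X.carrier) (s : ∀ z : U, X.stalk z), X.sheaf.IsSection U s →
      ∀ (hx : x ∈ U) (hy : y ∈ U), IsUnit (s ⟨x, hx⟩) → IsUnit (s ⟨y, hy⟩)) :
    f.base x = f.base y := by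
  obtain ⟨P, _, j, hj, p, hp⟩ := hG (f.base y)
  obtain ⟨q, hq, e⟩ : ∃ q, q ⤳ p ∧ j.base q = f.base x := by
    refine mem_range_of_specializes hj ?_
    rw [hp]
    exact h.map f.base.continuous
  rw [← e, ← hp]
  congr 1
  ext a
  refine ⟨fun ha => PrimeIdeal.specializes_iff.1 hq ha, fun ha => ?_⟩
  by_contra hqa
  obtain ⟨V, hV, s, hs, es⟩ := exists_section_toStalk hj.isStrict p a
  have k₁ := section_eq_toStalk (j.map_section V s hs) hq hV es
  have hVq : j.base q ∈ V := hq.mem_open (V.2.preimage j.base.continuous) hV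
  have t : ∀ z w (e : z = w) (hz : z ∈ V) (hw : w ∈ V),
      IsUnit (s ⟨z, hz⟩) → IsUnit (s ⟨w, hw⟩) := by
    rintro z _ rfl hz hw h
    exact h
  have hVx : f.base x ∈ V := e ▸ hVq
  have hVy : f.base y ∈ V := hp ▸ hV
  have u₁ := t _ _ e hVq hVx ((mem_iff_isUnit hVq k₁).1 hqa)
  have u₂ := hu _ _ (f.map_section V s hs) hVx hVy (u₁.map (f.stalkMap x))
  exact (mem_iff_isUnit hV es).2 (t _ _ hp.symm hVy hV (f.isLocal y _ u₂)) ha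

theorem bijective_logCharacter_of_eq {σ : Δ.Cone} {x : toricVariety k Δ} (h : orbitCone x = σ)
    (hx : x ∈ toricOpen k Δ σ) : Function.Bijective (associatesMap (logCharacter hx)) := by
  subst h
  exact bijective_associatesMap_logCharacter x

section Initial

variable {G : MonoidalSpace.{u}} (ψ : MonoidalSpace.Hom (charSpace (toricLog k Δ)) G)

/-- Strict morphisms to Kato fans are constant on torus orbits. -/
theorem base_orbitGeneric (hG : IsFsKatoFan G) (x : toricVariety k Δ) :
    ψ.base (orbitGeneric k (orbitCone x)) = ψ.base x := by
  refine base_eq_of_specializes (fun y => ?_) ψ (orbitGeneric_specializes x)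
    fun U s hs hx hy hu => ?_
  · obtain ⟨P, i, j, -, hj, hy⟩ := hG.cover y
    exact ⟨P, i, j, hj, hy⟩
  · obtain ⟨a, ha⟩ := (bijective_associatesMap_logCharacter x).2 (s ⟨x, hy⟩)
    obtain ⟨m, rfl⟩ := Associates.mk_surjective a
    have e := section_eq_logCharacter hs (orbitGeneric_specializes x) hy (mem_orbitCone x) ha.symm
    obtain ⟨τ, hτ, hm⟩ := Fan.exists_face (orbitCone x) m.toAdd.2
    have hu' : IsUnit (Associates.mk (logCharacter (orbitGeneric_mem (k := k) (orbitCone x)) m)) :=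
      e ▸ hu
    rw [isUnit_logCharacter_iff hτ hm, orbitCone_orbitGeneric] at hu'
    rw [← ha]
    exact (isUnit_logCharacter_iff hτ hm (mem_orbitCone x)).2 hu'

/-- The isomorphism between `S_σ / S_σ^*` and the stalk of the characteristic sheaf at the generic
point of the orbit of `σ`. -/
noncomputable def orbitEquiv (k : Type u) [Field k] (σ : Δ.Cone) :
    Fan.SharpS σ ≃* (charSpace (toricLog k Δ)).stalk (orbitGeneric k σ) :=
  MulEquiv.ofBijective _ (bijective_logCharacter_of_eq (orbitCone_orbitGeneric σ)
    (orbitGeneric_mem (k := k) σ))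

theorem orbitEquiv_mk (σ : Δ.Cone) (m : Multiplicative (Fan.S σ)) :
    orbitEquiv k σ (Associates.mk m) = Associates.mk (logCharacter (orbitGeneric_mem σ) m) := rfl

/-- The morphism from the Kato fan of `Δ` induced by a strict morphism from the toric variety: it
sends `σ` to the image of the generic point of the orbit of `σ`. -/
noncomputable def toricFactor : MonoidalSpace.Hom (Fan.katoFan Δ) G where
  base := ⟨fun σ => ψ.base (orbitGeneric k σ), continuous_def.2 fun V hV _ _ hle hσ =>
    (orbitGeneric_specializes_of_le hle).mem_open (hV.preimage ψ.base.continuous) hσ⟩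
  stalkMap σ := (orbitEquiv k σ).symm.toMonoidHom.comp (ψ.stalkMap (orbitGeneric k σ))
  isLocal σ a h := ψ.isLocal _ a ((MulEquiv.isUnit_map (orbitEquiv k σ).symm).1 h)
  map_section V s hs τ σ hle hσ hτ := by
    obtain ⟨m, hm⟩ := Associates.mk_surjective
      ((orbitEquiv k σ).symm (ψ.stalkMap (orbitGeneric k σ) (s ⟨ψ.base (orbitGeneric k σ), hσ⟩)))
    have e := section_eq_logCharacter (ψ.map_section V s hs) (orbitGeneric_specializes_of_le hle)
      hσ (orbitGeneric_mem σ) (m := m) (by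
        rw [← orbitEquiv_mk, hm]
        exact ((orbitEquiv k σ).apply_symm_apply _).symm)
    refine (congrArg (Fan.resS hle) hm).symm.trans ?_
    refine ((orbitEquiv k τ).symm_apply_eq.2 (Eq.trans e ?_)).symm
    rw [Fan.resS_mk, orbitEquiv_mk, logCharacter_inclS]

theorem toricFactor_isStrict (hψ : ψ.IsStrict) : (toricFactor ψ).IsStrict := fun σ =>
  (orbitEquiv k σ).symm.bijective.comp (hψ (orbitGeneric k σ))

theorem toricCharMap_comp_toricFactor (hG : IsFsKatoFan G) :
    (toricCharMap k Δ).comp (toricFactor ψ) = ψ := by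
  refine MonoidalSpace.Hom.ext_of_section (base_orbitGeneric ψ hG) fun V s hs x hf hg => ?_
  obtain ⟨a, ha⟩ := (bijective_associatesMap_logCharacter (k := k) x).2
    (ψ.stalkMap x (s ⟨ψ.base x, hg⟩))
  obtain ⟨m, rfl⟩ := Associates.mk_surjective a
  have e := section_eq_logCharacter (ψ.map_section V s hs) (orbitGeneric_specializes x) hg
    (mem_orbitCone x) (m := m) ha.symm
  refine Eq.trans ?_ ha
  refine congrArg (associatesMap (logCharacter (mem_orbitCone x))) ?_
  exact (orbitEquiv k (orbitCone x)).symm_apply_eq.2 e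

end Initial

theorem toricCharMap_surjective : Function.Surjective (toricCharMap k Δ).base :=
  fun σ => ⟨orbitGeneric k σ, orbitCone_orbitGeneric σ⟩

variable (k Δ) in
theorem isCharacteristic_toricCharMap [Module.Finite ℤ M] :
    IsCharacteristic (toricLog k Δ) (toricCharMap k Δ) where
  isFsKatoFan := Fan.isFsKatoFan_katoFan Δ
  isStrict := toricCharMap_isStrict
  existsUnique G ψ hG hψ := by
    refine ⟨toricFactor ψ, ⟨toricFactor_isStrict ψ hψ, toricCharMap_comp_toricFactor ψ hG⟩, ?_⟩
    rintro g ⟨-, hg⟩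
    exact MonoidalSpace.Hom.comp_left_cancel toricCharMap_surjective
      (fun x => (toricCharMap_isStrict x).1) (hg.trans (toricCharMap_comp_toricFactor ψ hG).symm)

/-! ### Charts of the Kato fan of a toric variety -/

/-- `j` is a system of charts `Spec S_σ → F` of the Kato fan `F` of a toric variety, compatible with
the inclusions of faces and with the characteristic morphism `φ`. -/
structure IsToricAtlas {F : MonoidalSpace.{u}}
    (φ : MonoidalSpace.Hom (charSpace (toricLog k Δ)) F)
    (j : ∀ σ : Δ.Cone, MonoidalSpace.Hom (MSpec (Multiplicative (Fan.S σ))) F) : Prop where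
  isOpenImmersion : ∀ σ, (j σ).IsOpenImmersion
  mem_range_iff : ∀ σ (x : toricVariety k Δ), φ.base x ∈ Set.range (j σ).base ↔
    x ∈ toricOpen k Δ σ
  map_comp : ∀ {τ σ : Δ.Cone} (h : τ ≤ σ), (MSpec.map (Fan.inclS h)).comp (j σ) = j τ
  cover : ∀ y, ∃ σ, y ∈ Set.range (j σ).base
  inter : ∀ {σ τ : Δ.Cone} {y}, y ∈ Set.range (j σ).base → y ∈ Set.range (j τ).base →
    y ∈ Set.range (j (Fan.inter σ τ)).base
  existsUnique_range : ∀ (P : Type u) (_ : CommMonoid P) (i : MonoidalSpace.Hom (MSpec P) F),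
    i.IsOpenImmersion → ∃! σ, Set.range i.base = Set.range (j σ).base
  stalkMap_eq : ∀ {σ : Δ.Cone} {x : toricVariety k Δ} (hx : x ∈ toricOpen k Δ σ)
    (p : PrimeIdeal (Multiplicative (Fan.S σ))), (j σ).base p = φ.base x →
    ∀ (V : Opens F.carrier) (s : ∀ y : V, F.stalk y) (h₁ : (j σ).base p ∈ V)
      (h₂ : φ.base x ∈ V) (m : Multiplicative (Fan.S σ)),
      (j σ).stalkMap p (s ⟨_, h₁⟩) = toStalk p m →
        φ.stalkMap x (s ⟨_, h₂⟩) = Associates.mk (logCharacter hx m)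

variable [Module.Finite ℤ M]

theorem isToricAtlas_chart : IsToricAtlas (toricCharMap k Δ) (Fan.chart (Δ := Δ)) where
  isOpenImmersion := Fan.isOpenImmersion_chart
  mem_range_iff σ x := by
    rw [Fan.range_chart]
    exact orbitCone_le_iff
  map_comp h := Fan.map_chart h
  cover σ := ⟨σ, Fan.exists_chart σ⟩
  inter {σ τ ρ} h h' := by
    rw [Fan.range_chart] at h h' ⊢
    exact Fan.le_inter h h'
  existsUnique_range P _ i hi := by
    rw [Fan.range_eq_Iic hi]
    refine ⟨_, (Fan.range_chart _).symm, fun σ h => ?_⟩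
    have h : Set.Iic _ = Set.range (Fan.chart σ).base := h
    rw [Fan.range_chart] at h
    exact (Set.Iic_injective h).symm
  stalkMap_eq {σ x} hx p hp V s h₁ h₂ m hm := by
    obtain ⟨m', hm'⟩ := Fan.resS_surjective (Fan.primeFace_le p) (s ⟨Fan.primeFace p, h₁⟩)
    have hle : orbitCone x ≤ σ := orbitCone_le_iff.2 hx
    have e : s ⟨Fan.primeFace p, h₁⟩ = Associates.mk (Fan.inclS (Fan.primeFace_le p) m) :=
      (Fan.stalkEquiv p).injective (Eq.trans hm (Fan.stalkEquiv_mk p m).symm)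
    have aux : ∀ ρ (hρ : Fan.primeFace p = ρ) (hρσ : ρ ≤ σ) (h : ρ ∈ V),
        s ⟨ρ, h⟩ = Associates.mk (Fan.inclS hρσ m) := by
      rintro _ rfl _ _
      exact e
    refine (congrArg (associatesMap (logCharacter (mem_orbitCone x))) (aux _ hp hle h₂)).trans ?_
    exact congrArg Associates.mk (logCharacter_inclS hle (mem_orbitCone x) m)

/-- Every characteristic morphism of a toric variety admits a toric atlas, since it is isomorphic to
the one with target the Kato fan of `Δ`. -/
theorem exists_isToricAtlas {F : MonoidalSpace.{u}}
    {φ : MonoidalSpace.Hom (charSpace (toricLog k Δ)) F}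
    (hφ : IsCharacteristic (toricLog k Δ) φ) : ∃ j, IsToricAtlas φ j := by
  have hφ₀ := isCharacteristic_toricCharMap k Δ
  obtain ⟨g, ⟨hg, rfl⟩, -⟩ := hφ₀.existsUnique F φ hφ.isFsKatoFan hφ.isStrict
  obtain ⟨h, ⟨hh, e⟩, -⟩ := hφ.existsUnique _ _ hφ₀.isFsKatoFan hφ₀.isStrict
  have hgh : g.comp h = MonoidalSpace.Hom.id _ :=
    (hφ₀.existsUnique _ _ hφ₀.isFsKatoFan hφ₀.isStrict).unique ⟨hg.comp hh, e⟩
      ⟨MonoidalSpace.Hom.id_isStrict _, rfl⟩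
  have hhg : h.comp g = MonoidalSpace.Hom.id _ :=
    (hφ.existsUnique _ _ hφ.isFsKatoFan hφ.isStrict).unique
      ⟨hh.comp hg, by
        change (((toricCharMap k Δ).comp g).comp h).comp g = _
        rw [e]⟩
      ⟨MonoidalSpace.Hom.id_isStrict _, rfl⟩
  have hg' := MonoidalSpace.Hom.isOpenImmersion_of_inverse hgh hhg hg
  have hh' := MonoidalSpace.Hom.isOpenImmersion_of_inverse hhg hgh hh
  have hgi := hg'.isOpenEmbedding.injective
  have hA := isToricAtlas_chart (k := k) (Δ := Δ)
  have hgs : ∀ y, ∃ σ, g.base σ = y := fun y =>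
    ⟨h.base y, congrArg (fun p : MonoidalSpace.Hom F F => p.base y) hhg⟩
  have hrange : ∀ σ, Set.range ((Fan.chart σ).comp g).base =
      g.base '' Set.range (Fan.chart σ).base := fun σ =>
    Set.range_comp g.base (Fan.chart σ).base
  refine ⟨fun σ => (Fan.chart σ).comp g, ?_⟩
  constructor
  · exact fun σ => (hA.isOpenImmersion σ).comp hg'
  · intro σ x
    rw [hrange, ← hA.mem_range_iff]
    exact hgi.mem_set_image
  · intro τ σ hle
    exact congrArg (fun p => MonoidalSpace.Hom.comp p g) (hA.map_comp hle)
  · intro y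
    obtain ⟨σ, rfl⟩ := hgs y
    exact ⟨σ, by rw [hrange]; exact Set.mem_image_of_mem _ (Fan.exists_chart σ)⟩
  · intro σ τ y h₁ h₂
    obtain ⟨ρ, rfl⟩ := hgs y
    rw [hrange, hgi.mem_set_image] at h₁ h₂ ⊢
    exact hA.inter h₁ h₂
  · intro P _ i hi
    have key : ∀ σ, Set.range i.base = Set.range ((Fan.chart σ).comp g).base ↔
        Set.range (i.comp h).base = Set.range (Fan.chart σ).base := by
      intro σ
      have e₁ : Set.range (i.comp h).base = h.base '' Set.range i.base :=
        Set.range_comp h.base i.base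
      have e₂ : Set.range i.base = g.base '' Set.range (i.comp h).base := by
        rw [e₁, Set.image_image]
        refine (Set.image_congr fun y _ => ?_).symm.trans (Set.image_id _) |>.symm
        exact (congrArg (fun p : MonoidalSpace.Hom F F => p.base y) hhg).symm
      rw [hrange, e₂]
      exact hgi.image_injective.eq_iff
    simp only [key]
    exact hA.existsUnique_range P _ (i.comp h) (hi.comp hh')
  · intro σ x hx p hp V s h₁ h₂ m hm
    exact hA.stalkMap_eq hx p (hgi hp) (V.comap g.base) (fun y => g.stalkMap y (s ⟨g.base y, y.2⟩))
      h₁ h₂ m hm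

end Orbits

/-! ### Extension of homomorphisms to localizations of monoids -/

section Extend

variable {M : Type u} [AddCommGroup M] {A B : AddSubmonoid M} {Q : Type v} [AddCommMonoid Q]

/-- A homomorphism on `A` that is invertible at `m` extends to a localization of `A` at `m`. -/
theorem exists_extend_of_isAddUnit (h : A ≤ B) {m : M} (hm : m ∈ A)
    (hB : ∀ w ∈ B, ∃ n : ℕ, w + n • m ∈ A) (g : A →+ Q) (hg : IsAddUnit (g ⟨m, hm⟩)) :
    ∃ g' : B →+ Q, ∀ a : A, g' ⟨a, h a.2⟩ = g a := by
  obtain ⟨q, hq⟩ := hg.exists_neg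
  choose! n hn using hB
  have hpow : ∀ k : ℕ, k • g ⟨m, hm⟩ + k • q = 0 := fun k => by
    rw [← nsmul_add, hq, nsmul_zero]
  -- the value `g (w + n m) - n g(m)` does not depend on `n`
  have key : ∀ (w : M) (k l : ℕ) (hk : w + k • m ∈ A) (hl : w + l • m ∈ A),
      g ⟨_, hk⟩ + k • q = g ⟨_, hl⟩ + l • q := by
    intro w k l hk hl
    have e : g ⟨_, hk⟩ + l • g ⟨m, hm⟩ = g ⟨_, hl⟩ + k • g ⟨m, hm⟩ := by
      rw [← map_nsmul, ← map_nsmul, ← map_add, ← map_add]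
      congr 1
      refine Subtype.ext ?_
      change w + k • m + l • m = w + l • m + k • m
      abel
    calc g ⟨_, hk⟩ + k • q = g ⟨_, hk⟩ + k • q + (l • g ⟨m, hm⟩ + l • q) := by
          rw [hpow, add_zero]
      _ = (g ⟨_, hk⟩ + l • g ⟨m, hm⟩) + (k • q + l • q) := by abel
      _ = g ⟨_, hl⟩ + l • q + (k • g ⟨m, hm⟩ + k • q) := by rw [e]; abel
      _ = _ := by rw [hpow, add_zero]
  refine ⟨{ toFun := fun w => g ⟨w + n w • m, hn w w.2⟩ + n w • q
            map_zero' := ?_, map_add' := fun w w' => ?_ }, fun a => ?_⟩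
  · have := key 0 (n 0) 0 (hn 0 B.zero_mem) (by simp)
    refine this.trans ?_
    have e : ∀ h, (⟨0 + 0 • m, h⟩ : A) = 0 := fun h => Subtype.ext (by simp)
    rw [e, map_zero, zero_nsmul, add_zero]
  · have hA : (w + w' : M) + (n w + n w') • m ∈ A := by
      have := add_mem (hn w w.2) (hn w' w'.2)
      rwa [add_add_add_comm, ← add_nsmul] at this
    refine (key (w + w') _ (n w + n w') (hn _ (add_mem w.2 w'.2)) hA).trans ?_
    have e : (⟨_, hA⟩ : A) = ⟨_, hn w w.2⟩ + ⟨_, hn w' w'.2⟩ := Subtype.ext (by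
      change (w + w' : M) + (n w + n w') • m = w + n w • m + (w' + n w' • m)
      rw [add_nsmul]; abel)
    rw [e, map_add, add_nsmul]
    abel
  · refine (key a (n a) 0 (hn a (h a.2)) (by simp)).trans ?_
    have e : ∀ h, (⟨a + 0 • m, h⟩ : A) = a := fun h => Subtype.ext (by simp)
    rw [e, zero_nsmul, add_zero]

end Extend

/-! ### The Kajiwara-Payne partial compactification -/

/-- The function `-log : [0, ∞) → ℝ ∪ {∞}` is an order-reversing bijection. -/
noncomputable def negLogIso : NNRealᵒᵈ ≃o WithTop ℝ where
  toFun r := negLogTop (OrderDual.ofDual r)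
  invFun x := OrderDual.toDual (x.recTopCoe 0 fun x => ⟨Real.exp (-x), (Real.exp_pos _).le⟩)
  left_inv r := by
    change OrderDual.toDual _ = r
    induction r using OrderDual.rec with
    | _ r =>
    congr 1
    change (negLogTop r).recTopCoe 0 _ = r
    unfold negLogTop
    by_cases h : r = 0
    · rw [if_pos h, h]
      rfl
    · rw [if_neg h]
      refine NNReal.eq ?_
      have : (0 : ℝ) < r := NNReal.coe_pos.2 (pos_iff_ne_zero.2 h)
      change Real.exp (- -Real.log r) = r
      rw [neg_neg, Real.exp_log this]
  right_inv x := by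
    change negLogTop (x.recTopCoe 0 _) = x
    induction x using WithTop.recTopCoe with
    | top => exact if_pos rfl
    | coe x =>
      have h : (⟨Real.exp (-x), (Real.exp_pos _).le⟩ : NNReal) ≠ 0 := fun h =>
        (Real.exp_pos (-x)).ne' (congrArg NNReal.toReal h)
      refine (if_neg h).trans ?_
      change ((-Real.log (Real.exp (-x)) : ℝ) : WithTop ℝ) = x
      rw [Real.log_exp, neg_neg]
  map_rel_iff' {r s} := by
    induction r using OrderDual.rec with
    | _ r =>
    induction s using OrderDual.rec with
    | _ s =>
    change negLogTop r ≤ negLogTop s ↔ s ≤ r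
    unfold negLogTop
    by_cases hs : s = 0
    · simp [hs]
    rw [if_neg hs]
    by_cases hr : r = 0
    · simp [hr, hs]
    rw [if_neg hr, WithTop.coe_le_coe, neg_le_neg_iff, Real.log_le_log_iff]
    · exact NNReal.coe_le_coe
    · exact NNReal.coe_pos.2 (pos_iff_ne_zero.2 hs)
    · exact NNReal.coe_pos.2 (pos_iff_ne_zero.2 hr)

/-- The function `x ↦ exp (-x)` on `ℝ ∪ {∞}`. -/
noncomputable def expNeg (x : WithTop ℝ) : NNReal := OrderDual.ofDual (negLogIso.symm x)

theorem negLogTop_expNeg (x : WithTop ℝ) : negLogTop (expNeg x) = x := negLogIso.apply_symm_apply x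

theorem expNeg_negLogTop (r : NNReal) : expNeg (negLogTop r) = r :=
  congrArg OrderDual.ofDual (negLogIso.symm_apply_apply (OrderDual.toDual r))

theorem expNeg_injective : Function.Injective expNeg :=
  Function.LeftInverse.injective negLogTop_expNeg

theorem isEmbedding_expNeg : Topology.IsEmbedding expNeg :=
  (Homeomorph.refl NNReal).isEmbedding.comp negLogIso.symm.toHomeomorph.isEmbedding

theorem expNeg_zero : expNeg 0 = 1 := by
  rw [← negLogTop_one, expNeg_negLogTop]

theorem expNeg_add (x y : WithTop ℝ) : expNeg (x + y) = expNeg x * expNeg y := by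
  rw [← expNeg_negLogTop (expNeg x * expNeg y), negLogTop_mul, negLogTop_expNeg, negLogTop_expNeg]

theorem expNeg_nsmul (n : ℕ) (x : WithTop ℝ) : expNeg (n • x) = expNeg x ^ n := by
  induction n with
  | zero => rw [zero_nsmul, pow_zero, expNeg_zero]
  | succ n ih => rw [succ_nsmul, pow_succ, expNeg_add, ih]

theorem expNeg_eq_zero {x : WithTop ℝ} : expNeg x = 0 ↔ x = ⊤ := by
  have : expNeg ⊤ = 0 := by
    have := expNeg_negLogTop 0
    rwa [negLogTop, if_pos rfl] at this
  rw [← this]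
  exact expNeg_injective.eq_iff

theorem isAddUnit_iff_ne_top {x : WithTop ℝ} : IsAddUnit x ↔ x ≠ ⊤ := by
  constructor
  · rintro h rfl
    obtain ⟨y, hy⟩ := h.exists_neg
    rw [WithTop.top_add] at hy
    exact WithTop.top_ne_zero hy
  · intro h
    lift x to ℝ using h
    exact IsAddUnit.of_add_eq_zero ((-x : ℝ) : WithTop ℝ) (by
      rw [← WithTop.coe_add, add_neg_cancel, WithTop.coe_zero])

section KajiwaraPayne

variable {M : Type u} [AddCommGroup M] {Δ : Fan M}

namespace KPChart

/-- A point of `N_ℝ(σ)` as a homomorphism. -/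
def toHom {σ : Δ.Cone} (u : KPChart σ) : Fan.S σ →+ WithTop ℝ := u

/-- The function `exp (- u(m))` on `N_ℝ(σ)`. -/
noncomputable def coord {σ : Δ.Cone} (m : Fan.S σ) (u : KPChart σ) : NNReal :=
  expNeg (u.toHom m)

theorem coord_add {σ : Δ.Cone} (m m' : Fan.S σ) (u : KPChart σ) :
    coord (m + m') u = coord m u * coord m' u := by
  rw [coord, coord, coord, map_add, expNeg_add]

theorem coord_nsmul {σ : Δ.Cone} (n : ℕ) (m : Fan.S σ) (u : KPChart σ) :
    coord (n • m) u = coord m u ^ n := by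
  rw [coord, coord, map_nsmul, expNeg_nsmul]

theorem ext_coord {σ : Δ.Cone} {a b : KPChart σ} (h : ∀ m, coord m a = coord m b) : a = b :=
  show a.toHom = b.toHom from AddMonoidHom.ext fun m => expNeg_injective (h m)

theorem isInducing_coord (σ : Δ.Cone) :
    Topology.IsInducing fun (u : KPChart σ) (m : Fan.S σ) => coord m u :=
  (Topology.IsInducing.piMap fun _ : Fan.S σ => isEmbedding_expNeg.isInducing).comp
    (⟨rfl⟩ : Topology.IsInducing fun (u : KPChart σ) (m : Fan.S σ) =>
      u.toHom m)

theorem continuous_coord {σ : Δ.Cone} (m : Fan.S σ) :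
    Continuous (coord m : KPChart σ → NNReal) :=
  (continuous_apply m).comp (isInducing_coord σ).continuous

theorem continuous_iff {σ : Δ.Cone} {Y : Type*} [TopologicalSpace Y] {f : Y → KPChart σ} :
    Continuous f ↔ ∀ m, Continuous fun y => coord m (f y) :=
  (isInducing_coord σ).continuous_iff.trans continuous_pi_iff

theorem coord_restrict {τ σ : Δ.Cone} (h : τ ≤ σ) (u : KPChart τ) (m : Fan.S σ) :
    coord m (restrict h u) =
      coord (⟨m, Fan.S_anti h m.2⟩ : Fan.S τ) u := rfl

theorem continuous_restrict {τ σ : Δ.Cone} (h : τ ≤ σ) :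
    Continuous (restrict h : KPChart τ → KPChart σ) :=
  continuous_iff.2 fun m => continuous_coord (σ := τ) ⟨m, Fan.S_anti h m.2⟩

section Face

variable {τ σ : Δ.Cone} (h : τ ≤ σ) {m : M} (hm : m ∈ Fan.S σ)

theorem coord_ne_zero (hτ : ∀ u, u ∈ τ.1 ↔ u ∈ σ.1 ∧ u m = 0) (u : KPChart τ) :
    coord (⟨m, Fan.S_anti h hm⟩ : Fan.S τ) u ≠ 0 := by
  have hneg : -m ∈ Fan.S τ := fun v hv => by rw [map_neg, ((hτ v).1 hv).2, neg_zero]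
  intro h0
  have e := coord_add ⟨m, Fan.S_anti h hm⟩ (⟨-m, hneg⟩ : Fan.S τ) u
  rw [h0, zero_mul] at e
  have e' : (⟨m, Fan.S_anti h hm⟩ + ⟨-m, hneg⟩ : Fan.S τ) = 0 := Subtype.ext (add_neg_cancel m)
  rw [e', coord, map_zero, expNeg_zero] at e
  exact one_ne_zero e

/-- `S_τ` is obtained from `S_σ` by inverting the character that cuts out the face `τ`. -/
theorem exists_nsmul (hm : m ∈ Fan.S σ) (hτ : ∀ u, u ∈ τ.1 ↔ u ∈ σ.1 ∧ u m = 0)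
    (w : M) (hw : w ∈ Fan.S τ) : ∃ n : ℕ, w + n • m ∈ Fan.S σ :=
  exists_add_nsmul_mem (Δ.rational _ σ.2) hm hτ hw

theorem coord_eq_div (hτ : ∀ u, u ∈ τ.1 ↔ u ∈ σ.1 ∧ u m = 0) (u : KPChart τ)
    (w : Fan.S τ) {n : ℕ} (hn : (w : M) + n • m ∈ Fan.S σ) :
    coord w u = coord (⟨_, hn⟩ : Fan.S σ) (restrict h u) *
      (coord (⟨m, hm⟩ : Fan.S σ) (restrict h u) ^ n)⁻¹ := by
  have h0 := coord_ne_zero h hm hτ u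
  rw [coord_restrict, coord_restrict, eq_mul_inv_iff_mul_eq₀ (pow_ne_zero _ h0), ← coord_nsmul,
    ← coord_add]
  rfl

/-- The subset `N_ℝ(τ)` of `N_ℝ(σ)` is the locus where the character that cuts out `τ` is finite. -/
theorem mem_range_restrict_iff (hτ : ∀ u, u ∈ τ.1 ↔ u ∈ σ.1 ∧ u m = 0)
    (u : KPChart σ) :
    u ∈ Set.range (restrict h) ↔ coord (⟨m, hm⟩ : Fan.S σ) u ≠ 0 := by
  constructor
  · rintro ⟨u, rfl⟩
    exact coord_ne_zero h hm hτ u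
  · intro h0
    obtain ⟨g, hg⟩ := exists_extend_of_isAddUnit (Fan.S_anti h) hm (exists_nsmul hm hτ) u.toHom
      (isAddUnit_iff_ne_top.2 fun e => h0 (expNeg_eq_zero.2 e))
    exact ⟨g, show AddMonoidHom.comp _ _ = u.toHom from AddMonoidHom.ext hg⟩

end Face

theorem isOpenEmbedding_restrict {τ σ : Δ.Cone} (h : τ ≤ σ) :
    Topology.IsOpenEmbedding (restrict h : KPChart τ → KPChart σ) := by
  obtain ⟨m, hm, hτ⟩ := Fan.isFace_of_le h
  choose! n hn using exists_nsmul hm hτ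
  refine ⟨⟨⟨le_antisymm (continuous_restrict h).le_induced ?_⟩, fun a b e => ?_⟩, ?_⟩
  · have : @Continuous _ _ (TopologicalSpace.induced (restrict h) inferInstance)
        inferInstance (id : KPChart τ → KPChart τ) := by
      let _ := TopologicalSpace.induced (restrict h : KPChart τ → KPChart σ) inferInstance
      refine continuous_iff.2 fun w => ?_
      have hc : Continuous (restrict h : KPChart τ → KPChart σ) := continuous_induced_dom
      have e : (fun u : KPChart τ => coord w (id u)) = fun u : KPChart τ =>
          coord (⟨_, hn w w.2⟩ : Fan.S σ) (restrict h u) *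
            (coord (⟨m, hm⟩ : Fan.S σ) (restrict h u) ^ n w)⁻¹ :=
        funext fun u => coord_eq_div h hm hτ u w (hn w w.2)
      rw [e]
      refine ((continuous_coord _).comp hc).mul (Continuous.inv₀
        (((continuous_coord _).comp hc).pow _) fun u => ?_)
      exact pow_ne_zero _ (coord_ne_zero h hm hτ u)
    exact continuous_id_iff_le.1 this
  · refine ext_coord fun w => ?_
    rw [coord_eq_div h hm hτ a w (hn w w.2), coord_eq_div h hm hτ b w (hn w w.2), e]
  · have : Set.range (restrict h) = {u | coord (⟨m, hm⟩ : Fan.S σ) u ≠ 0} :=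
      Set.ext fun u => mem_range_restrict_iff h hm hτ u
    rw [this]
    exact isOpen_ne.preimage (continuous_coord _)

end KPChart

namespace KP

open KPChart

/-- The inclusion of `N_ℝ(σ)` in `N_ℝ(Δ)`. -/
def incl (σ : Δ.Cone) (u : KPChart σ) : KP Δ := mk σ u

theorem exists_eq_incl (x : KP Δ) : ∃ (σ : Δ.Cone) (a : KPChart σ), x = incl σ a := by
  induction x using Quot.ind with
  | mk a => exact ⟨a.1, a.2, rfl⟩

/-- Two points of `N_ℝ(σ)` and `N_ℝ(τ)` are glued if and only if they come from a point of
`N_ℝ(σ ∩ τ)`. -/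
theorem incl_eq_incl_iff {σ τ : Δ.Cone} {a : KPChart σ} {b : KPChart τ} :
    incl σ a = incl τ b ↔ ∃ c : KPChart (Fan.inter σ τ),
      restrict (Fan.inter_le_left σ τ) c = a ∧ restrict (Fan.inter_le_right σ τ) c = b := by
  constructor
  · intro h
    let R : (Σ ρ : Δ.Cone, KPChart ρ) → Prop := fun b => ∃ c : KPChart (Fan.inter σ b.1),
      restrict (Fan.inter_le_left σ b.1) c = a ∧ restrict (Fan.inter_le_right σ b.1) c = b.2
    have hR : ∀ x y : Σ ρ : Δ.Cone, KPChart ρ, (∃ h : x.1 ≤ y.1, y.2 = x.2.restrict h) →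
        R x = R y := by
      rintro ⟨ρ, x⟩ ⟨ρ', y⟩ ⟨hle, hy⟩
      change ρ ≤ ρ' at hle
      change y = restrict hle x at hy
      subst hy
      have hle' : Fan.inter σ ρ ≤ Fan.inter σ ρ' :=
        Fan.le_inter (Fan.inter_le_left σ ρ) ((Fan.inter_le_right σ ρ).trans hle)
      refine propext ⟨?_, ?_⟩
      · rintro ⟨c, h₁, h₂⟩
        exact ⟨restrict hle' c, h₁, congrArg (restrict hle) h₂⟩
      · rintro ⟨c, h₁, h₂⟩
        obtain ⟨m, hm, hρ⟩ := Fan.isFace_of_le hle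
        have hinter : ∀ u, u ∈ (Fan.inter σ ρ).1 ↔ u ∈ (Fan.inter σ ρ').1 ∧ u m = 0 := fun u =>
          ⟨fun hu => ⟨hle' hu, ((hρ u).1 hu.2).2⟩, fun hu => ⟨hu.1.1, (hρ u).2 ⟨hu.1.2, hu.2⟩⟩⟩
        obtain ⟨c', rfl⟩ := (mem_range_restrict_iff hle'
          (Fan.S_anti (Fan.inter_le_right σ ρ') hm) hinter c).2 (by
            have := coord_ne_zero hle hm hρ x
            rw [← coord_restrict hle x ⟨m, hm⟩] at this
            change coord (⟨m, hm⟩ : Fan.S ρ') (restrict (Fan.inter_le_right σ ρ') c) ≠ 0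
            rw [h₂]
            exact this)
        exact ⟨c', h₁, (isOpenEmbedding_restrict hle).injective h₂⟩
    have e : Quot.lift R hR (incl σ a) = Quot.lift R hR (incl τ b) := congrArg _ h
    change R ⟨σ, a⟩ = R ⟨τ, b⟩ at e
    change R ⟨τ, b⟩
    rw [← e]
    have hσ : σ ≤ Fan.inter σ σ := Fan.le_inter le_rfl le_rfl
    exact ⟨restrict hσ a, rfl, rfl⟩
  · rintro ⟨c, rfl, rfl⟩
    exact (mk_restrict _ c).trans (mk_restrict _ c).symm

theorem continuous_incl (σ : Δ.Cone) : Continuous (incl σ) :=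
  continuous_quot_mk.comp continuous_sigmaMk

theorem isOpen_iff {W : Set (KP Δ)} : IsOpen W ↔ ∀ σ : Δ.Cone, IsOpen (incl σ ⁻¹' W) :=
  isOpen_coinduced.trans isOpen_sigma_iff

theorem isOpenMap_incl (σ : Δ.Cone) : IsOpenMap (incl σ) := by
  intro V hV
  refine isOpen_iff.2 fun τ => ?_
  have : incl τ ⁻¹' (incl σ '' V) =
      restrict (Fan.inter_le_right σ τ) '' (restrict (Fan.inter_le_left σ τ) ⁻¹' V) := by
    ext b
    constructor
    · rintro ⟨a, ha, h⟩
      obtain ⟨c, rfl, rfl⟩ := incl_eq_incl_iff.1 (show incl σ a = incl τ b from h)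
      exact ⟨c, ha, rfl⟩
    · rintro ⟨c, hc, rfl⟩
      exact ⟨_, hc, incl_eq_incl_iff.2 ⟨c, rfl, rfl⟩⟩
  rw [this]
  exact (isOpenEmbedding_restrict _).isOpenMap _ (hV.preimage (continuous_restrict _))

/-- For a character `m` separating `σ` and `τ`, the gluing of `N_ℝ(σ)` and `N_ℝ(τ)` is described by
the equations `a(w) + n b(m) = b(w + n m)` for `w ∈ S_σ`, together with `a(-m) + b(m) = 0`; they
define a closed subset of `N_ℝ(σ) × N_ℝ(τ)`. -/
theorem isClosed_setOf_incl_eq_incl [Module.Free ℤ M] [Module.Finite ℤ M] (σ τ : Δ.Cone) :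
    IsClosed {p : KPChart σ × KPChart τ | incl σ p.1 = incl τ p.2} := by
  obtain ⟨m, hm, hneg, hτ⟩ := Fan.exists_separating σ τ
  have hle := Fan.inter_le_right σ τ
  have hle' := Fan.inter_le_left σ τ
  choose! n hn using exists_nsmul hm hτ
  have hn' : ∀ w : Fan.S σ, (w : M) + n w • m ∈ Fan.S τ := fun w => hn w (Fan.S_anti hle' w.2)
  have : {p : KPChart σ × KPChart τ | incl σ p.1 = incl τ p.2} =
      {p | coord (⟨-m, hneg⟩ : Fan.S σ) p.1 * coord (⟨m, hm⟩ : Fan.S τ) p.2 = 1} ∩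
        ⋂ w : Fan.S σ, {p | coord w p.1 * coord (⟨m, hm⟩ : Fan.S τ) p.2 ^ n w =
          coord (⟨_, hn' w⟩ : Fan.S τ) p.2} := by
    ext ⟨a, b⟩
    simp only [Set.mem_ofPred_eq, Set.mem_inter_iff, Set.mem_iInter]
    rw [incl_eq_incl_iff]
    constructor
    · rintro ⟨c, rfl, rfl⟩
      refine ⟨?_, fun w => ?_⟩
      · rw [coord_restrict, coord_restrict, ← coord_add]
        have e : (⟨-m, Fan.S_anti hle' hneg⟩ + ⟨m, Fan.S_anti hle hm⟩ :
            Fan.S (Fan.inter σ τ)) = 0 := Subtype.ext (neg_add_cancel m)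
        exact (congrArg (fun w => coord w c) e).trans
          ((congrArg expNeg (map_zero c.toHom)).trans expNeg_zero)
      · rw [coord_restrict, coord_restrict, coord_restrict, ← coord_nsmul, ← coord_add]
        rfl
    · rintro ⟨h₁, h₂⟩
      have h0 : coord (⟨m, hm⟩ : Fan.S τ) b ≠ 0 := right_ne_zero_of_mul_eq_one h₁
      obtain ⟨c, rfl⟩ := (mem_range_restrict_iff hle hm hτ b).2 h0
      refine ⟨c, ext_coord fun w => ?_, rfl⟩
      rw [coord_restrict, coord_eq_div hle hm hτ c ⟨w, Fan.S_anti hle' w.2⟩ (hn' w), ← h₂ w,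
        mul_assoc, mul_inv_cancel₀ (pow_ne_zero _ h0), mul_one]
  rw [this]
  have c₁ : ∀ w : Fan.S σ, Continuous fun p : KPChart σ × KPChart τ => coord w p.1 := fun w =>
    (continuous_coord w).comp continuous_fst
  have c₂ : ∀ w : Fan.S τ, Continuous fun p : KPChart σ × KPChart τ => coord w p.2 := fun w =>
    (continuous_coord w).comp continuous_snd
  exact (isClosed_eq ((c₁ _).mul (c₂ _)) continuous_const).inter
    (isClosed_iInter fun w => isClosed_eq ((c₁ w).mul ((c₂ _).pow _)) (c₂ _))

/-- `N_ℝ(Δ)` is Hausdorff, because its charts are open and the gluing relation between any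
two of them is closed. -/
instance t2Space [Module.Free ℤ M] [Module.Finite ℤ M] : T2Space (KP Δ) where
  t2 x y hxy := by
    obtain ⟨σ, a, rfl⟩ := exists_eq_incl x
    obtain ⟨τ, b, rfl⟩ := exists_eq_incl y
    obtain ⟨U, V, hU, hV, ha, hb, h⟩ := isOpen_prod_iff.1
      (isClosed_setOf_incl_eq_incl σ τ).isOpen_compl a b hxy
    refine ⟨_, _, isOpenMap_incl σ U hU, isOpenMap_incl τ V hV, ⟨a, ha, rfl⟩, ⟨b, hb, rfl⟩, ?_⟩
    refine Set.disjoint_left.2 ?_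
    rintro _ ⟨a', ha', rfl⟩ ⟨b', hb', e⟩
    exact h (Set.mk_mem_prod ha' hb') e.symm

end KP

end KajiwaraPayne

/-! ### Points of the Kato fan of a toric variety -/

theorem MSpec.map_comp {P : Type u} {P' : Type v} {Q : Type w} [CommMonoid P] [CommMonoid P']
    [CommMonoid Q] (f : P →* P') (g : P' →* Q) :
    (MSpec.map g).comp (MSpec.map f) = MSpec.map (g.comp f) := by
  refine MonoidalSpace.Hom.ext rfl (heq_of_eq (funext fun q => MonoidHom.ext fun a => ?_))
  obtain ⟨a, rfl⟩ := toStalk_surjective _ a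
  refine Eq.trans ?_ (map_toStalk (g.comp f) q a).symm
  refine Eq.trans ?_ (map_toStalk g q (f a))
  exact congrArg ((MSpec.map g).stalkMap q) (map_toStalk f (PrimeIdeal.comap g q) a)

theorem RNonneg.eq_one_of_isUnit (q : RNonneg) (h : IsUnit q) : q = 1 := by
  obtain ⟨r, hr⟩ := h.exists_right_inv
  have : Multiplicative.toAdd q + Multiplicative.toAdd r = 0 := congrArg Multiplicative.toAdd hr
  exact Multiplicative.toAdd.injective (add_eq_zero.1 this).1

section Atlas

variable {k : Type u} [Field k] {M : Type u} [AddCommGroup M] {Δ : Fan M} {F : MonoidalSpace.{u}}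
  {φ : MonoidalSpace.Hom (charSpace (toricLog k Δ)) F}
  {j : ∀ σ : Δ.Cone, MonoidalSpace.Hom (MSpec (Multiplicative (Fan.S σ))) F}
  {Q : Type v} [CommMonoid Q]

namespace IsToricAtlas

theorem exists_isOpenImmersion (hA : IsToricAtlas φ j) (y : F.carrier) :
    ∃ (P : Type u) (_ : CommMonoid P) (j : MonoidalSpace.Hom (MSpec P) F),
      j.IsOpenImmersion ∧ y ∈ Set.range j.base := by
  obtain ⟨σ, hσ⟩ := hA.cover y
  exact ⟨_, _, j σ, hA.isOpenImmersion σ, hσ⟩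

theorem ofHom_inclS (hA : IsToricAtlas φ j) {τ σ : Δ.Cone} (h : τ ≤ σ)
    (g : Multiplicative (Fan.S τ) →* Q) :
    Points.ofHom (j σ) (g.comp (Fan.inclS h)) = Points.ofHom (j τ) g := by
  rw [← hA.map_comp h, Points.ofHom, ← MSpec.map_comp]
  rfl

theorem exists_eq_ofHom_of_mem (hA : IsToricAtlas φ j) (hQ : ∀ q : Q, IsUnit q → q = 1)
    {σ : Δ.Cone} {u : Points F Q} (h : u.base (PrimeIdeal.closedPoint Q) ∈ Set.range (j σ).base) :
    ∃ g, u = Points.ofHom (j σ) g := by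
  obtain ⟨p, hp⟩ := h
  obtain ⟨g, hg, -⟩ := exists_eq_ofHom hA.exists_isOpenImmersion hQ (hA.isOpenImmersion σ) u p hp.symm
  exact ⟨g, hg⟩

theorem exists_eq_ofHom (hA : IsToricAtlas φ j) (hQ : ∀ q : Q, IsUnit q → q = 1)
    (u : Points F Q) : ∃ σ g, u = Points.ofHom (j σ) g := by
  obtain ⟨σ, hσ⟩ := hA.cover (u.base (PrimeIdeal.closedPoint Q))
  exact ⟨σ, hA.exists_eq_ofHom_of_mem hQ hσ⟩

/-- Homomorphisms on `S_σ` and `S_τ` that define the same point of `F` come from a homomorphism on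
`S_{σ ∩ τ}`. -/
theorem exists_of_ofHom_eq (hA : IsToricAtlas φ j) (hQ : ∀ q : Q, IsUnit q → q = 1)
    {σ τ : Δ.Cone} {g : Multiplicative (Fan.S σ) →* Q} {g' : Multiplicative (Fan.S τ) →* Q}
    (h : Points.ofHom (j σ) g = Points.ofHom (j τ) g') :
    ∃ c : Multiplicative (Fan.S (Fan.inter σ τ)) →* Q,
      g = c.comp (Fan.inclS (Fan.inter_le_left σ τ)) ∧
      g' = c.comp (Fan.inclS (Fan.inter_le_right σ τ)) := by
  have h₁ : (Points.ofHom (j σ) g).base (PrimeIdeal.closedPoint Q) ∈ Set.range (j σ).base :=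
    ⟨_, rfl⟩
  have h₂ : (Points.ofHom (j σ) g).base (PrimeIdeal.closedPoint Q) ∈ Set.range (j τ).base := by
    rw [h]
    exact ⟨_, rfl⟩
  obtain ⟨c, hc⟩ := hA.exists_eq_ofHom_of_mem hQ (hA.inter h₁ h₂)
  refine ⟨c, ofHom_injective hQ (hA.isOpenImmersion σ) ?_,
    ofHom_injective hQ (hA.isOpenImmersion τ) ?_⟩
  · rw [hA.ofHom_inclS, hc]
  · rw [hA.ofHom_inclS, ← h, hc]

/-- A compatible family of maps on the cones `Hom(S_σ, Q)` glues to a map on `Hom(Spec Q, F)`. -/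
theorem exists_desc (hA : IsToricAtlas φ j) (hQ : ∀ q : Q, IsUnit q → q = 1) {Y : Type w}
    (f : ∀ σ : Δ.Cone, (Multiplicative (Fan.S σ) →* Q) → Y)
    (hf : ∀ {τ σ : Δ.Cone} (h : τ ≤ σ) (g : Multiplicative (Fan.S τ) →* Q),
      f σ (g.comp (Fan.inclS h)) = f τ g) :
    ∃ f' : Points F Q → Y, ∀ σ g, f' (Points.ofHom (j σ) g) = f σ g := by
  choose σ g hg using hA.exists_eq_ofHom hQ
  have key : ∀ (σ τ : Δ.Cone) (g : Multiplicative (Fan.S σ) →* Q)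
      (g' : Multiplicative (Fan.S τ) →* Q),
      Points.ofHom (j σ) g = Points.ofHom (j τ) g' → f σ g = f τ g' := by
    intro σ τ g g' h
    obtain ⟨c, rfl, rfl⟩ := hA.exists_of_ofHom_eq hQ h
    rw [hf, hf]
  exact ⟨fun u => f (σ u) (g u), fun τ g' => key _ _ _ _ (hg _).symm⟩

section Topology

attribute [local instance] pointwiseTopology

variable [TopologicalSpace Q]

theorem continuous_ofHom (hA : IsToricAtlas φ j) (σ : Δ.Cone) :
    Continuous (Points.ofHom (j σ) : (Multiplicative (Fan.S σ) →* Q) → Points F Q) :=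
  continuous_def.2 fun _ hW => hW _ _ (j σ) (hA.isOpenImmersion σ)

/-- The weak topology is determined by the charts of an atlas. -/
theorem continuous_of_comp_ofHom (hA : IsToricAtlas φ j) (hQ : ∀ q : Q, IsUnit q → q = 1)
    {Y : Type w} [TopologicalSpace Y] {f : Points F Q → Y}
    (hf : ∀ σ, Continuous fun g : Multiplicative (Fan.S σ) →* Q => f (Points.ofHom (j σ) g)) :
    Continuous f := by
  refine continuous_def.2 fun W hW P _ i hi => ?_
  obtain ⟨σ, p, hp⟩ := hA.cover (i.base (PrimeIdeal.closedPoint P))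
  obtain ⟨θ, hθ⟩ := exists_reparametrization (Q := Q) hA.exists_isOpenImmersion hQ
    (hA.isOpenImmersion σ) i p hp.symm
  choose γ hγ hγ' using hθ
  have hc : Continuous γ := by
    refine continuous_induced_rng.2 (continuous_pi fun a => ?_)
    have : (fun g : P →* Q => γ g a) = fun g => g (θ a) := funext fun g => hγ' g a
    change Continuous fun g : P →* Q => γ g a
    rw [this]
    exact (continuous_apply (θ a)).comp continuous_induced_dom
  have e : Points.ofHom i ⁻¹' (f ⁻¹' W) = (fun g => f (Points.ofHom (j σ) (γ g))) ⁻¹' W := by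
    ext g
    change f _ ∈ W ↔ f _ ∈ W
    rw [hγ]
  rw [e]
  exact hW.preimage ((hf σ).comp hc)

end Topology

end IsToricAtlas

end Atlas

/-! ### The cone complex is the fan -/

section Cone

variable {M : Type u} [AddCommGroup M] {Δ : Fan M}

/-- The pairing of `u ∈ σ` with `S_σ`, as a homomorphism to `ℝ_{≥ 0}`. -/
noncomputable def Fan.pairing (σ : Δ.Cone) (u : σ.1) : Multiplicative (Fan.S σ) →* RNonneg where
  toFun m := .ofAdd ⟨u.1 (m.toAdd : M), m.toAdd.2 u u.2⟩
  map_one' := congrArg Multiplicative.ofAdd (NNReal.eq (map_zero u.1))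
  map_mul' _ _ := congrArg Multiplicative.ofAdd (NNReal.eq (map_add u.1 _ _))

theorem Fan.coe_pairing (σ : Δ.Cone) (u : σ.1) (m : Multiplicative (Fan.S σ)) :
    ((Fan.pairing σ u m).toAdd : ℝ) = u.1 (m.toAdd : M) := rfl

/-- Every homomorphism `S_σ → ℝ_{≥0}` is evaluation at a point of `σ`: it extends to `M`, since `S_σ`
generates `M`, and the extension lies in `σ` by biduality. -/
theorem Fan.exists_eq_pairing (σ : Δ.Cone) (g : Multiplicative (Fan.S σ) →* RNonneg) :
    ∃ u : σ.1, g = Fan.pairing σ u := by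
  obtain ⟨m, hm, hn⟩ := Fan.exists_add_nsmul_mem_S σ
  let g' : Fan.S σ →+ ℝ := (NNReal.toRealHom : NNReal →+ ℝ).comp (AddMonoidHom.toMultiplicative.symm g)
  obtain ⟨v, hv⟩ := exists_extend_of_isAddUnit (B := ⊤) le_top hm (fun w _ => hn w) g'
    (AddGroup.isAddUnit _)
  let u : NR M := v.comp (AddSubmonoid.topEquiv (M := M)).symm.toAddMonoidHom
  have hu : ∀ a : Fan.S σ, u a = ((g (.ofAdd a)).toAdd : NNReal) := hv
  refine ⟨⟨u, (Fan.mem_iff σ).2 fun a ha => ?_⟩, MonoidHom.ext fun a => ?_⟩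
  · rw [hu ⟨a, ha⟩]
    exact NNReal.coe_nonneg _
  · exact congrArg Multiplicative.ofAdd (NNReal.eq (hu a.toAdd).symm)

theorem Fan.pairing_injective (σ : Δ.Cone) : Function.Injective (Fan.pairing σ) := by
  intro u v h
  obtain ⟨m, hm, hn⟩ := Fan.exists_add_nsmul_mem_S σ
  have key : ∀ a : Fan.S σ, u.1 a = v.1 a := fun a =>
    congrArg (fun g : Multiplicative (Fan.S σ) →* RNonneg => ((g (.ofAdd a)).toAdd : ℝ)) h
  refine Subtype.ext (AddMonoidHom.ext fun w => ?_)
  obtain ⟨n, hw⟩ := hn w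
  have e := key ⟨_, hw⟩
  simp only [map_add, map_nsmul] at e
  rw [key ⟨m, hm⟩] at e
  exact add_right_cancel e

theorem Fan.pairing_comp_inclS {τ σ : Δ.Cone} (h : τ ≤ σ) (u : τ.1) :
    (Fan.pairing τ u).comp (Fan.inclS h) = Fan.pairing σ ⟨u.1, h u.2⟩ := rfl

theorem Fan.isClosed_cone (σ : Δ.Cone) : IsClosed (σ.1 : Set (NR M)) := by
  have : (σ.1 : Set (NR M)) = ⋂ m ∈ Fan.S σ, {u | 0 ≤ u m} := by
    ext u
    simp only [SetLike.mem_coe, Set.mem_iInter, Set.mem_ofPred_eq]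
    exact Fan.mem_iff σ
  rw [this]
  exact isClosed_biInter fun m _ =>
    isClosed_le continuous_const ((continuous_apply m).comp continuous_induced_dom)

variable {k : Type u} [Field k] {F : MonoidalSpace.{u}}
  {φ : MonoidalSpace.Hom (charSpace (toricLog k Δ)) F}
  {j : ∀ σ : Δ.Cone, MonoidalSpace.Hom (MSpec (Multiplicative (Fan.S σ))) F}

attribute [local instance] pointwiseTopology in
/-- The identification of the cone complex with the support of the fan: it sends the point of
`Hom(S_σ, ℝ_{≥ 0})` given by the pairing with `u ∈ σ` to `u`. -/
theorem IsToricAtlas.exists_homeomorph (hA : IsToricAtlas φ j) :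
    ∃ e : ConeComplex F ≃ₜ Δ.support,
      ∀ (σ : Δ.Cone) (u : σ.1), (e (Points.ofHom (j σ) (Fan.pairing σ u)) : NR M) = u.1 := by
  have hQ := RNonneg.eq_one_of_isUnit
  choose ε hε using fun σ : Δ.Cone => Fan.exists_eq_pairing σ
  obtain ⟨f, hf⟩ := hA.exists_desc hQ (Y := Δ.support)
    (fun σ g => ⟨(ε σ g).1, σ.1, σ.2, (ε σ g).2⟩) (fun {τ σ} h g => by
      have := hε σ (g.comp (Fan.inclS h))
      conv_lhs at this => rw [hε τ g]
      rw [Fan.pairing_comp_inclS] at this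
      exact Subtype.ext (congrArg (fun u : σ.1 => u.1) (Fan.pairing_injective σ this).symm))
  have hf' : ∀ (σ : Δ.Cone) (u : σ.1), (f (Points.ofHom (j σ) (Fan.pairing σ u)) : NR M) = u.1 := by
    intro σ u
    rw [hf]
    exact congrArg Subtype.val (Fan.pairing_injective σ (hε σ (Fan.pairing σ u))).symm
  have hpt : ∀ u : ConeComplex F, ∃ (σ : Δ.Cone) (v : σ.1),
      u = Points.ofHom (j σ) (Fan.pairing σ v) := fun u => by
    obtain ⟨σ, g, rfl⟩ := hA.exists_eq_ofHom hQ u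
    obtain ⟨v, rfl⟩ := Fan.exists_eq_pairing σ g
    exact ⟨σ, v, rfl⟩
  have hbij : Function.Bijective f := by
    constructor
    · intro x y hxy
      obtain ⟨σ, u, rfl⟩ := hpt x
      obtain ⟨τ, v, rfl⟩ := hpt y
      have e : u.1 = v.1 := by rw [← hf' σ u, ← hf' τ v, hxy]
      have hv : u.1 ∈ (Fan.inter σ τ).1 := ⟨u.2, e ▸ v.2⟩
      have e₁ := hA.ofHom_inclS (Fan.inter_le_left σ τ) (Fan.pairing _ ⟨u.1, hv⟩)
      have e₂ := hA.ofHom_inclS (Fan.inter_le_right σ τ) (Fan.pairing _ ⟨u.1, hv⟩)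
      rw [Fan.pairing_comp_inclS] at e₁ e₂
      have e₃ : v = ⟨u.1, hv.2⟩ := Subtype.ext e.symm
      rw [e₃]
      exact e₁.trans e₂.symm
    · rintro ⟨u, σ, hσ, hu⟩
      exact ⟨Points.ofHom (j ⟨σ, hσ⟩) (Fan.pairing ⟨σ, hσ⟩ ⟨u, hu⟩),
        Subtype.ext (hf' ⟨σ, hσ⟩ ⟨u, hu⟩)⟩
  let E : ConeComplex F ≃ Δ.support := Equiv.ofBijective f hbij
  refine ⟨⟨E, ?_, ?_⟩, hf'⟩
  · refine continuous_induced_rng.2 (continuous_induced_rng.2 (continuous_pi fun w => ?_))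
    refine hA.continuous_of_comp_ofHom hQ fun σ => ?_
    obtain ⟨m, hm, hn⟩ := Fan.exists_add_nsmul_mem_S σ
    obtain ⟨n, hw⟩ := hn w
    have e : (fun g : Multiplicative (Fan.S σ) →* RNonneg =>
        (f (Points.ofHom (j σ) g) : NR M) w) = fun g =>
        (((g (.ofAdd ⟨_, hw⟩)).toAdd : NNReal) : ℝ) - n • ((g (.ofAdd ⟨m, hm⟩)).toAdd : ℝ) := by
      funext g
      obtain ⟨u, rfl⟩ := Fan.exists_eq_pairing σ g
      rw [hf', Fan.coe_pairing, Fan.coe_pairing]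
      change u.1 w = u.1 (w + n • m) - n • u.1 m
      rw [map_add, map_nsmul, add_sub_cancel_right]
    change Continuous fun g : Multiplicative (Fan.S σ) →* RNonneg =>
        (f (Points.ofHom (j σ) g) : NR M) w
    rw [e]
    have hc : ∀ a : Multiplicative (Fan.S σ), Continuous
        fun g : Multiplicative (Fan.S σ) →* RNonneg => ((g a).toAdd : ℝ) := fun a =>
      NNReal.continuous_coe.comp (continuous_toAdd.comp
        ((continuous_apply a).comp continuous_induced_dom))
    exact (hc _).sub ((hc _).const_smul n)
  · have : Finite Δ.Cone := Δ.finite.to_subtype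
    refine (locallyFinite_of_finite fun σ : Δ.Cone => {u : Δ.support | u.1 ∈ σ.1}).continuous
      ?_ (fun σ => (Fan.isClosed_cone σ).preimage continuous_subtype_val) fun σ => ?_
    · refine Set.eq_univ_of_forall fun u => Set.mem_iUnion.2 ?_
      obtain ⟨σ, hσ, hu⟩ := u.2
      exact ⟨⟨σ, hσ⟩, hu⟩
    · rw [continuousOn_iff_continuous_domRestrict]
      have e : Set.domRestrict {u : Δ.support | u.1 ∈ σ.1} E.symm = fun u =>
          Points.ofHom (j σ) (Fan.pairing σ ⟨u.1.1, u.2⟩) := by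
        funext u
        exact E.symm_apply_eq.2 (Subtype.ext (hf' σ ⟨u.1.1, u.2⟩).symm)
      change Continuous (Set.domRestrict {u : Δ.support | u.1 ∈ σ.1} E.symm)
      rw [e]
      refine (hA.continuous_ofHom σ).comp (continuous_induced_rng.2 (continuous_pi fun a => ?_))
      refine continuous_ofAdd.comp (continuous_induced_rng.2 ?_)
      have hc : Continuous fun u : NR M => u (a.toAdd : M) :=
        (continuous_apply (a.toAdd : M)).comp continuous_induced_dom
      have hc' : Continuous fun u : {u : Δ.support | u.1 ∈ σ.1} => u.1.1 (a.toAdd : M) :=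
        hc.comp (continuous_subtype_val.comp continuous_subtype_val)
      exact hc'

end Cone

/-! ### The extended cone complex is the closure of the fan -/

theorem ennrealToTop_top : ennrealToTop ⊤ = ⊤ := rfl

theorem ennrealToTop_coe (r : NNReal) : ennrealToTop r = ((r : ℝ) : WithTop ℝ) := rfl

theorem strictMono_ennrealToTop : StrictMono ennrealToTop := by
  intro x y h
  induction x using ENNReal.recTopCoe with
  | top => exact absurd h not_top_lt
  | coe x =>
    induction y using ENNReal.recTopCoe with
    | top => exact WithTop.coe_lt_top _
    | coe y => exact WithTop.coe_lt_coe.2 (NNReal.coe_lt_coe.2 (ENNReal.coe_lt_coe.1 h))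

theorem range_ennrealToTop : Set.range ennrealToTop = Set.Ici 0 := by
  ext x
  constructor
  · rintro ⟨y, rfl⟩
    have := strictMono_ennrealToTop.monotone (zero_le : 0 ≤ y)
    rwa [map_zero] at this
  · intro hx
    induction x using WithTop.recTopCoe with
    | top => exact ⟨⊤, rfl⟩
    | coe x => exact ⟨ENNReal.ofNNReal ⟨x, WithTop.coe_nonneg.1 hx⟩, rfl⟩

theorem continuous_ennrealToTop : Continuous ennrealToTop :=
  (strictMono_ennrealToTop.isEmbedding_of_ordConnected
    (by rw [range_ennrealToTop]; exact Set.ordConnected_Ici)).continuous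

theorem ConeComplex.toExt_ofHom {F : MonoidalSpace.{u}} {P : Type u} [CommMonoid P]
    (j : MonoidalSpace.Hom (MSpec P) F) (g : P →* RNonneg) :
    ConeComplex.toExt (Points.ofHom j g) = Points.ofHom j
      ((AddMonoidHom.toMultiplicative ENNReal.ofNNRealHom.toAddMonoidHom).comp g) :=
  congrArg (fun h => MonoidalSpace.Hom.comp h j) (MSpec.map_comp g
    (AddMonoidHom.toMultiplicative ENNReal.ofNNRealHom.toAddMonoidHom))

attribute [local instance] pointwiseTopology in
instance compactSpace_monoidHom_rBar (P : Type u) [CommMonoid P] : CompactSpace (P →* RBar) := by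
  have : T2Space RBar := inferInstanceAs (T2Space ENNReal)
  have h : Topology.IsClosedEmbedding fun (g : P →* RBar) (p : P) => g p :=
    ⟨⟨⟨rfl⟩, DFunLike.coe_injective⟩, MonoidHom.isClosed_range_coe P RBar⟩
  exact h.compactSpace

section Extended

variable {M : Type u} [AddCommGroup M] {Δ : Fan M}

/-- A homomorphism `S_σ → [0, ∞]` as a point of `N_ℝ(σ)`. -/
noncomputable def KPChart.ofRBar (σ : Δ.Cone) (g : Multiplicative (Fan.S σ) →* RBar) : KPChart σ :=
  ennrealToTop.comp (AddMonoidHom.toMultiplicative.symm g)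

theorem KPChart.ofRBar_injective (σ : Δ.Cone) : Function.Injective (ofRBar σ) := by
  intro g g' h
  refine MonoidHom.ext fun m => Multiplicative.toAdd.injective ?_
  exact strictMono_ennrealToTop.injective (expNeg_injective (congrArg (coord m.toAdd) h))

theorem KPChart.exists_eq_ofRBar {σ : Δ.Cone} {c : KPChart σ} (h : ∀ m, 0 ≤ c.toHom m) :
    ∃ g, c = ofRBar σ g := by
  have h' : ∀ m, ∃ r, ennrealToTop r = c.toHom m := fun m => by
    change _ ∈ Set.range ennrealToTop
    rw [range_ennrealToTop]
    exact h m
  choose r hr using h'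
  refine ⟨AddMonoidHom.toMultiplicative
    { toFun := r
      map_zero' := strictMono_ennrealToTop.injective (by rw [hr, map_zero, map_zero])
      map_add' := fun a b => strictMono_ennrealToTop.injective (by
        rw [map_add, hr, hr, hr, map_add]) }, ?_⟩
  exact ext_coord fun m => congrArg expNeg (hr m).symm

attribute [local instance] pointwiseTopology in
theorem KP.continuous_ofRBar (σ : Δ.Cone) : Continuous (KP.ofRBar σ) := by
  refine (KP.continuous_incl σ).comp (f := KPChart.ofRBar σ) (KPChart.continuous_iff.2 fun m => ?_)
  exact isEmbedding_expNeg.continuous.comp (continuous_ennrealToTop.comp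
    (continuous_toAdd.comp ((continuous_apply (Multiplicative.ofAdd m)).comp
      continuous_induced_dom)))

theorem KP.ofRBar_comp_inclS {τ σ : Δ.Cone} (h : τ ≤ σ) (g : Multiplicative (Fan.S τ) →* RBar) :
    KP.ofRBar σ (g.comp (Fan.inclS h)) = KP.ofRBar τ g :=
  KP.mk_restrict h (KPChart.ofRBar τ g)

/-- On a cone `σ`, the embedding of `N_ℝ` into `N_ℝ(Δ)` is the pairing of `σ` with `S_σ`. -/
theorem KP.ofNR_eq (σ : Δ.Cone) (u : σ.1) : KP.ofNR Δ u.1 = KP.ofRBar σ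
    ((AddMonoidHom.toMultiplicative ENNReal.ofNNRealHom.toAddMonoidHom).comp (Fan.pairing σ u)) :=
  (KP.mk_restrict (Fan.zeroCone_le σ) _).symm

/-- If the gluing of a point of `N_ℝ(σ)` and a point of `N_ℝ(τ)` has nonnegative coordinates on both
charts, then it has nonnegative coordinates on `N_ℝ(σ ∩ τ)`, because `S_{σ ∩ τ} = S_σ + S_τ`. -/
theorem KP.exists_of_ofRBar_eq [Module.Free ℤ M] [Module.Finite ℤ M] {σ τ : Δ.Cone}
    {g : Multiplicative (Fan.S σ) →* RBar} {g' : Multiplicative (Fan.S τ) →* RBar}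
    (h : KP.ofRBar σ g = KP.ofRBar τ g') :
    ∃ c : Multiplicative (Fan.S (Fan.inter σ τ)) →* RBar,
      g = c.comp (Fan.inclS (Fan.inter_le_left σ τ)) ∧
      g' = c.comp (Fan.inclS (Fan.inter_le_right σ τ)) := by
  obtain ⟨c, hc, hc'⟩ := KP.incl_eq_incl_iff.1
    (show KP.incl σ (KPChart.ofRBar σ g) = KP.incl τ (KPChart.ofRBar τ g') from h)
  have h₁ : ∀ w : Fan.S σ, 0 ≤ c.toHom ⟨w, Fan.S_anti (Fan.inter_le_left σ τ) w.2⟩ := fun w => by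
    have e : c.toHom ⟨w, Fan.S_anti (Fan.inter_le_left σ τ) w.2⟩ =
      ennrealToTop (g (.ofAdd w)).toAdd := congrArg (fun a : KPChart σ => a.toHom w) hc
    rw [e]
    exact range_ennrealToTop.subset ⟨_, rfl⟩
  have h₂ : ∀ w : Fan.S τ, 0 ≤ c.toHom ⟨w, Fan.S_anti (Fan.inter_le_right σ τ) w.2⟩ := fun w => by
    have e : c.toHom ⟨w, Fan.S_anti (Fan.inter_le_right σ τ) w.2⟩ =
      ennrealToTop (g' (.ofAdd w)).toAdd := congrArg (fun a : KPChart τ => a.toHom w) hc'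
    rw [e]
    exact range_ennrealToTop.subset ⟨_, rfl⟩
  obtain ⟨m, hm, hneg, hτ⟩ := Fan.exists_separating σ τ
  obtain ⟨d, rfl⟩ := KPChart.exists_eq_ofRBar (c := c) fun w => by
    obtain ⟨n, hn⟩ := KPChart.exists_nsmul hm hτ w w.2
    have e : w = ⟨_, Fan.S_anti (Fan.inter_le_right σ τ) hn⟩ +
        n • (⟨-m, Fan.S_anti (Fan.inter_le_left σ τ) hneg⟩ : Fan.S (Fan.inter σ τ)) :=
      Subtype.ext (by
        change (w : M) = w + n • m + n • (-m)
        rw [smul_neg, add_neg_cancel_right])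
    rw [e, map_add, map_nsmul]
    exact add_nonneg (h₂ ⟨_, hn⟩) (nsmul_nonneg (h₁ ⟨_, hneg⟩) n)
  exact ⟨d, KPChart.ofRBar_injective σ hc.symm, KPChart.ofRBar_injective τ hc'.symm⟩

/-- A cone has a point where only the characters that are trivial on the cone vanish. -/
theorem Fan.exists_relint (τ : Δ.Cone) :
    ∃ v ∈ τ.1, ∀ m ∈ Fan.S τ, v m = 0 → ∀ u ∈ τ.1, u m = 0 := by
  obtain ⟨s, hs, hd, -⟩ := (Δ.rational _ τ.2).exists_generators
  refine ⟨∑ v ∈ s, latticePoint v, Submodule.sum_mem _ hs, fun m hm h u hu => ?_⟩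
  rw [AddMonoidHom.finsetSum_apply] at h
  have h0 := (Finset.sum_eq_zero_iff_of_nonneg fun v hv => hm _ (hs v hv)).1 h
  have hneg : -m ∈ Fan.S τ := (hd _).2 fun v hv => by
    have : v m = 0 := Int.cast_injective (α := ℝ) ((h0 v hv).trans Int.cast_zero.symm)
    rw [map_neg, this, neg_zero]
  have h₁ := hm u hu
  have h₂ := hneg u hu
  rw [map_neg] at h₂
  linarith

/-- Homomorphisms to `ℝ` on a face of `S_σ` extend to `M`. -/
theorem Fan.exists_extend_face {τ σ : Δ.Cone} (h : τ ≤ σ) {A : AddSubmonoid M}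
    (hA : ∀ m, m ∈ A ↔ m ∈ Fan.S σ ∧ ∀ u ∈ τ.1, u m = 0) (g : A →+ ℝ) :
    ∃ u : NR M, ∀ m : A, u m = g m := by
  obtain ⟨m, hm, hτ⟩ := Fan.isFace_of_le h
  let B : AddSubgroup M :=
    { carrier := {w | ∀ u ∈ τ.1, u w = 0}
      zero_mem' := fun u _ => map_zero u
      add_mem' := fun ha hb u hu => by rw [map_add, ha u hu, hb u hu, add_zero]
      neg_mem' := fun ha u hu => by rw [map_neg, ha u hu, neg_zero] }
  have hAB : A ≤ B.toAddSubmonoid := fun w hw => ((hA w).1 hw).2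
  have hmB : ∀ u ∈ τ.1, u m = 0 := fun u hu => ((hτ u).1 hu).2
  obtain ⟨g', hg'⟩ := exists_extend_of_isAddUnit hAB ((hA m).2 ⟨hm, hmB⟩) (fun w hw => by
    obtain ⟨n, hn⟩ := KPChart.exists_nsmul hm hτ w fun u hu => (hw u hu).ge
    exact ⟨n, (hA _).2 ⟨hn, fun u hu => by
      rw [map_add, map_nsmul, hw u hu, hmB u hu, smul_zero, add_zero]⟩⟩) g
    (AddGroup.isAddUnit _)
  obtain ⟨u, hu⟩ := (Module.Baer.of_divisible ℝ).extension_property_addMonoidHom B.subtype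
    B.subtype_injective g'
  exact ⟨u, fun a => (DFunLike.congr_fun hu ⟨a, hAB a.2⟩).trans (hg' a)⟩

/-- A point `g` of `Hom(S_σ, [0, ∞])` is the limit of `h + n v`, where `v` is in the relative
interior of the face of `σ` that corresponds to the prime ideal where `g` is infinite and `h`
extends `g` from the complement of that prime ideal. -/
theorem KP.ofRBar_mem_closure [Module.Finite ℤ M] (σ : Δ.Cone)
    (g : Multiplicative (Fan.S σ) →* RBar) :
    KP.ofRBar σ g ∈ closure (KP.ofNR Δ '' Δ.support) := by
  let p : PrimeIdeal (Multiplicative (Fan.S σ)) :=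
    { carrier := {w | (g w).toAdd = ⊤}
      mul_mem := fun a b hb => by
        change (g (a * b)).toAdd = ⊤
        rw [map_mul, toAdd_mul, show (g b).toAdd = ⊤ from hb, add_top]
      one_notMem := fun h => by
        change (g 1).toAdd = ⊤ at h
        rw [map_one] at h
        exact ENNReal.zero_ne_top h
      mem_or_mem := fun a b h => by
        change (g (a * b)).toAdd = ⊤ at h
        rw [map_mul, toAdd_mul, ENNReal.add_eq_top] at h
        exact h }
  have hp : ∀ w : Fan.S σ, (g (.ofAdd w)).toAdd ≠ ⊤ ↔ ∀ u ∈ (Fan.primeFace p).1, u w = 0 :=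
    fun w => Fan.notMem_iff p (m := .ofAdd w)
  have hle := Fan.primeFace_le p
  let A : AddSubmonoid M :=
    { carrier := {w | w ∈ Fan.S σ ∧ ∀ u ∈ (Fan.primeFace p).1, u w = 0}
      zero_mem' := ⟨zero_mem _, fun u _ => map_zero u⟩
      add_mem' := fun ha hb => ⟨add_mem ha.1 hb.1, fun u hu => by
        rw [map_add, ha.2 u hu, hb.2 u hu, add_zero]⟩ }
  have hA : ∀ w : A, (g (.ofAdd ⟨w, w.2.1⟩)).toAdd ≠ ⊤ := fun w => (hp ⟨w, w.2.1⟩).2 w.2.2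
  obtain ⟨h, hh⟩ := Fan.exists_extend_face hle (A := A) (fun _ => Iff.rfl)
    { toFun := fun w => (g (.ofAdd ⟨w, w.2.1⟩)).toAdd.toReal
      map_zero' := by
        have : g (.ofAdd (0 : Fan.S σ)) = 1 := map_one g
        exact (congrArg (fun q : RBar => q.toAdd.toReal) this).trans ENNReal.toReal_zero
      map_add' := fun a b => by
        have : g (.ofAdd ⟨_, (a + b).2.1⟩) = g (.ofAdd ⟨a, a.2.1⟩) * g (.ofAdd ⟨b, b.2.1⟩) :=
          map_mul g (.ofAdd ⟨a, a.2.1⟩) (.ofAdd ⟨b, b.2.1⟩)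
        rw [this, toAdd_mul, ENNReal.toReal_add (hA a) (hA b)] }
  obtain ⟨v, hv, hv'⟩ := Fan.exists_relint (Fan.primeFace p)
  -- on the characters where `g` is finite, `v` vanishes and `h` agrees with `g`
  have hfin : ∀ w : Fan.S σ, (g (.ofAdd w)).toAdd ≠ ⊤ →
      v w = 0 ∧ ennrealToTop (g (.ofAdd w)).toAdd = ((h w : ℝ) : WithTop ℝ) := by
    intro w hw
    have hw' := (hp w).1 hw
    refine ⟨hw' v hv, ?_⟩
    rw [hh ⟨w, w.2, hw'⟩]
    conv_lhs => rw [← ENNReal.coe_toNNReal hw]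
    rfl
  have hinf : ∀ w : Fan.S σ, (g (.ofAdd w)).toAdd = ⊤ →
      Filter.Tendsto (fun n : ℕ => (h + n • v) w) Filter.atTop Filter.atTop := by
    intro w hw
    have hpos : 0 < v w := by
      refine lt_of_le_of_ne (w.2 v (hle hv)) fun h0 => ?_
      exact (hp w).2 (hv' w (Fan.S_anti hle w.2) h0.symm) hw
    refine (Filter.tendsto_atTop_add_const_left _ (h w)
      (tendsto_natCast_atTop_atTop.atTop_mul_const hpos)).congr fun n => ?_
    rw [AddMonoidHom.add_apply, AddMonoidHom.nsmul_apply, nsmul_eq_mul]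
  have hnonneg : ∀ w : Fan.S σ, ∀ᶠ n : ℕ in Filter.atTop, 0 ≤ (h + n • v) w := by
    intro w
    by_cases hw : (g (.ofAdd w)).toAdd = ⊤
    · exact (hinf w hw).eventually_ge_atTop 0
    · obtain ⟨h₁, h₂⟩ := hfin w hw
      refine Filter.Eventually.of_forall fun n => ?_
      rw [AddMonoidHom.add_apply, AddMonoidHom.nsmul_apply, h₁, smul_zero, add_zero,
        ← WithTop.coe_nonneg, ← h₂]
      exact range_ennrealToTop.subset ⟨_, rfl⟩
  have hmem : ∀ᶠ n : ℕ in Filter.atTop, h + n • v ∈ σ.1 := by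
    obtain ⟨s, hs⟩ := (Δ.rational _ σ.2).dualMonoid_fg
    have hsub : ∀ w ∈ s, w ∈ Fan.S σ := fun w hw => by
      change w ∈ dualMonoid σ.1
      rw [← hs]
      exact AddSubmonoid.subset_closure hw
    have := Filter.eventually_all.2 fun w : s => hnonneg ⟨w, hsub w w.2⟩
    filter_upwards [this] with n hn
    refine (Fan.mem_iff σ).2 fun w hw => ?_
    change w ∈ dualMonoid σ.1 at hw
    rw [← hs] at hw
    induction hw using AddSubmonoid.closure_induction with
    | mem w hw => exact hn ⟨w, hw⟩
    | zero => exact (map_zero (h + n • v)).ge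
    | add a b _ _ ha hb =>
      rw [map_add]
      exact add_nonneg ha hb
  let pt : NR M → KPChart σ := fun u => KPChart.restrict (Fan.zeroCone_le σ)
    (WithTop.addHom.comp (u.comp (Fan.S Δ.zeroCone).subtype) :
      Fan.S Δ.zeroCone →+ WithTop ℝ)
  have hpt : ∀ u : NR M, KP.incl σ (pt u) = KP.ofNR Δ u := fun u => KP.mk_restrict _ _
  have hlim : Filter.Tendsto (fun n : ℕ => pt (h + n • v)) Filter.atTop
      (nhds (KPChart.ofRBar σ g)) := by
    refine (KPChart.isInducing_coord σ).tendsto_nhds_iff.2 (tendsto_pi_nhds.2 fun w => ?_)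
    change Filter.Tendsto (fun n : ℕ => expNeg (((h + n • v) w : ℝ) : WithTop ℝ)) _
      (nhds (expNeg (ennrealToTop (g (.ofAdd w)).toAdd)))
    by_cases hw : (g (.ofAdd w)).toAdd = ⊤
    · rw [hw, ennrealToTop_top, expNeg_eq_zero.2 rfl, ← NNReal.tendsto_coe]
      exact Real.tendsto_exp_neg_atTop_nhds_zero.comp (hinf w hw)
    · obtain ⟨h₁, h₂⟩ := hfin w hw
      refine tendsto_const_nhds.congr fun n => ?_
      rw [h₂, AddMonoidHom.add_apply, AddMonoidHom.nsmul_apply, h₁, smul_zero, add_zero]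
  refine mem_closure_of_tendsto (((KP.continuous_incl σ).tendsto _).comp hlim) ?_
  filter_upwards [hmem] with n hn
  exact ⟨h + n • v, ⟨σ.1, σ.2, hn⟩, (hpt _).symm⟩

variable {k : Type u} [Field k] {F : MonoidalSpace.{u}}
  {φ : MonoidalSpace.Hom (charSpace (toricLog k Δ)) F}
  {j : ∀ σ : Δ.Cone, MonoidalSpace.Hom (MSpec (Multiplicative (Fan.S σ))) F}

attribute [local instance] pointwiseTopology in
theorem IsToricAtlas.compactSpace (hA : IsToricAtlas φ j) : CompactSpace (ExtConeComplex F) := by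
  have : Finite Δ.Cone := Δ.finite.to_subtype
  have : (Set.univ : Set (ExtConeComplex F)) = ⋃ σ, Set.range (Points.ofHom (j σ)) :=
    (Set.eq_univ_of_forall fun u => by
      obtain ⟨σ, g, rfl⟩ := hA.exists_eq_ofHom eq_one_of_isUnit u
      exact Set.mem_iUnion.2 ⟨σ, g, rfl⟩).symm
  refine ⟨?_⟩
  rw [this]
  exact isCompact_iUnion fun σ => isCompact_range (hA.continuous_ofHom σ)

variable [Module.Free ℤ M] [Module.Finite ℤ M]

theorem IsToricAtlas.exists_isClosedEmbedding (hA : IsToricAtlas φ j) :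
    ∃ e : ExtConeComplex F → KP Δ, Topology.IsClosedEmbedding e ∧
      ∀ (σ : Δ.Cone) (g : Multiplicative (Fan.S σ) →* RBar),
        e (Points.ofHom (j σ) g) = KP.ofRBar σ g := by
  obtain ⟨e, he⟩ := hA.exists_desc eq_one_of_isUnit (Y := KP Δ) (fun σ g => KP.ofRBar σ g)
    fun h g => KP.ofRBar_comp_inclS h g
  have := hA.compactSpace
  refine ⟨e, Continuous.isClosedEmbedding ?_ ?_, he⟩
  · refine hA.continuous_of_comp_ofHom eq_one_of_isUnit fun σ => ?_
    simp only [he]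
    exact KP.continuous_ofRBar σ
  · intro x y h
    obtain ⟨σ, g, rfl⟩ := hA.exists_eq_ofHom eq_one_of_isUnit x
    obtain ⟨τ, g', rfl⟩ := hA.exists_eq_ofHom eq_one_of_isUnit y
    rw [he, he] at h
    obtain ⟨c, rfl, rfl⟩ := KP.exists_of_ofRBar_eq h
    rw [hA.ofHom_inclS, hA.ofHom_inclS]

end Extended

/-! ### Tropicalization -/

theorem eq_one_of_negLog_eq_zero {r : NNReal} (h : negLog r = 0) : 1 ≤ r := by
  unfold negLog at h
  by_cases hr : r = 0
  · rw [if_pos hr] at h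
    exact absurd h ENNReal.top_ne_zero
  · rw [if_neg hr, ENNReal.ofReal_eq_zero, neg_nonpos,
      Real.log_nonneg_iff (NNReal.coe_pos.2 (pos_iff_ne_zero.2 hr))] at h
    exact_mod_cast h

theorem ennrealToTop_negLog {r : NNReal} (h : r ≤ 1) : ennrealToTop (negLog r) = negLogTop r := by
  unfold negLog negLogTop
  by_cases hr : r = 0
  · rw [if_pos hr, if_pos hr, ennrealToTop_top]
  · rw [if_neg hr, if_neg hr]
    have : 0 ≤ -Real.log r := neg_nonneg.2 (Real.log_nonpos r.2 (by exact_mod_cast h))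
    refine (ennrealToTop_coe _).trans ?_
    rw [Real.coe_toNNReal _ this]

section Beth

variable {k : Type u} [Field k] {X : Scheme.{u}} {f : X ⟶ Spec (.of k)}

/-- `trop_X(x)` is a local homomorphism on stalks. -/
theorem isUnit_of_isUnit_tropStalk (L : LogStructure X) (x : BethPoint f)
    (a : (charSpace L).stalk x.center) (h : IsUnit (tropStalk L x a)) : IsUnit a := by
  obtain ⟨s, rfl⟩ := Associates.mk_surjective a
  have h₁ : negLog (x.seminorm x.specializes (L.toStructure x.center s)) = 0 :=
    congrArg Multiplicative.toAdd (eq_one_of_isUnit _ h)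
  refine Associates.isUnit_mk.2 ((isUnit_iff_toStructure L _ s).2 ?_)
  by_contra hu
  exact (eq_one_of_negLog_eq_zero h₁).not_gt ((x.lt_one_iff _).2 hu)

end Beth

/-- A germ of a morphism of monoidal spaces is determined by its effect on sections. -/
theorem sigma_stalk_hom_eq_iff {F : MonoidalSpace.{u}} {R : Type v} [CommMonoid R]
    {b b' : F.carrier} {f : F.stalk b →* R} {f' : F.stalk b' →* R} :
    (⟨b, f⟩ : Σ y : F.carrier, F.stalk y →* R) = ⟨b', f'⟩ ↔ b = b' ∧
      ∀ (V : Opens F.carrier) (s : ∀ y : V, F.stalk y), F.sheaf.IsSection V s →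
        ∀ (h : b ∈ V) (h' : b' ∈ V), f (s ⟨b, h⟩) = f' (s ⟨b', h'⟩) := by
  constructor
  · intro e
    obtain ⟨rfl, e⟩ := Sigma.mk.inj e
    obtain rfl := eq_of_heq e
    exact ⟨rfl, fun _ _ _ _ _ => rfl⟩
  · rintro ⟨rfl, e⟩
    refine congrArg (Sigma.mk b) (MonoidHom.ext fun a => ?_)
    obtain ⟨V, hV, s, hs, rfl⟩ := F.sheaf.exists_section b a
    exact e V s hs hV hV

/-- The tropicalization of a point is unique, since a morphism to a Kato fan is determined by its germ
at the closed point. -/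
theorem eq_of_isTrop {k : Type u} [Field k] {X : Scheme.{u}} {f : X ⟶ Spec (.of k)}
    {L : LogStructure X} {F : MonoidalSpace.{u}} {φ : MonoidalSpace.Hom (charSpace L) F}
    (hF : ∀ y : F.carrier, ∃ (P : Type u) (_ : CommMonoid P) (j : MonoidalSpace.Hom (MSpec P) F),
      j.IsOpenImmersion ∧ y ∈ Set.range j.base) {x : BethPoint f} {u v : ExtConeComplex F}
    (hu : IsTrop φ x u) (hv : IsTrop φ x v) : u = v := by
  obtain ⟨hb, h⟩ := sigma_stalk_hom_eq_iff.1 (hu.trans hv.symm)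
  exact hom_ext_of_closedPoint hF hb h

section Toric

variable {k : Type u} [Field k] {M : Type u} [AddCommGroup M] {Δ : Fan M}

theorem seminorm_toricGerm (x : AnPoint (toricStructure k Δ)) {σ : Δ.Cone} {c : toricVariety k Δ}
    (h : x.pt ⤳ c) (hc : c ∈ toricOpen k Δ σ) (hx : x.pt ∈ toricOpen k Δ σ)
    (a : AddMonoidAlgebra k (Fan.S σ)) : x.seminorm h (toricGerm hc a) =
      x.val ((toricVariety k Δ).residue x.pt (toricGerm hx a)) :=
  congrArg (fun z => x.val ((toricVariety k Δ).residue x.pt z))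
    (stalkSpecializes_toricGerm h hc hx a)

/-- A point of the analytification has at most one center: a character separating two cones `σ` and
`τ` whose charts contain centers has absolute value `1`, so that one of the charts contains both
centers, and there the center is given by the functions of absolute value less than `1`. -/
theorem toAnPoint_injective [Module.Free ℤ M] [Module.Finite ℤ M] : Function.Injective
    (BethPoint.toAnPoint : BethPoint (toricStructure k Δ) → AnPoint (toricStructure k Δ)) := by
  rintro ⟨x, c, h, h₁, h₂⟩ ⟨y, c', h', h₁', h₂'⟩ e
  change x = y at e
  subst e
  suffices c = c' by
    subst this
    rfl
  change ∀ a, x.seminorm h a ≤ 1 at h₁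
  change ∀ a, x.seminorm h' a ≤ 1 at h₁'
  change ∀ a, x.seminorm h a < 1 ↔ ¬ IsUnit a at h₂
  change ∀ a, x.seminorm h' a < 1 ↔ ¬ IsUnit a at h₂'
  obtain ⟨σ, hc⟩ := exists_mem_toricOpen k Δ c
  obtain ⟨τ, hc'⟩ := exists_mem_toricOpen k Δ c'
  have hσ : x.pt ∈ toricOpen k Δ σ := h.mem_open (toricOpen k Δ σ).2 hc
  have hτ : x.pt ∈ toricOpen k Δ τ := h'.mem_open (toricOpen k Δ τ).2 hc'
  obtain ⟨m, hm, hneg, hi⟩ := Fan.exists_separating σ τ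
  have hx := toricOpen_inter hσ hτ
  have e₁ := toricGerm_inclusion (Fan.inter_le_left σ τ) hx ⟨-m, hneg⟩
  have e₂ := toricGerm_inclusion (Fan.inter_le_right σ τ) hx ⟨m, hm⟩
  have e₃ : toricGerm hσ (AddMonoidAlgebra.single ⟨-m, hneg⟩ 1) *
      toricGerm hτ (AddMonoidAlgebra.single ⟨m, hm⟩ 1) = 1 := by
    rw [← e₁, ← e₂, ← map_mul, AddMonoidAlgebra.single_mul_single, one_mul, ← map_one (toricGerm hx),
      AddMonoidAlgebra.one_def]
    congr 2
    exact Subtype.ext (neg_add_cancel m)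
  have e₄ : x.seminorm h (toricGerm hc (AddMonoidAlgebra.single ⟨-m, hneg⟩ 1)) *
      x.seminorm h' (toricGerm hc' (AddMonoidAlgebra.single ⟨m, hm⟩ 1)) = 1 := by
    rw [seminorm_toricGerm x h hc hσ, seminorm_toricGerm x h' hc' hτ, ← map_mul, ← map_mul, e₃,
      map_one, map_one]
  have e₅ : ¬ x.seminorm h' (toricGerm hc' (AddMonoidAlgebra.single ⟨m, hm⟩ 1)) < 1 := fun hlt =>
    (mul_lt_one_of_nonneg_of_lt_one_right (h₁ _) zero_le hlt).ne e₄
  rw [h₂', not_not, isUnit_toricGerm_single (Fan.inter_le_right σ τ) hi] at e₅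
  have hc'σ : c' ∈ toricOpen k Δ σ := toricOpen_mono (Fan.inter_le_left σ τ) e₅
  have e₆ : toricPrime hc = toricPrime hc'σ := by
    refine PrimeSpectrum.ext (Ideal.ext fun a => ?_)
    rw [← not_iff_not, ← isUnit_toricGerm, ← isUnit_toricGerm, ← not_iff_not, ← h₂, ← h₂',
      seminorm_toricGerm x h hc hσ, seminorm_toricGerm x h' hc'σ hσ]
  rw [← toricChart_toricPrime hc, ← toricChart_toricPrime hc'σ, e₆]

variable {F : MonoidalSpace.{u}} {φ : MonoidalSpace.Hom (charSpace (toricLog k Δ)) F}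
  {j : ∀ σ : Δ.Cone, MonoidalSpace.Hom (MSpec (Multiplicative (Fan.S σ))) F}

/-- The tropicalization of a point of `X^ℶ` with center in `U_σ` is the point of
`Hom(S_σ, [0, ∞])` that sends `m` to `- log |χ^m|`. -/
theorem IsToricAtlas.exists_isTrop (hA : IsToricAtlas φ j) (x : BethPoint (toricStructure k Δ))
    {σ : Δ.Cone} (hc : x.center ∈ toricOpen k Δ σ) :
    ∃ g : Multiplicative (Fan.S σ) →* RBar, IsTrop φ x (Points.ofHom (j σ) g) ∧
      ∀ m, g m = .ofAdd (negLog
        (x.seminorm x.specializes (toricGerm hc (AddMonoidAlgebra.single m.toAdd 1)))) := by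
  obtain ⟨p, hp⟩ := (hA.mem_range_iff σ x.center).2 hc
  let l₀ : F.stalk (φ.base x.center) →* RBar :=
    (tropStalk (toricLog k Δ) x).comp (φ.stalkMap x.center)
  obtain ⟨l, hl, hl'⟩ : ∃ l : F.stalk ((j σ).base p) →* RBar, (∀ a, IsUnit (l a) → IsUnit a) ∧
      ∀ (V : Opens F.carrier) (s : ∀ y : V, F.stalk y) (h₁ : (j σ).base p ∈ V)
        (h₂ : φ.base x.center ∈ V), l (s ⟨_, h₁⟩) = l₀ (s ⟨_, h₂⟩) := by
    rw [hp]
    exact ⟨l₀, fun a ha => φ.isLocal _ a (isUnit_of_isUnit_tropStalk _ x _ ha),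
      fun _ _ _ _ => rfl⟩
  obtain ⟨g, hg, hgl, hgs⟩ := exists_ofHom_germ (hA.isOpenImmersion σ) p l hl
  have hb : (Points.ofHom (j σ) g).base (PrimeIdeal.closedPoint RBar) = φ.base x.center :=
    (congrArg (j σ).base hg).trans hp
  refine ⟨g, sigma_stalk_hom_eq_iff.2 ⟨hb, fun V s hs h₁ h₂ => ?_⟩, fun m => ?_⟩
  · refine (hgs V s hs (hp ▸ h₂) h₁).trans ?_
    rw [hl' V s _ h₂]
    rfl
  · obtain ⟨V, hV, s, hs, e⟩ := exists_section_toStalk (hA.isOpenImmersion σ).isStrict p m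
    have hV' : φ.base x.center ∈ V := hp ▸ hV
    rw [hgl _ _ e, hl' V s hV hV']
    exact congrArg (tropStalk (toricLog k Δ) x) (hA.stalkMap_eq hc p hp V s hV hV' m e)

theorem tropKP_eq_ofRBar (x : BethPoint (toricStructure k Δ)) {σ : Δ.Cone}
    (hc : x.center ∈ toricOpen k Δ σ) {g : Multiplicative (Fan.S σ) →* RBar}
    (hg : ∀ m, g m = .ofAdd (negLog
      (x.seminorm x.specializes (toricGerm hc (AddMonoidAlgebra.single m.toAdd 1))))) :
    tropKP x.toAnPoint = KP.ofRBar σ g := by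
  have hx : x.pt ∈ toricOpen k Δ σ := x.specializes.mem_open (toricOpen k Δ σ).2 hc
  rw [tropKP_eq x.toAnPoint σ hx]
  refine congrArg (KP.mk σ) (AddMonoidHom.ext fun m => ?_)
  change _ = ennrealToTop (g (.ofAdd m)).toAdd
  rw [hg, toAdd_ofAdd, ennrealToTop_negLog (x.le_one _), seminorm_toricGerm _ _ hc hx]
  rfl

end Toric

end LogTrop

theorem mainTheorem7 (k : Type u) [Field k] (M : Type u) [AddCommGroup M] [Module.Free ℤ M]
    [Module.Finite ℤ M] (Δ : Fan M) :
    (∃ (F : MonoidalSpace.{u}) (φ : MonoidalSpace.Hom (charSpace (toricLog k Δ)) F),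
      IsCharacteristic (toricLog k Δ) φ) ∧
    ∀ (F : MonoidalSpace.{u}) (φ : MonoidalSpace.Hom (charSpace (toricLog k Δ)) F),
      IsCharacteristic (toricLog k Δ) φ →
      ∃ (j : ∀ σ : Δ.Cone, MonoidalSpace.Hom (MSpec (Multiplicative (Fan.S σ))) F)
        (e : ConeComplex F ≃ₜ Δ.support)
        (e' : ExtConeComplex F → KP Δ)
        (trop : BethPoint (toricStructure k Δ) → ExtConeComplex F),
        -- the affine open subsets of `F_X` are the spectra of the monoids `S_σ`
        (∀ σ, (j σ).IsOpenImmersion) ∧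
        (∀ σ, φ.base ⁻¹' Set.range (j σ).base = toricOpen k Δ σ) ∧
        (∀ (P : Type u) (_ : CommMonoid P) (i : MonoidalSpace.Hom (MSpec P) F),
          i.IsOpenImmersion → ∃! σ, Set.range i.base = Set.range (j σ).base) ∧
        -- `Σ_X = Δ`, cone by cone and with the integral structure
        (∀ σ, Set.range (fun g : Multiplicative (Fan.S σ) →* RNonneg =>
          (e (Points.ofHom (j σ) g) : NR M)) = (σ.1 : Set (NR M))) ∧
        (∀ σ (g : Multiplicative (Fan.S σ) →* RNonneg) (m : Fan.S σ),
          (e (Points.ofHom (j σ) g) : NR M) m = (g (.ofAdd m)).toAdd) ∧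
        -- `Σ̄_X` is the closure of `Δ` in `N_ℝ(Δ)`
        Topology.IsEmbedding e' ∧
        Set.range e' = closure (KP.ofNR Δ '' Δ.support) ∧
        (∀ u, e' (ConeComplex.toExt u) = KP.ofNR Δ (e u)) ∧
        (∀ σ (g : Multiplicative (Fan.S σ) →* RBar),
          e' (Points.ofHom (j σ) g) = KP.ofRBar σ g) ∧
        -- `trop_X` is the restriction of `trop_Δ` to `X^ℶ ⊆ X^an`
        (∀ x u, IsTrop φ x u ↔ u = trop x) ∧
        Function.Injective
          (BethPoint.toAnPoint : BethPoint (toricStructure k Δ) → AnPoint (toricStructure k Δ)) ∧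
        ∀ x, e' (trop x) = tropKP x.toAnPoint := by
  refine ⟨⟨Fan.katoFan Δ, toricCharMap k Δ, isCharacteristic_toricCharMap k Δ⟩, fun F φ hφ => ?_⟩
  obtain ⟨j, hA⟩ := exists_isToricAtlas hφ
  obtain ⟨e, he⟩ := hA.exists_homeomorph
  obtain ⟨e', hcl, he'⟩ := hA.exists_isClosedEmbedding
  choose σ hσ using fun x : BethPoint (toricStructure k Δ) => exists_mem_toricOpen k Δ x.center
  choose g hg hg' using fun x : BethPoint (toricStructure k Δ) => hA.exists_isTrop x (hσ x)
  have hext : ∀ u, e' (ConeComplex.toExt u) = KP.ofNR Δ (e u) := by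
    intro u
    obtain ⟨τ, h, rfl⟩ := hA.exists_eq_ofHom RNonneg.eq_one_of_isUnit u
    obtain ⟨v, rfl⟩ := Fan.exists_eq_pairing τ h
    rw [he, KP.ofNR_eq τ v, ← he', ConeComplex.toExt_ofHom]
  refine ⟨j, e, e', fun x => Points.ofHom (j (σ x)) (g x), hA.isOpenImmersion,
    fun τ => Set.ext fun x => hA.mem_range_iff τ x, hA.existsUnique_range, fun τ => ?_,
    fun τ h m => ?_, hcl.isEmbedding, Set.Subset.antisymm ?_ ?_, hext, he', fun x u => ?_,
    toAnPoint_injective, fun x => ?_⟩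
  · ext u
    constructor
    · rintro ⟨h, rfl⟩
      obtain ⟨v, rfl⟩ := Fan.exists_eq_pairing τ h
      change (e (Points.ofHom (j τ) (Fan.pairing τ v)) : NR M) ∈ τ.1
      rw [he]
      exact v.2
    · intro hu
      exact ⟨Fan.pairing τ ⟨u, hu⟩, he τ ⟨u, hu⟩⟩
  · obtain ⟨v, rfl⟩ := Fan.exists_eq_pairing τ h
    rw [he]
    rfl
  · rintro _ ⟨u, rfl⟩
    obtain ⟨τ, h, rfl⟩ := hA.exists_eq_ofHom eq_one_of_isUnit u
    rw [he']
    exact KP.ofRBar_mem_closure τ h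
  · refine closure_minimal ?_ hcl.isClosed_range
    rintro _ ⟨v, hv, rfl⟩
    obtain ⟨u, hu⟩ := e.surjective ⟨v, hv⟩
    exact ⟨ConeComplex.toExt u, by rw [hext, hu]⟩
  · exact ⟨fun h => eq_of_isTrop hA.exists_isOpenImmersion h (hg x), fun h => h ▸ hg x⟩
  · rw [he']
    exact (tropKP_eq_ofRBar x (hσ x) (hg' x)).symm
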